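/- **Setting.** Let $c_1,c_2,\nu_1,\nu_2,\phi_1,\phi_2\in\mathbb R$ with $c_1\neq c_2$, $\nu_1\neq0$, $\nu_2\neq 0$ and $(c_j/3)^3+(\nu_j/2)^2>0$ for $j=1,2$. With real cube roots put $$\beta_{j\pm}=\sqrt[3]{\sqrt{(c_j/3)^3+(\nu_j/2)^2}\pm\nu_j/2},\quad k_j=\tfrac{\sqrt3}{2}(\beta_{j-}+\beta_{j+}),\quad \kappa_j=\tfrac12(\beta_{j-}-\beta_{j+}),$$ $r_j=\sqrt{k_j^2+\kappa_j^2}$, $s_j=\operatorname{sgn}\kappa_j$, $\mu=(\nu_1-\nu_2)/(c_1-c_2)$, $s=1$ if $\kappa_1+\kappa_2\ge 0$ and $s=-1$ otherwise, $$\Omega=\sqrt{\big((k_1+k_2)^2+(\kappa_1+\kappa_2)^2\big)\big((k_1-k_2)^2+(\kappa_1+\kappa_2)^2\big)},\quad \Upsilon=\big((k_1-k_2)^2+(\kappa_1-\kappa_2)^2\big)\big((k_1+k_2)^2+(\kappa_1-\kappa_2)^2\big),$$ $$\Delta=\sqrt{\frac{(k_1-k_2)^2+(\kappa_1+\kappa_2)^2}{(k_1+k_2)^2+(\kappa_1+\kappa_2)^2}},\qquad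 \Gamma=\frac{(k_1-k_2)^2+(\kappa_1-\kappa_2)^2}{(k_1+k_2)^2+(\kappa_1-\kappa_2)^2},$$ and, with principal arguments in $(-\pi,\pi]$, $\gamma_1=\arg(k_1^2-k_2^2-(\kappa_1-\kappa_2)^2+2ik_1(\kappa_1-\kappa_2))$, $\gamma_2=\arg(k_2^2-k_1^2-(\kappa_1-\kappa_2)^2-2ik_2(\kappa_1-\kappa_2))$, $\delta_1=\arg(k_2^2-k_1^2+(\kappa_1+\kappa_2)^2+2ik_1(\kappa_1+\kappa_2))$, $\delta_2=\arg(k_1^2-k_2^2+(\kappa_1+\kappa_2)^2+2ik_2(\kappa_1+\kappa_2))$, $\lambda_j=\arg(\kappa_j(\kappa_j+ik_j))$, $\alpha_1=\frac{\lambda_2+\delta_1}2$, $\alpha_2=\frac{\lambda_1+\delta_2}2$, $\upsilon_1=\frac{\lambda_2-\delta_1}2$, $\upsilon_2=\frac{\lambda_1-\delta_2}2$, $\varpi_1=\frac{\lambda_1-\delta_1}2$, $\varpi_2=\frac{\lambda_2-\delta_2}2$. **2-solitons.** With $\xi_j=x-c_jt$ and $\theta=\kappa_1\xi_1-\kappa_2\xi_2+\mu(\xi_2-\xi_1)+\phi_1-\phi_2$,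 the oscillatory 2-soliton is $$u(t,x)=e^{i\phi_1}e^{i\nu_1t}e^{i\kappa_1\xi_1}V_1/W+e^{i\phi_2}e^{i\nu_2t}e^{i\kappa_2\xi_2}V_2/W .$$ For the Hirota equation $u_t+24|u|^2u_x+u_{xxx}=0$, $V_1=k_1\cosh(k_2\xi_2+i\gamma_2)$, $V_2=k_2\cosh(k_1\xi_1+i\gamma_1)$, $$W=\sqrt\Gamma\cosh(k_1\xi_1+k_2\xi_2)+\tfrac1{\sqrt\Gamma}\cosh(k_1\xi_1-k_2\xi_2)-\tfrac{4k_1k_2}{\sqrt\Upsilon}\cos\theta .$$ For the Sasa–Satsuma equation $u_t+6(u\bar u_x+3u_x\bar u)u+u_{xxx}=0$, $$\begin{aligned}V_1={}&k_1\sqrt{r_1}|2\kappa_1|^{1/2}\Big(|\kappa_2|\big(\sqrt{\Delta\Gamma}\cosh(k_1\xi_1+2k_2\xi_2+i(\alpha_2+\gamma_2))+\tfrac1{\sqrt{\Delta\Gamma}}\cosh(k_1\xi_1-2k_2\xi_2+i(\upsilon_2-\gamma_2))\big)\\&+r_2\big(-\tfrac{8k_2^2\kappa_2s}{\sqrt{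\Omega\Upsilon}}\cosh(k_1\xi_1+i(\varpi_1+\gamma_1))+\sqrt{\tfrac\Gamma\Delta}\cosh(k_1\xi_1+i(\alpha_2-\gamma_2))+\sqrt{\tfrac\Delta\Gamma}\cosh(k_1\xi_1+i(\upsilon_2+\gamma_2))\big)\Big)\\&+k_1k_2s\sqrt{\tfrac\Omega\Upsilon}\Big(k_2\sqrt{r_1}|8\kappa_1|^{1/2}s_2\cosh(k_1\xi_1+i(\varpi_1-\gamma_1))-k_1\sqrt{r_2}|32\kappa_2|^{1/2}s_1\operatorname{Re}\big(\cosh(k_2\xi_2+i(\gamma_2-\varpi_2))e^{i\theta}\big)\Big),\end{aligned}$$ $V_2$ is obtained from $V_1$ by interchanging the indices $1$ and $2$ (so that $\theta$ becomes $-\theta$), and $$\begin{aligned}W={}&|\kappa_1\kappa_2|\big(\Delta\Gamma\cosh(2(k_1\xi_1+k_2\xi_2))+\tfrac1{\Delta\Gamma}\cosh(2(k_1\xi_1-k_2\xi_2))\big)+2r_1|\kappa_2|\cosh(2k_2\xi_2)+2r_2|\kappa_1|\cosh(2k_1\xi_1)\\&+4k_1^2k_2^2s_1s_2\tfrac\O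mega\Upsilon\cos2\theta+r_1r_2\Big(\tfrac\Gamma\Delta+\tfrac\Delta\Gamma+\tfrac{64k_1^2k_2^2\kappa_1\kappa_2}{\Omega\Upsilon}\Big)\\&-16k_1k_2|\kappa_1\kappa_2|^{1/2}\sqrt{r_1r_2}\operatorname{Re}\Big(e^{i\theta}\big(\sqrt{\tfrac\Gamma\Upsilon}\cosh(k_1\xi_1+k_2\xi_2+i(\varpi_1-\varpi_2))+\tfrac1{\sqrt{\Gamma\Upsilon}}\cosh(k_1\xi_1-k_2\xi_2+i(\varpi_1+\varpi_2))\big)\Big).\end{aligned}$$ **Asymptotic 1-solitons.** For either sign $\pm$, the asymptotic 1-solitons as $(c_1-c_2)t\to\pm\infty$ are $$u_j^\pm(t,x)=e^{i(\phi_j\pm\eta_j)}e^{i\nu_jt}e^{i\kappa_j\xi_j^\pm}U_j(\xi_j^\pm),\qquad \xi_j^\pm=x-c_jt\mp x_j ,$$ where, in the Hirota case, $U_j(\xi)=\frac{k_j}{2\cosh(k_j\xi)}$, $x_1=-\frac{\ln\Gamma}{2k_1}$, $x_2=\frac{\ln\Gamma}{2k_2}$, $\eta_1=\gamma_2+\kappa_1x_1$,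 $\eta_2=-\gamma_1+\kappa_2x_2$, and, in the Sasa–Satsuma case, $U_j(\xi)=\frac{k_j(2|\kappa_j|)^{1/2}\sqrt{r_j}\cosh(k_j\xi+i\lambda_j/2)}{|\kappa_j|\cosh(2k_j\xi)+r_j}$, $x_1=-\frac{\ln(\Delta\Gamma)}{2k_1}$, $x_2=\frac{\ln(\Delta\Gamma)}{2k_2}$, $\eta_1=\gamma_2+\frac12\delta_2+\kappa_1x_1$, $\eta_2=-\gamma_1-\frac12\delta_1+\kappa_2x_2$. **Integrals.** For a field $u(t,x)$ define at time $t$ the angular twist, momentum, energy, Galilean energy and center of momentum $$\mathcal W=\int_{\mathbb R}\operatorname{Re}(iu\bar u_x)\,dx,\quad \mathcal P=\int_{\mathbb R}|u|^2dx,\quad \mathcal E=\int_{\mathbb R}3(4|u|^4-|u_x|^2)\,dx,$$ $$\mathcal C=\int_{\mathbb R}\big(3t(4|u|^4-|u_x|^2)-x|u|^2\big)dx,\quad \mathcal X(t)=\frac1{\mathcal P}\int_{\mathbb R}x|u|^2dx .$$ **Theorem.** In both cases, and for either sign $\pm$, the functions $u$, $u_1^\pm$, $u_2^\pm$ are smooth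 on $\mathbb R^2$, all these integrals converge absolutely at every time $t$, and the momenta are positive. Writing $\mathcal W_j,\mathcal P_j,\mathcal E_j,\mathcal C_j$ for the integrals of $u_j^\pm$ and $\mathcal W,\mathcal P,\mathcal E,\mathcal C,\mathcal X$ for those of $u$, one has for every $t\in\mathbb R$: (Hirota) - $\mathcal W=\mathcal W_1+\mathcal W_2=\frac{\sqrt3}8(\beta_{1-}^2-\beta_{1+}^2+\beta_{2-}^2-\beta_{2+}^2)$ with $\mathcal W_j=\frac12\kappa_jk_j$; - $\mathcal P=\mathcal P_1+\mathcal P_2=\frac{\sqrt3}4(\beta_{1-}+\beta_{1+}+\beta_{2-}+\beta_{2+})$ with $\mathcal P_j=\frac12k_j$; - $\mathcal E=\mathcal E_1+\mathcal E_2=\frac{\sqrt3}4\big((\beta_{1-}+\beta_{1+})c_1+(\beta_{2-}+\beta_{2+})c_2\big)$ with $\mathcal E_j=\frac12k_j(k_j^2-3\kappa_j^2)$; - $\mathcal C=\mathcal C_1+\mathcal C_2=0$ with $\mathcal C_j=\mp\frac12k_jx_j$. (Sasa–Satsuma) - $\mathcal P=\mathcal P_1+\mathcal P_2=\frac{\sqrt3}2(\beta_{1-}+\beta_{1+}+\beta_{2-}+\beta_{2+})$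 with $\mathcal P_j=k_j$; - $\mathcal E=\mathcal E_1+\mathcal E_2=\frac{\sqrt3}2\big((\beta_{1-}+\beta_{1+})c_1+(\beta_{2-}+\beta_{2+})c_2\big)$ with $\mathcal E_j=k_j(k_j^2-3\kappa_j^2)$; - $\mathcal C=\mathcal C_1+\mathcal C_2=0$ with $\mathcal C_j=\mp k_jx_j$. In both cases the center of momentum is $\mathcal X(t)=\frac{\mathcal E}{\mathcal P}\,t$, which moves at the constant speed $$\frac{\mathcal E}{\mathcal P}=\frac{\mathcal P_1c_1+\mathcal P_2c_2}{\mathcal P_1+\mathcal P_2}=\frac{(\beta_{1-}+\beta_{1+})c_1+(\beta_{2-}+\beta_{2+})c_2}{\beta_{1-}+\beta_{1+}+\beta_{2-}+\beta_{2+}} .$$ -/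

import Mathlib

open MeasureTheory
open scoped ContDiff ComplexConjugate

noncomputable section

namespace OscSoliton

/-! ### Conserved integrals of a complex field `u t x` -/

/-- Density `|u|²` of the momentum. -/
def momentumDensity (u : ℝ → ℝ → ℂ) (t x : ℝ) : ℝ := ‖u t x‖ ^ 2

/-- Density `3 (4 |u|⁴ - |u_x|²)` of the energy. The sign is the one for which
`∫ x |u|² dx` has time derivative equal to the energy. -/
def energyDensity (u : ℝ → ℝ → ℂ) (t x : ℝ) : ℝ :=
  3 * (4 * ‖u t x‖ ^ 4 - ‖deriv (u t) x‖ ^ 2)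

/-- Density `x |u|²` of the first moment of the momentum. -/
def momentDensity (u : ℝ → ℝ → ℂ) (t x : ℝ) : ℝ := x * ‖u t x‖ ^ 2

/-- Density of the Galilean energy. -/
def galileanDensity (u : ℝ → ℝ → ℂ) (t x : ℝ) : ℝ :=
  t * energyDensity u t x - momentDensity u t x

/-- Density `Re (i u ū_x)` of the angular twist. -/
def twistDensity (u : ℝ → ℝ → ℂ) (t x : ℝ) : ℝ :=
  (Complex.I * u t x * conj (deriv (u t) x)).re

/-- Momentum at time `t`. -/
def momentum (u : ℝ → ℝ → ℂ) (t : ℝ) : ℝ := ∫ x, momentumDensity u t x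

/-- Energy at time `t`. -/
def energy (u : ℝ → ℝ → ℂ) (t : ℝ) : ℝ := ∫ x, energyDensity u t x

/-- Galilean energy at time `t`. -/
def galileanEnergy (u : ℝ → ℝ → ℂ) (t : ℝ) : ℝ := ∫ x, galileanDensity u t x

/-- Angular twist at time `t`. -/
def angularTwist (u : ℝ → ℝ → ℂ) (t : ℝ) : ℝ := ∫ x, twistDensity u t x

/-- Center of momentum at time `t`. -/
def centerOfMomentum (u : ℝ → ℝ → ℂ) (t : ℝ) : ℝ :=
  1 / momentum u t * ∫ x, momentDensity u t x

/-- `u` is smooth, its momentum is positive, and all the integrals above converge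
absolutely at all times, so that none of them is a default value. -/
structure HasFiniteIntegrals (u : ℝ → ℝ → ℂ) : Prop where
  smooth : ContDiff ℝ ∞ (fun q : ℝ × ℝ => u q.1 q.2)
  integrable_momentum : ∀ t, Integrable (momentumDensity u t)
  integrable_energy : ∀ t, Integrable (energyDensity u t)
  integrable_moment : ∀ t, Integrable (momentDensity u t)
  integrable_galilean : ∀ t, Integrable (galileanDensity u t)
  integrable_twist : ∀ t, Integrable (twistDensity u t)
  momentum_pos : ∀ t, 0 < momentum u t

/-! ### Kinematic quantities of an oscillatory wave of speed `c` and frequency `ν` -/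

/-- The real cube root, odd in its argument. -/
def cbrt (x : ℝ) : ℝ := Real.sign x * |x| ^ (1 / 3 : ℝ)

theorem cbrt_pow_three (x : ℝ) : cbrt x ^ 3 = x := by
  have h : (|x| ^ (1 / 3 : ℝ)) ^ 3 = |x| := by
    rw [← Real.rpow_natCast, ← Real.rpow_mul (abs_nonneg x)]
    norm_num
  rw [cbrt, mul_pow, h]
  rcases lt_trichotomy x 0 with hx | hx | hx
  · rw [Real.sign_of_neg hx, abs_of_neg hx]; ring
  · simp [hx]
  · rw [Real.sign_of_pos hx, abs_of_pos hx]; ring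

/-- The kinematic discriminant, required to be positive. -/
def disc (c ν : ℝ) : ℝ := (c / 3) ^ 3 + (ν / 2) ^ 2

def betaPlus (c ν : ℝ) : ℝ := cbrt (√(disc c ν) + ν / 2)

def betaMinus (c ν : ℝ) : ℝ := cbrt (√(disc c ν) - ν / 2)

/-- The inverse width `k`. -/
def invWidth (c ν : ℝ) : ℝ := √3 * (betaMinus c ν + betaPlus c ν) / 2

/-- The wave number `κ`. -/
def waveNumber (c ν : ℝ) : ℝ := (betaMinus c ν - betaPlus c ν) / 2

/-! ### Oscillatory 1-solitons -/

/-- Hirota envelope. -/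
def hirotaEnvelope (k ξ : ℝ) : ℂ := ((k / (2 * Real.cosh (k * ξ)) : ℝ) : ℂ)

/-- Sasa-Satsuma envelope; `√√(k² + κ²)` is `(k² + κ²)^(1/4)`. -/
def sasaSatsumaEnvelope (k κ ξ : ℝ) : ℂ :=
  ((k * √(2 * |κ|) * √√(k ^ 2 + κ ^ 2) : ℝ) : ℂ)
    * Complex.cosh ((k * ξ : ℝ)
        + Complex.I * ((Complex.arg (κ * (κ + Complex.I * k)) / 2 : ℝ) : ℂ))
    / ((|κ| * Real.cosh (2 * k * ξ) + √(k ^ 2 + κ ^ 2) : ℝ) : ℂ)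

/-- The Hirota 1-soliton with speed `c`, frequency `ν`, phase `φ`, and position `x₀` at `t = 0`. -/
def hirotaOne (c ν φ x₀ t x : ℝ) : ℂ :=
  Complex.exp (Complex.I * φ) * Complex.exp (Complex.I * (ν * t : ℝ))
    * (Complex.exp (Complex.I * (waveNumber c ν * (x - c * t - x₀) : ℝ))
      * hirotaEnvelope (invWidth c ν) (x - c * t - x₀))

/-- The Sasa-Satsuma 1-soliton with speed `c`, frequency `ν`, phase `φ`, and position `x₀`
at `t = 0`. -/
def sasaSatsumaOne (c ν φ x₀ t x : ℝ) : ℂ :=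
  Complex.exp (Complex.I * φ) * Complex.exp (Complex.I * (ν * t : ℝ))
    * (Complex.exp (Complex.I * (waveNumber c ν * (x - c * t - x₀) : ℝ))
      * sasaSatsumaEnvelope (invWidth c ν) (waveNumber c ν) (x - c * t - x₀))

/-! ### Oscillatory 2-solitons -/

/-- Speeds, temporal frequencies and phases of the two waves. -/
structure Params where
  c₁ : ℝ
  c₂ : ℝ
  ν₁ : ℝ
  ν₂ : ℝ
  φ₁ : ℝ
  φ₂ : ℝ

namespace Params

def k₁ (p : Params) : ℝ := invWidth p.c₁ p.ν₁
def k₂ (p : Params) : ℝ := invWidth p.c₂ p.ν₂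
def κ₁ (p : Params) : ℝ := waveNumber p.c₁ p.ν₁
def κ₂ (p : Params) : ℝ := waveNumber p.c₂ p.ν₂

/-- `r₁ = (k₁² + κ₁²)^(1/2)`; correspondingly `√r₁ = (k₁² + κ₁²)^(1/4)`. -/
def r₁ (p : Params) : ℝ := √(p.k₁ ^ 2 + p.κ₁ ^ 2)
def r₂ (p : Params) : ℝ := √(p.k₂ ^ 2 + p.κ₂ ^ 2)

def μ (p : Params) : ℝ := (p.ν₁ - p.ν₂) / (p.c₁ - p.c₂)

def Ω (p : Params) : ℝ :=
  √(((p.k₁ + p.k₂) ^ 2 + (p.κ₁ + p.κ₂) ^ 2) * ((p.k₁ - p.k₂) ^ 2 + (p.κ₁ + p.κ₂) ^ 2))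

def Υ (p : Params) : ℝ :=
  ((p.k₁ - p.k₂) ^ 2 + (p.κ₁ - p.κ₂) ^ 2) * ((p.k₁ + p.k₂) ^ 2 + (p.κ₁ - p.κ₂) ^ 2)

def Δ (p : Params) : ℝ :=
  √(((p.k₁ - p.k₂) ^ 2 + (p.κ₁ + p.κ₂) ^ 2) / ((p.k₁ + p.k₂) ^ 2 + (p.κ₁ + p.κ₂) ^ 2))

def Γ (p : Params) : ℝ :=
  ((p.k₁ - p.k₂) ^ 2 + (p.κ₁ - p.κ₂) ^ 2) / ((p.k₁ + p.k₂) ^ 2 + (p.κ₁ - p.κ₂) ^ 2)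

def γ₁ (p : Params) : ℝ :=
  Complex.arg ⟨p.k₁ ^ 2 - p.k₂ ^ 2 - (p.κ₁ - p.κ₂) ^ 2, 2 * p.k₁ * (p.κ₁ - p.κ₂)⟩

def γ₂ (p : Params) : ℝ :=
  Complex.arg ⟨p.k₂ ^ 2 - p.k₁ ^ 2 - (p.κ₁ - p.κ₂) ^ 2, -(2 * p.k₂ * (p.κ₁ - p.κ₂))⟩

def δ₁ (p : Params) : ℝ :=
  Complex.arg ⟨p.k₂ ^ 2 - p.k₁ ^ 2 + (p.κ₁ + p.κ₂) ^ 2, 2 * p.k₁ * (p.κ₁ + p.κ₂)⟩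

def δ₂ (p : Params) : ℝ :=
  Complex.arg ⟨p.k₁ ^ 2 - p.k₂ ^ 2 + (p.κ₁ + p.κ₂) ^ 2, 2 * p.k₂ * (p.κ₁ + p.κ₂)⟩

def lam₁ (p : Params) : ℝ := Complex.arg (p.κ₁ * (p.κ₁ + Complex.I * p.k₁))
def lam₂ (p : Params) : ℝ := Complex.arg (p.κ₂ * (p.κ₂ + Complex.I * p.k₂))

def α₁ (p : Params) : ℝ := (p.lam₂ + p.δ₁) / 2
def α₂ (p : Params) : ℝ := (p.lam₁ + p.δ₂) / 2
def υ₁ (p : Params) : ℝ := (p.lam₂ - p.δ₁) / 2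
def υ₂ (p : Params) : ℝ := (p.lam₁ - p.δ₂) / 2
def ϖ₁ (p : Params) : ℝ := (p.lam₁ - p.δ₁) / 2
def ϖ₂ (p : Params) : ℝ := (p.lam₂ - p.δ₂) / 2

def s₁ (p : Params) : ℝ := Real.sign p.κ₁
def s₂ (p : Params) : ℝ := Real.sign p.κ₂

/-- The sign of `κ₁ + κ₂`, taken as `1` at zero. This is the sign that goes with half-angles
`δ₁ / 2`, `δ₂ / 2` of principal arguments. -/
def s (p : Params) : ℝ := if 0 ≤ p.κ₁ + p.κ₂ then 1 else -1

/-- The relative phase of the two waves. -/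
def θ (p : Params) (ξ₁ ξ₂ : ℝ) : ℝ :=
  p.κ₁ * ξ₁ - p.κ₂ * ξ₂ + p.μ * (ξ₂ - ξ₁) + p.φ₁ - p.φ₂

/-- `cosh (a + i b)` for real `a`, `b`. -/
def coshI (a b : ℝ) : ℂ := Complex.cosh (a + Complex.I * b)

/-- `exp (i b)` for real `b`. -/
def expI (b : ℝ) : ℂ := Complex.exp (Complex.I * b)

def VH₁ (p : Params) (_ξ₁ ξ₂ : ℝ) : ℂ := p.k₁ * coshI (p.k₂ * ξ₂) p.γ₂

def VH₂ (p : Params) (ξ₁ _ξ₂ : ℝ) : ℂ := p.k₂ * coshI (p.k₁ * ξ₁) p.γ₁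

def WH (p : Params) (ξ₁ ξ₂ : ℝ) : ℝ :=
  √p.Γ * Real.cosh (p.k₁ * ξ₁ + p.k₂ * ξ₂) + 1 / √p.Γ * Real.cosh (p.k₁ * ξ₁ - p.k₂ * ξ₂)
    - 4 * p.k₁ * p.k₂ / √p.Υ * Real.cos (p.θ ξ₁ ξ₂)

def VS₁ (p : Params) (ξ₁ ξ₂ : ℝ) : ℂ :=
  (p.k₁ * √p.r₁ * √|2 * p.κ₁| : ℝ)
      * ((|p.κ₂| : ℝ)
          * ((√(p.Δ * p.Γ) : ℝ) * coshI (p.k₁ * ξ₁ + 2 * p.k₂ * ξ₂) (p.α₂ + p.γ₂)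
            + (1 / √(p.Δ * p.Γ) : ℝ) * coshI (p.k₁ * ξ₁ - 2 * p.k₂ * ξ₂) (p.υ₂ - p.γ₂))
        + (p.r₂ : ℝ)
          * ((-8 * p.k₂ ^ 2 * p.κ₂ * p.s * (1 / √(p.Ω * p.Υ)) : ℝ)
              * coshI (p.k₁ * ξ₁) (p.ϖ₁ + p.γ₁)
            + (√(p.Γ / p.Δ) : ℝ) * coshI (p.k₁ * ξ₁) (p.α₂ - p.γ₂)
            + (√(p.Δ / p.Γ) : ℝ) * coshI (p.k₁ * ξ₁) (p.υ₂ + p.γ₂)))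
    + (p.k₁ * p.k₂ * p.s * √(p.Ω / p.Υ) : ℝ)
      * ((p.k₂ * √p.r₁ * √|8 * p.κ₁| * p.s₂ : ℝ) * coshI (p.k₁ * ξ₁) (p.ϖ₁ - p.γ₁)
        - (p.k₁ * √p.r₂ * √|32 * p.κ₂| * p.s₁
            * (coshI (p.k₂ * ξ₂) (p.γ₂ - p.ϖ₂) * expI (p.θ ξ₁ ξ₂)).re : ℝ))

def VS₂ (p : Params) (ξ₁ ξ₂ : ℝ) : ℂ :=
  (p.k₂ * √p.r₂ * √|2 * p.κ₂| : ℝ)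
      * ((|p.κ₁| : ℝ)
          * ((√(p.Δ * p.Γ) : ℝ) * coshI (p.k₂ * ξ₂ + 2 * p.k₁ * ξ₁) (p.α₁ + p.γ₁)
            + (1 / √(p.Δ * p.Γ) : ℝ) * coshI (p.k₂ * ξ₂ - 2 * p.k₁ * ξ₁) (p.υ₁ - p.γ₁))
        + (p.r₁ : ℝ)
          * ((-8 * p.k₁ ^ 2 * p.κ₁ * p.s * (1 / √(p.Ω * p.Υ)) : ℝ)
              * coshI (p.k₂ * ξ₂) (p.ϖ₂ + p.γ₂)
            + (√(p.Γ / p.Δ) : ℝ) * coshI (p.k₂ * ξ₂) (p.α₁ - p.γ₁)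
            + (√(p.Δ / p.Γ) : ℝ) * coshI (p.k₂ * ξ₂) (p.υ₁ + p.γ₁)))
    + (p.k₁ * p.k₂ * p.s * √(p.Ω / p.Υ) : ℝ)
      * ((p.k₁ * √p.r₂ * √|8 * p.κ₂| * p.s₁ : ℝ) * coshI (p.k₂ * ξ₂) (p.ϖ₂ - p.γ₂)
        - (p.k₂ * √p.r₁ * √|32 * p.κ₁| * p.s₂
            * (coshI (p.k₁ * ξ₁) (p.γ₁ - p.ϖ₁) * expI (-p.θ ξ₁ ξ₂)).re : ℝ))

def WS (p : Params) (ξ₁ ξ₂ : ℝ) : ℝ :=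
  |p.κ₁ * p.κ₂|
      * (p.Δ * p.Γ * Real.cosh (2 * (p.k₁ * ξ₁ + p.k₂ * ξ₂))
        + 1 / (p.Δ * p.Γ) * Real.cosh (2 * (p.k₁ * ξ₁ - p.k₂ * ξ₂)))
    + 2 * p.r₁ * |p.κ₂| * Real.cosh (2 * p.k₂ * ξ₂)
    + 2 * p.r₂ * |p.κ₁| * Real.cosh (2 * p.k₁ * ξ₁)
    + 4 * p.k₁ ^ 2 * p.k₂ ^ 2 * p.s₁ * p.s₂ * (p.Ω / p.Υ) * Real.cos (2 * p.θ ξ₁ ξ₂)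
    + p.r₁ * p.r₂
      * (p.Γ / p.Δ + p.Δ / p.Γ
        + 64 * p.k₁ ^ 2 * p.k₂ ^ 2 * p.κ₁ * p.κ₂ * (1 / (p.Ω * p.Υ)))
    - 16 * p.k₁ * p.k₂ * √|p.κ₁ * p.κ₂| * √p.r₁ * √p.r₂
      * (expI (p.θ ξ₁ ξ₂)
        * ((√(p.Γ / p.Υ) : ℝ) * coshI (p.k₁ * ξ₁ + p.k₂ * ξ₂) (p.ϖ₁ - p.ϖ₂)
          + (1 / √(p.Γ * p.Υ) : ℝ) * coshI (p.k₁ * ξ₁ - p.k₂ * ξ₂) (p.ϖ₁ + p.ϖ₂))).re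

/-- The superposition `e^{iφ₁} e^{iν₁t} f₁(ξ₁, ξ₂) + e^{iφ₂} e^{iν₂t} f₂(ξ₁, ξ₂)` with
`ξⱼ = x - cⱼ t` and `fⱼ = e^{iκⱼξⱼ} Vⱼ / W`. -/
def superpose (p : Params) (V₁ V₂ : ℝ → ℝ → ℂ) (W : ℝ → ℝ → ℝ) (t x : ℝ) : ℂ :=
  expI p.φ₁ * expI (p.ν₁ * t)
      * (expI (p.κ₁ * (x - p.c₁ * t)) * V₁ (x - p.c₁ * t) (x - p.c₂ * t)
        / W (x - p.c₁ * t) (x - p.c₂ * t))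
    + expI p.φ₂ * expI (p.ν₂ * t)
      * (expI (p.κ₂ * (x - p.c₂ * t)) * V₂ (x - p.c₁ * t) (x - p.c₂ * t)
        / W (x - p.c₁ * t) (x - p.c₂ * t))

/-- The Hirota oscillatory 2-soliton. -/
def hirota (p : Params) : ℝ → ℝ → ℂ := p.superpose p.VH₁ p.VH₂ p.WH

/-- The Sasa-Satsuma oscillatory 2-soliton. -/
def sasaSatsuma (p : Params) : ℝ → ℝ → ℂ := p.superpose p.VS₁ p.VS₂ p.WS

/-! ### Asymptotic 1-solitons

The sign `σ = ±1` is that of `(c₁ - c₂) t` as `(c₁ - c₂) t → ±∞`. -/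

def xH₁ (p : Params) : ℝ := -(Real.log p.Γ / (2 * p.k₁))
def xH₂ (p : Params) : ℝ := Real.log p.Γ / (2 * p.k₂)
def xS₁ (p : Params) : ℝ := -(Real.log (p.Δ * p.Γ) / (2 * p.k₁))
def xS₂ (p : Params) : ℝ := Real.log (p.Δ * p.Γ) / (2 * p.k₂)

def hirotaAsymptotic₁ (p : Params) (σ : ℝ) : ℝ → ℝ → ℂ :=
  hirotaOne p.c₁ p.ν₁ (p.φ₁ + σ * (p.γ₂ + p.κ₁ * p.xH₁)) (σ * p.xH₁)

def hirotaAsymptotic₂ (p : Params) (σ : ℝ) : ℝ → ℝ → ℂ :=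
  hirotaOne p.c₂ p.ν₂ (p.φ₂ + σ * (-p.γ₁ + p.κ₂ * p.xH₂)) (σ * p.xH₂)

def sasaSatsumaAsymptotic₁ (p : Params) (σ : ℝ) : ℝ → ℝ → ℂ :=
  sasaSatsumaOne p.c₁ p.ν₁ (p.φ₁ + σ * (p.γ₂ + p.δ₂ / 2 + p.κ₁ * p.xS₁)) (σ * p.xS₁)

def sasaSatsumaAsymptotic₂ (p : Params) (σ : ℝ) : ℝ → ℝ → ℂ :=
  sasaSatsumaOne p.c₂ p.ν₂ (p.φ₂ + σ * (-p.γ₁ - p.δ₁ / 2 + p.κ₂ * p.xS₂)) (σ * p.xS₂)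

/-- `β₁₋`, `β₁₊`, `β₂₋`, `β₂₊`. -/
def β₁m (p : Params) : ℝ := betaMinus p.c₁ p.ν₁
def β₁p (p : Params) : ℝ := betaPlus p.c₁ p.ν₁
def β₂m (p : Params) : ℝ := betaMinus p.c₂ p.ν₂
def β₂p (p : Params) : ℝ := betaPlus p.c₂ p.ν₂

end Params

end OscSoliton

end

open OscSoliton

open Filter Topology

noncomputable section

namespace OscSoliton

/-! ### Derivatives of determinants and inverses of matrices -/

section MatrixCalculus

variable {n : ℕ}

/-! At each fixed time every soliton in the statement is, up to a constant factor, a component of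
one kind of reflectionless profile. Take poles k_j with positive real part, the row p(x) with
entries P_j e^{k_j x}, constant rows q_c, and let M solve the Lyapunov equation K⋆M + MK = p⋆p + q⋆q
with K = diag k. The profile is v_c = p M⁻¹ q_c⋆. Time enters only through the amplitudes P_j, and
the evolution equations themselves are never used.

Since M' = p⋆p has rank one, the moments S a b = pKᵃ M⁻¹ (pKᵇ)⋆ have derivatives that are sums of
products of profile moments. Thus S 0 0 is an antiderivative of |v|², Im S 0 1 of the twist density,
and `A`, built on the moments of order two, of the energy density. Moreover S 0 0 = (log det M)', so
x S 0 0 - log det M is an antiderivative of x|v|². The moments S vanish at -∞, and their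
counterparts Q, formed with q in place of p, vanish at +∞. By the Lyapunov equation suitable
combinations of S + Q are constant, with values 2ΣRe k_j, -2iΣIm k_j² and 2ΣRe k_j³ (`trace_zero`,
`trace_one`, `trace_two`). Hence momentum, twist and energy are sums over poles, which is why they
add over the waves.

The first moment (`integral_mul_V`) is determined by the determinants of M at both ends and by Σ
log|P_j|. The amplitudes are normalized so that their moduli cancel against the ratio of the
determinants, and what remains is linear in the positions c_j t. Cardano's formula behind k and κ
gives c = k² - 3κ² (`speed_eq`), that is Re (k + iκ)³ = kc. So the first moment of a 2-soliton is t
times its energy and its Galilean energy vanishes.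

It remains to recognize the explicit formulas as profiles. Cramer's rule (`invForm_eq_det`) writes v
as a quotient of determinants. For Hirota these are 2×2 with poles k_j + iκ_j. For Sasa-Satsuma they
are 4×4, with the two poles, their conjugates and two conjugate components; every coefficient is
then a rational identity in the poles (`PolePair`), and the angles and square roots of the statement
are the polar forms of these rational functions. Invertibility of M also shows that W has no zeros,
whence smoothness. -/

theorem hasDerivAt_det {M : ℝ → Matrix (Fin n) (Fin n) ℂ} {M' : Matrix (Fin n) (Fin n) ℂ} {x : ℝ}
    (h : ∀ i j, HasDerivAt (fun y => M y i j) (M' i j) x) :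
    HasDerivAt (fun y => (M y).det) ((M x).adjugate * M').trace x := by
  have key : HasDerivAt (fun y => (M y).det)
      (∑ σ : Equiv.Perm (Fin n), (Equiv.Perm.sign σ : ℂ) *
        ∑ i, (∏ j ∈ Finset.univ.erase i, M x (σ j) j) • M' (σ i) i) x := by
    simp only [Matrix.det_apply']
    refine HasDerivAt.fun_sum fun σ _ => HasDerivAt.const_mul _ ?_
    exact HasDerivAt.fun_finsetProd fun i _ => h (σ i) i
  convert key using 1
  -- By Cramer's rule a diagonal entry of adj(M) M' is det M with one column replaced by that of M'.
  -- These are the terms produced by differentiating the Leibniz sum factor by factor.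
  have hcol : ∀ i, ((M x).adjugate * M') i i = ((M x).updateCol i fun r => M' r i).det := by
    intro i
    rw [← Matrix.cramer_apply, Matrix.cramer_eq_adjugate_mulVec]
    rfl
  simp only [Matrix.trace, Matrix.diag, hcol, Matrix.det_apply', Finset.mul_sum]
  rw [Finset.sum_comm]
  refine Finset.sum_congr rfl fun σ _ => Finset.sum_congr rfl fun i _ => ?_
  congr 1
  rw [← Finset.prod_erase_mul _ _ (Finset.mem_univ i), smul_eq_mul]
  congr 1
  · refine Finset.prod_congr rfl fun j hj => ?_
    simp [Finset.ne_of_mem_erase hj]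
  · simp

/-- The adjugate formula shows that the entries are differentiable; differentiating M⁻¹M = 1 then
determines the derivative. -/
theorem hasDerivAt_inv_apply {M : ℝ → Matrix (Fin n) (Fin n) ℂ} {M' : Matrix (Fin n) (Fin n) ℂ}
    {x : ℝ} (h : ∀ i j, HasDerivAt (fun y => M y i j) (M' i j) x) (h0 : (M x).det ≠ 0)
    (i j : Fin n) :
    HasDerivAt (fun y => (M y)⁻¹ i j) (-((M x)⁻¹ * M' * (M x)⁻¹) i j) x := by
  have hdet := hasDerivAt_det h
  have hdiff : ∀ a b, DifferentiableAt ℝ (fun y => (M y)⁻¹ a b) x := by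
    intro a b
    have : ∀ y, (M y)⁻¹ a b = (M y).det⁻¹ * ((M y).updateRow b (Pi.single a 1)).det := by
      intro y
      rw [Matrix.inv_def, Matrix.smul_apply, Ring.inverse_eq_inv', Matrix.adjugate_apply,
        smul_eq_mul]
    simp only [this]
    refine (hdet.differentiableAt.inv h0).mul ?_
    -- The replaced row is constant, so its derivative row is zero.
    refine (hasDerivAt_det (M' := M'.updateRow b 0) fun r s => ?_).differentiableAt
    by_cases hr : r = b
    · subst hr; simpa using hasDerivAt_const x _
    · simpa [Matrix.updateRow_apply, hr] using h r s
  have hev : ∀ᶠ y in 𝓝 x, (M y).det ≠ 0 := hdet.continuousAt.eventually_ne h0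
  set R' : Matrix (Fin n) (Fin n) ℂ := Matrix.of fun a b => deriv (fun y => (M y)⁻¹ a b) x
  have hR : ∀ a b, HasDerivAt (fun y => (M y)⁻¹ a b) (R' a b) x := fun a b =>
    (hdiff a b).hasDerivAt
  have hprod : R' * M x + (M x)⁻¹ * M' = 0 := by
    ext a b
    have h1 : HasDerivAt (fun y => ((M y)⁻¹ * M y) a b) ((R' * M x + (M x)⁻¹ * M') a b) x := by
      simp only [Matrix.mul_apply, Matrix.add_apply, ← Finset.sum_add_distrib]
      exact HasDerivAt.fun_sum fun c _ => (hR a c).mul (h c b)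
    have h2 : HasDerivAt (fun y => ((M y)⁻¹ * M y) a b) 0 x := by
      -- M⁻¹M = 1 is available only near x, where the determinant stays nonzero; this suffices for
      -- the derivative.
      refine (hasDerivAt_const x ((1 : Matrix (Fin n) (Fin n) ℂ) a b)).congr_of_eventuallyEq ?_
      filter_upwards [hev] with y hy
      rw [Matrix.nonsing_inv_mul _ (Ne.isUnit hy)]
    exact h1.unique h2
  have hfin : R' = -((M x)⁻¹ * M' * (M x)⁻¹) := by
    have := congrArg (· * (M x)⁻¹) (eq_neg_of_add_eq_zero_left hprod)
    simpa [Matrix.mul_assoc, Matrix.mul_nonsing_inv _ (Ne.isUnit h0)] using this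
  rw [← Matrix.neg_apply, ← hfin]
  exact hR i j

end MatrixCalculus

/-! ### The Hermitian solution of a Lyapunov equation -/

section Lyapunov

variable {n : ℕ} {α : Type*} [Fintype α]

/-- The solution `M` of the Lyapunov equation `K⋆ M + M K = p⋆ p + q⋆ q` with `K = diag k`, where
`p` is a row vector and `q` is a matrix with rows `q a`. -/
def lyapunovMatrix (k p : Fin n → ℂ) (q : α → Fin n → ℂ) : Matrix (Fin n) (Fin n) ℂ :=
  Matrix.of fun i j => (conj (p i) * p j + ∑ a, conj (q a i) * q a j) / (conj (k i) + k j)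

/-- The sesquilinear form `g M⁻¹ h⋆` of row vectors. -/
def invForm (M : Matrix (Fin n) (Fin n) ℂ) (g h : Fin n → ℂ) : ℂ :=
  ∑ i, ∑ j, g i * M⁻¹ i j * conj (h j)

variable {k p : Fin n → ℂ} {q : α → Fin n → ℂ}

theorem conj_add_ne_zero (hk : ∀ i, 0 < (k i).re) (i j : Fin n) : conj (k i) + k j ≠ 0 := by
  intro h
  have := congrArg Complex.re h
  simp only [Complex.add_re, Complex.conj_re, Complex.zero_re] at this
  linarith [hk i, hk j]

theorem lyapunovMatrix_eq (hk : ∀ i, 0 < (k i).re) (i j : Fin n) :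
    conj (k i) * lyapunovMatrix k p q i j + lyapunovMatrix k p q i j * k j
      = conj (p i) * p j + ∑ a, conj (q a i) * q a j := by
  have := conj_add_ne_zero hk i j
  simp only [lyapunovMatrix, Matrix.of_apply]
  field_simp

theorem lyapunovMatrix_conj (i j : Fin n) :
    conj (lyapunovMatrix k p q i j) = lyapunovMatrix k p q j i := by
  simp only [lyapunovMatrix, Matrix.of_apply, map_div₀, map_add, map_mul, map_sum,
    Complex.conj_conj]
  congr 1
  · simp only [mul_comm]
  · ring

theorem lyapunovMatrix_isHermitian : (lyapunovMatrix k p q).IsHermitian := by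
  ext i j
  exact lyapunovMatrix_conj j i

theorem lyapunovMatrix_inv_conj (i j : Fin n) :
    conj ((lyapunovMatrix k p q)⁻¹ i j) = (lyapunovMatrix k p q)⁻¹ j i := by
  have := (lyapunovMatrix_isHermitian (k := k) (p := p) (q := q)).inv
  exact this.apply j i

theorem lyapunovMatrix_det_conj : conj (lyapunovMatrix k p q).det = (lyapunovMatrix k p q).det := by
  have h := Matrix.det_conjTranspose (lyapunovMatrix k p q)
  rw [lyapunovMatrix_isHermitian.eq] at h
  exact h.symm

/-- Pairing the Lyapunov equation with a kernel vector ξ on both sides gives |pξ|² + Σ|q_a ξ|² = 0.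
Applying the equation to ξ once more gives M K ξ = 0, so the kernel is invariant under K. -/
theorem lyapunovMatrix_ker (hk : ∀ i, 0 < (k i).re) {ξ : Fin n → ℂ}
    (hξ : (lyapunovMatrix k p q).mulVec ξ = 0) :
    ∑ j, p j * ξ j = 0 ∧ (∀ a, ∑ j, q a j * ξ j = 0) ∧
      (lyapunovMatrix k p q).mulVec (fun j => k j * ξ j) = 0 := by
  set M := lyapunovMatrix k p q with hM
  have h0 : ∀ i, ∑ j, M i j * ξ j = 0 := fun i => congrFun hξ i
  have h1 : ∀ j, ∑ i, conj (ξ i) * M i j = 0 := by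
    intro j
    have := congrArg conj (h0 j)
    simpa [map_sum, hM, lyapunovMatrix_conj, mul_comm] using this
  have hrow : ∀ i, ∑ j, M i j * (k j * ξ j)
      = conj (p i) * ∑ j, p j * ξ j + ∑ a, conj (q a i) * ∑ j, q a j * ξ j := by
    intro i
    have e : ∑ j, (conj (k i) * M i j + M i j * k j) * ξ j
        = ∑ j, (conj (p i) * p j + ∑ a, conj (q a i) * q a j) * ξ j :=
      Finset.sum_congr rfl fun j _ => by rw [hM, lyapunovMatrix_eq hk]
    have e1 : ∑ j, (conj (k i) * M i j + M i j * k j) * ξ j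
        = conj (k i) * ∑ j, M i j * ξ j + ∑ j, M i j * (k j * ξ j) := by
      rw [Finset.mul_sum, ← Finset.sum_add_distrib]
      exact Finset.sum_congr rfl fun j _ => by ring
    rw [h0, mul_zero, zero_add] at e1
    rw [← e1, e]
    simp only [add_mul, Finset.sum_add_distrib, Finset.mul_sum, Finset.sum_mul, mul_assoc]
    rw [Finset.sum_comm (s := Finset.univ (α := Fin n))]
  -- Since ξ⋆M = 0 as well, ξ⋆MKξ vanishes, and the right side of the Lyapunov equation leaves a sum
  -- of squares.
  have hquad : conj (∑ j, p j * ξ j) * (∑ j, p j * ξ j)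
      + ∑ a, conj (∑ j, q a j * ξ j) * (∑ j, q a j * ξ j) = 0 := by
    have e : ∑ i, conj (ξ i) * ∑ j, M i j * (k j * ξ j) = 0 := by
      simp only [Finset.mul_sum]
      rw [Finset.sum_comm]
      refine Finset.sum_eq_zero fun j _ => ?_
      have : ∑ i, conj (ξ i) * (M i j * (k j * ξ j)) = (∑ i, conj (ξ i) * M i j) * (k j * ξ j) := by
        rw [Finset.sum_mul]; exact Finset.sum_congr rfl fun i _ => by ring
      rw [this, h1, zero_mul]
    rw [← e]
    have hpair : ∀ (r : Fin n → ℂ) (c : ℂ),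
        conj (∑ j, r j * ξ j) * c = ∑ i, conj (ξ i) * (conj (r i) * c) := by
      intro r c
      rw [map_sum, Finset.sum_mul]
      exact Finset.sum_congr rfl fun i _ => by rw [map_mul]; ring
    simp only [hrow, hpair, mul_add, Finset.sum_add_distrib]
    congr 1
    rw [Finset.sum_comm]
    simp only [Finset.mul_sum]
  have hre : ∀ z : ℂ, conj z * z = ((‖z‖ ^ 2 : ℝ) : ℂ) := by
    intro z
    rw [mul_comm, Complex.mul_conj, Complex.normSq_eq_norm_sq]
  simp only [hre, ← Complex.ofReal_sum, ← Complex.ofReal_add] at hquad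
  have hq0 := Complex.ofReal_eq_zero.mp hquad
  have hp : ∑ j, p j * ξ j = 0 := by
    have : ‖∑ j, p j * ξ j‖ ^ 2 ≤ 0 := by
      have : 0 ≤ ∑ a, ‖∑ j, q a j * ξ j‖ ^ 2 := Finset.sum_nonneg fun a _ => sq_nonneg _
      linarith
    exact norm_eq_zero.mp (pow_eq_zero_iff (two_ne_zero) |>.mp (le_antisymm this (sq_nonneg _)))
  have hqa : ∀ a, ∑ j, q a j * ξ j = 0 := by
    have hs : ∑ a, ‖∑ j, q a j * ξ j‖ ^ 2 = 0 := by
      refine le_antisymm ?_ (Finset.sum_nonneg fun a _ => sq_nonneg _)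
      nlinarith [sq_nonneg ‖∑ j, p j * ξ j‖]
    intro a
    have := (Finset.sum_eq_zero_iff_of_nonneg fun a _ => sq_nonneg _).mp hs a (Finset.mem_univ a)
    exact norm_eq_zero.mp (pow_eq_zero_iff (two_ne_zero) |>.mp this)
  refine ⟨hp, hqa, ?_⟩
  ext i
  have := hrow i
  simpa [hp, hqa, Matrix.mulVec, dotProduct] using this

/-- This is the observability criterion: the kernel is K-invariant and annihilated by p and every q
a, and distinct poles separate the coordinates. It is stated so that either p or q may vanish, which
covers the limits of M at both ends of the line. -/
theorem lyapunovMatrix_det_ne_zero (hk : ∀ i, 0 < (k i).re) (hinj : Function.Injective k)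
    (hobs : ∀ j, p j ≠ 0 ∨ ∃ a, q a j ≠ 0) : (lyapunovMatrix k p q).det ≠ 0 := by
  intro hdet
  obtain ⟨ξ, hξ, hM⟩ := Matrix.exists_mulVec_eq_zero_iff.mpr hdet
  have hpow : ∀ m : ℕ, (lyapunovMatrix k p q).mulVec (fun j => k j ^ m * ξ j) = 0 := by
    intro m
    induction m with
    | zero => simpa using hM
    | succ m ih =>
      have := (lyapunovMatrix_ker hk ih).2.2
      simpa only [← mul_assoc, ← pow_succ'] using this
  -- Vandermonde: Σ p_j ξ_j k_j^m = 0 for every m, with distinct nodes k_j.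
  have hp : (fun j => p j * ξ j) = 0 := by
    refine Matrix.eq_zero_of_forall_pow_sum_mul_pow_eq_zero hinj fun m => ?_
    rw [← (lyapunovMatrix_ker hk (hpow m)).1]
    exact Finset.sum_congr rfl fun j _ => by ring
  have hq : ∀ a, (fun j => q a j * ξ j) = 0 := by
    intro a
    refine Matrix.eq_zero_of_forall_pow_sum_mul_pow_eq_zero hinj fun m => ?_
    rw [← (lyapunovMatrix_ker hk (hpow m)).2.1 a]
    exact Finset.sum_congr rfl fun j _ => by ring
  refine hξ (funext fun j => ?_)
  rcases hobs j with h | ⟨a, h⟩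
  · exact (mul_eq_zero.mp (congrFun hp j)).resolve_left h
  · exact (mul_eq_zero.mp (congrFun (hq a) j)).resolve_left h

theorem invForm_conj (g h : Fin n → ℂ) :
    conj (invForm (lyapunovMatrix k p q) g h) = invForm (lyapunovMatrix k p q) h g := by
  simp only [invForm, map_sum, map_mul, Complex.conj_conj, lyapunovMatrix_inv_conj]
  rw [Finset.sum_comm]
  exact Finset.sum_congr rfl fun i _ => Finset.sum_congr rfl fun j _ => by ring

/-- A rank-one matrix between two inverses splits the form into a product. This turns both the
derivative of M⁻¹ and the Lyapunov equation into relations among scalar moments. -/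
theorem sum_inv_mul_rankOne_mul_inv (M : Matrix (Fin n) (Fin n) ℂ) (g h r : Fin n → ℂ) :
    ∑ i, ∑ j, g i * (M⁻¹ * Matrix.of (fun a b => conj (r a) * r b) * M⁻¹) i j * conj (h j)
      = invForm M g r * invForm M r h := by
  have h1 : ∀ i j, (M⁻¹ * Matrix.of (fun a b => conj (r a) * r b) * M⁻¹) i j
      = (∑ a, M⁻¹ i a * conj (r a)) * ∑ b, r b * M⁻¹ b j := by
    intro i j
    simp only [Matrix.mul_apply, Matrix.of_apply, Finset.mul_sum, Finset.sum_mul]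
    exact Finset.sum_congr rfl fun b _ => Finset.sum_congr rfl fun a _ => by ring
  have h2 : invForm M g r = ∑ i, g i * ∑ a, M⁻¹ i a * conj (r a) := by
    simp only [invForm, Finset.mul_sum, mul_assoc]
  have h3 : invForm M r h = ∑ j, (∑ b, r b * M⁻¹ b j) * conj (h j) := by
    rw [invForm, Finset.sum_comm]
    simp only [Finset.sum_mul]
  rw [h2, h3, Finset.sum_mul_sum]
  exact Finset.sum_congr rfl fun i _ => Finset.sum_congr rfl fun j _ => by rw [h1]; ring

/-- The Lyapunov equation multiplied by M⁻¹ on both sides. -/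
theorem lyapunovMatrix_inv_eq (hk : ∀ i, 0 < (k i).re) (h0 : (lyapunovMatrix k p q).det ≠ 0)
    (i j : Fin n) :
    k i * (lyapunovMatrix k p q)⁻¹ i j + (lyapunovMatrix k p q)⁻¹ i j * conj (k j)
      = ((lyapunovMatrix k p q)⁻¹ * Matrix.of (fun a b => conj (p a) * p b) *
          (lyapunovMatrix k p q)⁻¹) i j
        + ∑ c, ((lyapunovMatrix k p q)⁻¹ * Matrix.of (fun a b => conj (q c a) * q c b) *
          (lyapunovMatrix k p q)⁻¹) i j := by
  set M := lyapunovMatrix k p q with hM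
  have hMR := Matrix.mul_nonsing_inv M (Ne.isUnit h0)
  have hRM := Matrix.nonsing_inv_mul M (Ne.isUnit h0)
  have hsyl : Matrix.diagonal (fun i => conj (k i)) * M + M * Matrix.diagonal k
      = Matrix.of (fun a b => conj (p a) * p b)
        + ∑ c, Matrix.of (fun a b => conj (q c a) * q c b) := by
    ext a b
    simpa [Matrix.sum_apply] using lyapunovMatrix_eq (p := p) (q := q) hk a b
  have hmat : Matrix.diagonal k * M⁻¹ + M⁻¹ * Matrix.diagonal (fun i => conj (k i))
      = M⁻¹ * Matrix.of (fun a b => conj (p a) * p b) * M⁻¹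
        + ∑ c, M⁻¹ * Matrix.of (fun a b => conj (q c a) * q c b) * M⁻¹ := by
    rw [← Finset.sum_mul, ← Finset.mul_sum, ← add_mul, ← mul_add, ← hsyl]
    have e1 : M⁻¹ * (Matrix.diagonal (fun i => conj (k i)) * M) * M⁻¹
        = M⁻¹ * Matrix.diagonal (fun i => conj (k i)) * (M * M⁻¹) := by
      simp only [Matrix.mul_assoc]
    have e2 : M⁻¹ * (M * Matrix.diagonal k) * M⁻¹ = (M⁻¹ * M) * Matrix.diagonal k * M⁻¹ := by
      simp only [Matrix.mul_assoc]
    rw [mul_add, add_mul, e1, e2, hMR, hRM, mul_one, one_mul, add_comm]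
  simpa [Matrix.sum_apply] using congrFun (congrFun hmat i) j

/-- The Lyapunov equation in terms of the inverse matrix. -/
theorem invForm_lyapunov (hk : ∀ i, 0 < (k i).re) (h0 : (lyapunovMatrix k p q).det ≠ 0)
    (g h : Fin n → ℂ) :
    invForm (lyapunovMatrix k p q) (fun i => k i * g i) h
        + invForm (lyapunovMatrix k p q) g (fun i => k i * h i)
      = invForm (lyapunovMatrix k p q) g p * invForm (lyapunovMatrix k p q) p h
        + ∑ a, invForm (lyapunovMatrix k p q) g (q a) * invForm (lyapunovMatrix k p q) (q a) h := by
  simp only [← sum_inv_mul_rankOne_mul_inv]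
  rw [Finset.sum_comm (s := (Finset.univ : Finset α)), ← Finset.sum_add_distrib]
  simp only [invForm]
  rw [← Finset.sum_add_distrib]
  refine Finset.sum_congr rfl fun i _ => ?_
  rw [Finset.sum_comm (s := (Finset.univ : Finset α)), ← Finset.sum_add_distrib,
    ← Finset.sum_add_distrib]
  refine Finset.sum_congr rfl fun j _ => ?_
  rw [← Finset.sum_mul, ← Finset.mul_sum, ← add_mul, ← mul_add, ← lyapunovMatrix_inv_eq hk h0,
    map_mul]
  ring

/-- By the Lyapunov equation the last factor is (k_i + k̄_j) M_{ji}. When φ times k_i + k̄_j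
separates into a function of i plus a function of j, the double sum collapses through M⁻¹M = MM⁻¹ =
1. The symbols used later are 1, k̄ - k and k̄² - kk̄ + k². -/
theorem invForm_trace (hk : ∀ i, 0 < (k i).re) (h0 : (lyapunovMatrix k p q).det ≠ 0)
    (φ : Fin n → Fin n → ℂ) (β γ : Fin n → ℂ)
    (hφ : ∀ i j, φ i j * (k i + conj (k j)) = β i + γ j) :
    ∑ i, ∑ j, φ i j * (lyapunovMatrix k p q)⁻¹ i j * (p i * conj (p j) + ∑ a, q a i * conj (q a j))
      = ∑ i, β i + ∑ i, γ i := by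
  set M := lyapunovMatrix k p q with hM
  have hMR := Matrix.mul_nonsing_inv M (Ne.isUnit h0)
  have hRM := Matrix.nonsing_inv_mul M (Ne.isUnit h0)
  have hterm : ∀ i j, φ i j * M⁻¹ i j * (p i * conj (p j) + ∑ a, q a i * conj (q a j))
      = β i * (M⁻¹ i j * M j i) + γ j * (M j i * M⁻¹ i j) := by
    intro i j
    have := lyapunovMatrix_eq (p := p) (q := q) hk j i
    simp only [mul_comm (conj _)] at this
    rw [← this, ← hM]
    linear_combination M⁻¹ i j * M j i * hφ i j
  simp only [hterm, Finset.sum_add_distrib]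
  congr 1
  · refine Finset.sum_congr rfl fun i _ => ?_
    rw [← Finset.mul_sum, ← Matrix.mul_apply, hRM, Matrix.one_apply_eq, mul_one]
  · rw [Finset.sum_comm]
    refine Finset.sum_congr rfl fun i _ => ?_
    rw [← Finset.mul_sum, ← Matrix.mul_apply, hMR, Matrix.one_apply_eq, mul_one]

end Lyapunov

/-! ### Multi-soliton profiles at a fixed time -/

/-- Spectral data of a multi-soliton profile: distinct poles `k j` in the right half-plane,
amplitudes `P j` and polarization rows `q a`. -/
structure SolitonData (n : ℕ) (α : Type*) where
  k : Fin n → ℂ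
  P : Fin n → ℂ
  q : α → Fin n → ℂ
  re_pos : ∀ j, 0 < (k j).re
  inj : Function.Injective k
  P_ne : ∀ j, P j ≠ 0
  q_ne : ∀ j, ∃ a, q a j ≠ 0

namespace SolitonData

variable {n : ℕ} {α : Type*} (d : SolitonData n α)

/-- The exponential row vector. -/
def p (x : ℝ) (j : Fin n) : ℂ := d.P j * Complex.exp (d.k j * x)

/-- The row vector `p Kᵃ`. -/
def pk (a : ℕ) (x : ℝ) (j : Fin n) : ℂ := d.k j ^ a * d.p x j

theorem p_ne (x : ℝ) (j : Fin n) : d.p x j ≠ 0 := mul_ne_zero (d.P_ne j) (Complex.exp_ne_zero _)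

theorem pk_zero (x : ℝ) : d.pk 0 x = d.p x := by ext j; simp [pk]

theorem hasDerivAt_p (x : ℝ) (j : Fin n) : HasDerivAt (fun y => d.p y j) (d.k j * d.p x j) x := by
  have h : HasDerivAt (fun y : ℝ => d.k j * (y : ℂ)) (d.k j) x := by
    simpa using (Complex.ofRealCLM.hasDerivAt (x := x)).const_mul (d.k j)
  refine (h.cexp.const_mul (d.P j)).congr_deriv ?_
  simp only [p]; ring

theorem hasDerivAt_pk (a : ℕ) (x : ℝ) (j : Fin n) :
    HasDerivAt (fun y => d.pk a y j) (d.pk (a + 1) x j) x := by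
  refine ((d.hasDerivAt_p x j).const_mul (d.k j ^ a)).congr_deriv ?_
  simp only [pk]; ring

variable [Fintype α]

/-- The Lyapunov matrix at position `x`. -/
def M (x : ℝ) : Matrix (Fin n) (Fin n) ℂ := lyapunovMatrix d.k (d.p x) d.q

/-- The moments `p Kᵃ M⁻¹ (p Kᵇ)⋆`. -/
def S (a b : ℕ) (x : ℝ) : ℂ := invForm (d.M x) (d.pk a x) (d.pk b x)

/-- The moments `q M⁻¹ (p Kᵇ)⋆`; for `b = 0` this is the conjugate of the soliton profile. -/
def T (c : α) (b : ℕ) (x : ℝ) : ℂ := invForm (d.M x) (d.q c) (d.pk b x)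

/-- The squared modulus of the profile. -/
def V (x : ℝ) : ℝ := ∑ c, ‖d.T c 0 x‖ ^ 2

/-- The derivative of the conjugate profile. -/
def T' (c : α) (x : ℝ) : ℂ := d.T c 1 x - d.T c 0 x * d.S 0 0 x

/-- An antiderivative of the energy density, up to a constant factor. -/
def A (x : ℝ) : ℂ :=
  -(d.S 0 2 x - d.S 1 1 x + d.S 2 0 x)
    + ∑ c, (conj (d.T c 0 x) * d.T c 1 x + conj (d.T c 1 x) * d.T c 0 x)
    - 2 * (∑ c, conj (d.T c 0 x) * d.T c 0 x) * d.S 0 0 x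

theorem det_ne (x : ℝ) : (d.M x).det ≠ 0 :=
  lyapunovMatrix_det_ne_zero d.re_pos d.inj fun j => Or.inl (d.p_ne x j)

/-- Differentiating p̄_i p_j produces exactly the denominator k̄_i + k_j, so the derivative has rank
one. All later differentiation formulas rest on this. -/
theorem hasDerivAt_M (x : ℝ) (i j : Fin n) :
    HasDerivAt (fun y => d.M y i j)
      (Matrix.of (fun a b => conj (d.p x a) * d.p x b) i j) x := by
  have h := (((d.hasDerivAt_p x i).star.mul (d.hasDerivAt_p x j)).add_const
    (∑ a, conj (d.q a i) * d.q a j)).div_const (conj (d.k i) + d.k j)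
  refine h.congr_deriv ?_
  have := conj_add_ne_zero d.re_pos i j
  simp only [Matrix.of_apply, RCLike.star_def, map_mul]
  field_simp

/-- Product rule with (M⁻¹)' = -M⁻¹p⋆pM⁻¹, whose rank-one middle splits the last term. -/
theorem hasDerivAt_invForm {g h : ℝ → Fin n → ℂ} {g' h' : Fin n → ℂ} {x : ℝ}
    (hg : ∀ j, HasDerivAt (fun y => g y j) (g' j) x)
    (hh : ∀ j, HasDerivAt (fun y => h y j) (h' j) x) :
    HasDerivAt (fun y => invForm (d.M y) (g y) (h y))
      (invForm (d.M x) g' (h x) + invForm (d.M x) (g x) h'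
        - invForm (d.M x) (g x) (d.p x) * invForm (d.M x) (d.p x) (h x)) x := by
  rw [← sum_inv_mul_rankOne_mul_inv]
  simp only [invForm, ← Finset.sum_add_distrib, ← Finset.sum_sub_distrib]
  refine HasDerivAt.fun_sum fun i _ => HasDerivAt.fun_sum fun j _ => ?_
  refine (((hg i).mul (hasDerivAt_inv_apply (d.hasDerivAt_M x) (d.det_ne x) i j)).mul
    (hh j).star).congr_deriv ?_
  simp only [RCLike.star_def, Pi.mul_apply]
  ring

theorem S_conj (a b : ℕ) (x : ℝ) : conj (d.S a b x) = d.S b a x := invForm_conj _ _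

theorem S_lyapunov (a b : ℕ) (x : ℝ) :
    d.S (a + 1) b x + d.S a (b + 1) x
      = d.S a 0 x * d.S 0 b x + ∑ c, conj (d.T c a x) * d.T c b x := by
  have h := invForm_lyapunov d.re_pos (d.det_ne x) (d.pk a x) (d.pk b x)
  have e : ∀ a, (fun i => d.k i * d.pk a x i) = d.pk (a + 1) x := by
    intro a; ext i; simp only [pk]; ring
  rw [e, e] at h
  simp only [S, T, M, invForm_conj, pk_zero]
  exact h

/-- The product rule gives S (a+1) b + S a (b+1) - S a 0 · S 0 b, and `S_lyapunov` converts this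
into a sum over the components of q. This makes the moments of p antiderivatives of the densities.
-/
theorem hasDerivAt_S (a b : ℕ) (x : ℝ) :
    HasDerivAt (d.S a b) (∑ c, conj (d.T c a x) * d.T c b x) x := by
  refine (d.hasDerivAt_invForm (d.hasDerivAt_pk a x) (d.hasDerivAt_pk b x)).congr_deriv ?_
  have := d.S_lyapunov a b x
  simp only [S, pk_zero] at this
  linear_combination this

theorem hasDerivAt_T (c : α) (b : ℕ) (x : ℝ) :
    HasDerivAt (d.T c b) (d.T c (b + 1) x - d.T c 0 x * d.S 0 b x) x := by
  refine (d.hasDerivAt_invForm (g := fun _ => d.q c) (g' := 0)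
    (fun j => hasDerivAt_const x _) (d.hasDerivAt_pk b x)).congr_deriv ?_
  have : invForm (d.M x) 0 (d.pk b x) = 0 := by simp [invForm]
  rw [this, zero_add]
  simp only [S, T, pk_zero]

theorem hasDerivAt_T_zero (c : α) (x : ℝ) : HasDerivAt (d.T c 0) (d.T' c x) x :=
  d.hasDerivAt_T c 0 x

theorem ofReal_V (x : ℝ) : (d.V x : ℂ) = ∑ c, conj (d.T c 0 x) * d.T c 0 x := by
  simp [V, Complex.conj_mul']

theorem hasDerivAt_S_re (x : ℝ) : HasDerivAt (fun y => (d.S 0 0 y).re) (d.V x) x := by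
  have := (Complex.reCLM.hasFDerivAt.comp_hasDerivAt x (d.hasDerivAt_S 0 0 x))
  rw [← ofReal_V] at this
  exact this

theorem S_zero_zero (x : ℝ) : d.S 0 0 x = ((d.S 0 0 x).re : ℂ) :=
  (Complex.conj_eq_iff_re.mp (d.S_conj 0 0 x)).symm

/-- Replacing T c 1 by the true derivative T' changes the product by |T|² S 0 0, which is real and
drops out of the imaginary part. -/
theorem hasDerivAt_S_im (x : ℝ) :
    HasDerivAt (fun y => (d.S 0 1 y).im) (∑ c, (conj (d.T c 0 x) * d.T' c x).im) x := by
  refine (Complex.imCLM.hasFDerivAt.comp_hasDerivAt x (d.hasDerivAt_S 0 1 x)).congr_deriv ?_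
  rw [Complex.imCLM_apply, Complex.im_sum]
  refine Finset.sum_congr rfl fun c _ => ?_
  have : conj (d.T c 0 x) * d.T' c x
      = conj (d.T c 0 x) * d.T c 1 x - ((‖d.T c 0 x‖ ^ 2 * (d.S 0 0 x).re : ℝ) : ℂ) := by
    rw [T', S_zero_zero]
    push_cast
    rw [← Complex.conj_mul']
    simp only [Complex.ofReal_re]
    ring
  rw [this, Complex.sub_im, Complex.ofReal_im, sub_zero]

/-- Second-order moments alone do not give the energy density; the total derivatives of Σ 2 Re
(T̄₀T₁) and of V · S 0 0 correct them. -/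
theorem hasDerivAt_A (x : ℝ) :
    HasDerivAt d.A ((3 * ∑ c, ‖d.T' c x‖ ^ 2 - 3 * d.V x ^ 2 : ℝ) : ℂ) x := by
  have hT := fun c => d.hasDerivAt_T c 0 x
  have hT1 := fun c => d.hasDerivAt_T c 1 x
  have hV := HasDerivAt.fun_sum (u := Finset.univ) fun c _ => (hT c).star.mul (hT c)
  have hJ := HasDerivAt.fun_sum (u := Finset.univ) fun c _ =>
    ((hT c).star.mul (hT1 c)).add ((hT1 c).star.mul (hT c))
  have h := (((((d.hasDerivAt_S 0 2 x).sub (d.hasDerivAt_S 1 1 x)).add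
    (d.hasDerivAt_S 2 0 x)).neg).add hJ).sub ((hV.const_mul 2).mul (d.hasDerivAt_S 0 0 x))
  refine HasDerivAt.congr_deriv h ?_
  have hS := d.S_lyapunov 0 0 x
  simp only [zero_add] at hS
  have h00 := d.S_conj 0 0 x
  have h01 := d.S_conj 0 1 x
  have e1 : ((∑ c, ‖d.T' c x‖ ^ 2 : ℝ) : ℂ) = ∑ c, conj (d.T' c x) * d.T' c x := by
    simp [Complex.conj_mul']
  rw [Complex.ofReal_sub, Complex.ofReal_mul, Complex.ofReal_mul, Complex.ofReal_pow, e1, ofReal_V]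
  -- The three expansions are of |T'|², of the derivative of Σ 2 Re (T̄₀T₁), and of V'.
  have f1 : ∑ c, conj (d.T' c x) * d.T' c x
      = ∑ c, conj (d.T c 1 x) * d.T c 1 x
        - d.S 0 0 x * ∑ c, conj (d.T c 0 x) * d.T c 1 x
        - d.S 0 0 x * ∑ c, conj (d.T c 1 x) * d.T c 0 x
        + d.S 0 0 x ^ 2 * ∑ c, conj (d.T c 0 x) * d.T c 0 x := by
    simp only [Finset.mul_sum, ← Finset.sum_add_distrib, ← Finset.sum_sub_distrib]
    refine Finset.sum_congr rfl fun c _ => ?_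
    rw [T', map_sub, map_mul, h00]
    ring
  have f2 : ∑ c, (star (d.T c 1 x - d.T c 0 x * d.S 0 0 x) * d.T c 1 x
        + star (d.T c 0 x) * (d.T c 2 x - d.T c 0 x * d.S 0 1 x)
        + (star (d.T c 2 x - d.T c 0 x * d.S 0 1 x) * d.T c 0 x
          + star (d.T c 1 x) * (d.T c 1 x - d.T c 0 x * d.S 0 0 x)))
      = 2 * ∑ c, conj (d.T c 1 x) * d.T c 1 x
        - d.S 0 0 x * ∑ c, conj (d.T c 0 x) * d.T c 1 x
        - d.S 0 0 x * ∑ c, conj (d.T c 1 x) * d.T c 0 x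
        + ∑ c, conj (d.T c 0 x) * d.T c 2 x + ∑ c, conj (d.T c 2 x) * d.T c 0 x
        - (d.S 0 1 x + d.S 1 0 x) * ∑ c, conj (d.T c 0 x) * d.T c 0 x := by
    simp only [Finset.mul_sum, ← Finset.sum_add_distrib, ← Finset.sum_sub_distrib]
    refine Finset.sum_congr rfl fun c _ => ?_
    simp only [RCLike.star_def, map_sub, map_mul, h00, h01]
    ring
  have f3 : ∑ c, (star (d.T c 1 x - d.T c 0 x * d.S 0 0 x) * d.T c 0 x
        + star (d.T c 0 x) * (d.T c 1 x - d.T c 0 x * d.S 0 0 x))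
      = ∑ c, conj (d.T c 0 x) * d.T c 1 x + ∑ c, conj (d.T c 1 x) * d.T c 0 x
        - 2 * d.S 0 0 x * ∑ c, conj (d.T c 0 x) * d.T c 0 x := by
    simp only [Finset.mul_sum, ← Finset.sum_add_distrib, ← Finset.sum_sub_distrib]
    refine Finset.sum_congr rfl fun c _ => ?_
    simp only [RCLike.star_def, map_sub, map_mul, h00]
    ring
  simp only [zero_add, Nat.reduceAdd, Complex.ofReal_ofNat]
  rw [f1, f2, f3]
  simp only [RCLike.star_def]
  -- The only relation needed is S 1 0 + S 0 1 = (S 0 0)² + V.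
  linear_combination (-(∑ c, conj (d.T c 0 x) * d.T c 0 x)) * hS

theorem trace_adjugate_mul (x : ℝ) :
    ((d.M x).adjugate * Matrix.of (fun a b => conj (d.p x a) * d.p x b)).trace
      = (d.M x).det * d.S 0 0 x := by
  have hadj : (d.M x).adjugate = (d.M x).det • (d.M x)⁻¹ := by
    rw [Matrix.inv_def, smul_smul, Ring.inverse_eq_inv', mul_inv_cancel₀ (d.det_ne x), one_smul]
  rw [hadj, Matrix.smul_mul, Matrix.trace_smul, smul_eq_mul]
  congr 1
  simp only [Matrix.trace, Matrix.diag, Matrix.mul_apply, S, invForm, pk_zero, Matrix.of_apply]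
  exact Finset.sum_congr rfl fun i _ => Finset.sum_congr rfl fun j _ => by ring

theorem det_re (x : ℝ) : (d.M x).det = ((d.M x).det.re : ℂ) :=
  (Complex.conj_eq_iff_re.mp lyapunovMatrix_det_conj).symm

/-- Jacobi's formula with M' = p⋆p gives (det M)' = det M · S 0 0, so det M plays the role of a tau
function. The determinant is real because M is Hermitian. -/
theorem hasDerivAt_log_det (x : ℝ) :
    HasDerivAt (fun y => Real.log (d.M y).det.re) (d.S 0 0 x).re x := by
  have h := hasDerivAt_det (d.hasDerivAt_M x)
  rw [trace_adjugate_mul] at h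
  have h1 : HasDerivAt (fun y => (d.M y).det.re) ((d.M x).det.re * (d.S 0 0 x).re) x := by
    refine (Complex.reCLM.hasFDerivAt.comp_hasDerivAt x h).congr_deriv ?_
    rw [det_re, S_zero_zero, Complex.reCLM_apply]
    simp
  have h0 : (d.M x).det.re ≠ 0 := by
    intro h
    have := d.det_ne x
    rw [det_re, h] at this
    simp at this
  refine (h1.log h0).congr_deriv ?_
  field_simp

end SolitonData

/-! ### Exponential decay -/

section Decay

variable {E : Type*} [NormedAddCommGroup E]

/-- The factor 1 + |x| makes room for the first moment density; comparison with 1/(1 + x²) serves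
both integrability and decay. -/
theorem isBigO_exp_neg_abs_inv_one_add_sq {ε : ℝ} (hε : 0 < ε) :
    (fun x : ℝ => (1 + |x|) * Real.exp (-(ε * |x|))) =O[cocompact ℝ] fun x => (1 + x ^ 2)⁻¹ := by
  have h1 : (fun y : ℝ => (1 + y) * (1 + y ^ 2)) =O[atTop] fun y => Real.exp (ε * y) := by
    have h := fun m : ℕ => (isLittleO_pow_exp_pos_mul_atTop m hε).isBigO
    have e : (fun y : ℝ => (1 + y) * (1 + y ^ 2)) = fun y => y ^ 0 + y ^ 1 + y ^ 2 + y ^ 3 := by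
      ext y; ring
    rw [e]
    exact (((h 0).add (h 1)).add (h 2)).add (h 3)
  have h2 := h1.comp_tendsto (tendsto_norm_cocompact_atTop (E := ℝ))
  have h3 := (h2.mul (Asymptotics.isBigO_refl
    (fun x : ℝ => Real.exp (-(ε * |x|)) * (1 + x ^ 2)⁻¹) (cocompact ℝ)))
  refine (h3.congr_left ?_).congr_right ?_
  · intro x
    have : (1 + x ^ 2) ≠ 0 := by positivity
    simp only [Function.comp, Real.norm_eq_abs, sq_abs]
    field_simp
  · intro x
    simp only [Function.comp, Real.norm_eq_abs]
    rw [← mul_assoc, ← Real.exp_add, add_neg_cancel, Real.exp_zero, one_mul]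

theorem integrable_of_isBigO_exp_neg_abs {f : ℝ → ℝ} (hf : Continuous f) {ε : ℝ} (hε : 0 < ε)
    (h : f =O[cocompact ℝ] fun x : ℝ => (1 + |x|) * Real.exp (-(ε * |x|))) : Integrable f :=
  hf.locallyIntegrable.integrable_of_isBigO_cocompact
    (h.trans (isBigO_exp_neg_abs_inv_one_add_sq hε))
    (integrable_inv_one_add_sq.integrableAtFilter _)

theorem tendsto_zero_of_isBigO_exp_neg_abs {f : ℝ → E} {ε : ℝ} (hε : 0 < ε)
    (h : f =O[cocompact ℝ] fun x : ℝ => (1 + |x|) * Real.exp (-(ε * |x|))) :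
    Tendsto f (cocompact ℝ) (𝓝 0) := by
  refine (h.trans (isBigO_exp_neg_abs_inv_one_add_sq hε)).trans_tendsto ?_
  have h1 : Tendsto (fun y : ℝ => (1 + y ^ 2)⁻¹) atTop (𝓝 0) :=
    tendsto_inv_atTop_zero.comp (tendsto_atTop_add_const_left _ _ (tendsto_pow_atTop two_ne_zero))
  simpa [Function.comp_def] using h1.comp (tendsto_norm_cocompact_atTop (E := ℝ))

theorem isBigO_exp_neg_abs_weaken (ε : ℝ) (l : Filter ℝ) :
    (fun x : ℝ => Real.exp (-(ε * |x|))) =O[l] fun x => (1 + |x|) * Real.exp (-(ε * |x|)) := by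
  refine Asymptotics.isBigO_of_le _ fun x => ?_
  rw [norm_mul]
  refine le_mul_of_one_le_left (norm_nonneg _) ?_
  rw [Real.norm_eq_abs, abs_of_nonneg (by positivity)]
  linarith [abs_nonneg x]

theorem isBigO_id_mul_exp_neg_abs {f : ℝ → ℝ} {ε : ℝ} {l : Filter ℝ}
    (h : f =O[l] fun x : ℝ => Real.exp (-(ε * |x|))) :
    (fun x => x * f x) =O[l] fun x => (1 + |x|) * Real.exp (-(ε * |x|)) := by
  refine Asymptotics.IsBigO.mul (Asymptotics.isBigO_of_le _ fun x => ?_) h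
  rw [Real.norm_eq_abs, Real.norm_eq_abs, abs_of_nonneg (by positivity : 0 ≤ 1 + |x|)]
  linarith [abs_nonneg x]

theorem isBigO_exp_neg_abs_mul {ε : ℝ} (hε : 0 < ε) {f g : ℝ → ℂ} {l : Filter ℝ}
    (hf : f =O[l] fun x : ℝ => Real.exp (-(ε * |x|)))
    (hg : g =O[l] fun x : ℝ => Real.exp (-(ε * |x|))) :
    (fun x => f x * g x) =O[l] fun x : ℝ => Real.exp (-(ε * |x|)) := by
  refine (hf.mul hg).trans ?_
  refine Asymptotics.isBigO_of_le _ fun x => ?_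
  rw [← Real.exp_add, Real.norm_eq_abs, Real.norm_eq_abs, Real.abs_exp, Real.abs_exp,
    Real.exp_le_exp]
  nlinarith [abs_nonneg x]

end Decay

/-! ### Limits and bounds for inverse matrices. -/

section InverseLimits

variable {n : ℕ} {l : Filter ℝ}

theorem tendsto_inv_apply {N : ℝ → Matrix (Fin n) (Fin n) ℂ} {C : Matrix (Fin n) (Fin n) ℂ}
    (h : ∀ i j, Tendsto (fun x => N x i j) l (𝓝 (C i j))) (hC : C.det ≠ 0) (i j : Fin n) :
    Tendsto (fun x => (N x)⁻¹ i j) l (𝓝 (C⁻¹ i j)) := by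
  have hN : Tendsto N l (𝓝 C) := tendsto_pi_nhds.mpr fun i => tendsto_pi_nhds.mpr (h i)
  have hdet := ((continuous_id.matrix_det (n := Fin n) (R := ℂ)).tendsto C).comp hN
  have hadj := ((continuous_id.matrix_adjugate (n := Fin n) (R := ℂ)).tendsto C).comp hN
  have hadj' := tendsto_pi_nhds.mp (tendsto_pi_nhds.mp hadj i) j
  have := (hdet.inv₀ hC).mul hadj'
  simpa [Matrix.inv_def, Ring.inverse_eq_inv', Function.comp_def] using! this

theorem invForm_isBigO {N : ℝ → Matrix (Fin n) (Fin n) ℂ} {g h : ℝ → Fin n → ℂ} {φ ψ : ℝ → ℝ}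
    (hN : ∀ i j, (fun x => (N x)⁻¹ i j) =O[l] fun _ => (1 : ℝ))
    (hg : ∀ i, (fun x => g x i) =O[l] φ) (hh : ∀ i, (fun x => h x i) =O[l] ψ) :
    (fun x => invForm (N x) (g x) (h x)) =O[l] fun x => φ x * ψ x := by
  refine Asymptotics.IsBigO.fun_sum fun i _ => Asymptotics.IsBigO.fun_sum fun j _ => ?_
  have hc : (fun x => conj (h x j)) =O[l] ψ :=
    (hh j).norm_left.congr_left (fun x => (RCLike.norm_conj (h x j)).symm) |>.of_norm_left
  simpa using ((hg i).mul (hN i j)).mul hc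

end InverseLimits

/-! ### Behaviour of the moments at both ends of the line, and trace identities. -/

namespace SolitonData

variable {n : ℕ} {α : Type*} (d : SolitonData n α)

theorem exists_rate : ∃ ε : ℝ, 0 < ε ∧ ∀ j, ε ≤ (d.k j).re := by
  rcases Nat.eq_zero_or_pos n with rfl | hn
  -- Without poles any positive rate serves.
  · exact ⟨1, one_pos, fun j => j.elim0⟩
  · have : Nonempty (Fin n) := ⟨⟨0, hn⟩⟩
    obtain ⟨i, hi⟩ := Finite.exists_min fun j => (d.k j).re
    exact ⟨_, d.re_pos i, hi⟩

theorem norm_p (x : ℝ) (j : Fin n) : ‖d.p x j‖ = ‖d.P j‖ * Real.exp ((d.k j).re * x) := by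
  rw [p, norm_mul, Complex.norm_exp]
  simp

theorem pk_isBigO_atBot {ε : ℝ} (hε : ∀ j, ε ≤ (d.k j).re) (a : ℕ) (j : Fin n) :
    (fun x => d.pk a x j) =O[atBot] fun x : ℝ => Real.exp (-(ε * |x|)) := by
  refine Asymptotics.IsBigO.of_bound (‖d.k j ^ a‖ * ‖d.P j‖) ?_
  filter_upwards [eventually_le_atBot 0] with x hx
  rw [pk, norm_mul, norm_p, ← mul_assoc, Real.norm_eq_abs, Real.abs_exp, abs_of_nonpos hx]
  gcongr
  nlinarith [hε j]

theorem div_p_isBigO_atTop {ε : ℝ} (hε : ∀ j, ε ≤ (d.k j).re) (c : ℂ) (j : Fin n) :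
    (fun x => c / d.p x j) =O[atTop] fun x : ℝ => Real.exp (-(ε * |x|)) := by
  refine Asymptotics.IsBigO.of_bound (‖c‖ / ‖d.P j‖) ?_
  filter_upwards [eventually_ge_atTop 0] with x hx
  rw [norm_div, norm_p, Real.norm_eq_abs, Real.abs_exp, abs_of_nonneg hx, ← div_div,
    div_eq_mul_inv _ (Real.exp _), ← Real.exp_neg]
  gcongr
  nlinarith [hε j]

theorem p_tendsto_atBot (j : Fin n) : Tendsto (fun x => d.p x j) atBot (𝓝 0) := by
  obtain ⟨ε, hε, h⟩ := d.exists_rate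
  have h1 := d.pk_isBigO_atBot h 0 j
  simp only [pk_zero] at h1
  refine h1.trans_tendsto ?_
  have := tendsto_zero_of_isBigO_exp_neg_abs hε (isBigO_exp_neg_abs_weaken ε _)
  exact this.mono_left atBot_le_cocompact

theorem div_p_tendsto_atTop (c : ℂ) (j : Fin n) : Tendsto (fun x => c / d.p x j) atTop (𝓝 0) := by
  obtain ⟨ε, hε, h⟩ := d.exists_rate
  refine (d.div_p_isBigO_atTop h c j).trans_tendsto ?_
  have := tendsto_zero_of_isBigO_exp_neg_abs hε (isBigO_exp_neg_abs_weaken ε _)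
  exact this.mono_left atTop_le_cocompact

variable [Fintype α]

/-- The limit of `M` as `x → -∞`. -/
def Mbot : Matrix (Fin n) (Fin n) ℂ := lyapunovMatrix d.k 0 d.q

/-- The Lyapunov matrix with `p` scaled to `1`. -/
def Mscaled (x : ℝ) : Matrix (Fin n) (Fin n) ℂ :=
  lyapunovMatrix d.k 1 fun a j => d.q a j / d.p x j

/-- The limit of the scaled Lyapunov matrix as `x → ∞`. -/
def Mtop : Matrix (Fin n) (Fin n) ℂ := lyapunovMatrix d.k 1 (fun (_ : α) _ => 0)

/-- With p = 0 invertibility rests on the polarizations, through `q_ne`; with q = 0 in `Mtop_det_ne`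
it rests on the nonzero entries of p. -/
theorem Mbot_det_ne : d.Mbot.det ≠ 0 :=
  lyapunovMatrix_det_ne_zero d.re_pos d.inj fun j => Or.inr (d.q_ne j)

theorem Mtop_det_ne : d.Mtop.det ≠ 0 :=
  lyapunovMatrix_det_ne_zero d.re_pos d.inj fun j => Or.inl (by simp)

theorem M_tendsto (i j : Fin n) : Tendsto (fun x => d.M x i j) atBot (𝓝 (d.Mbot i j)) := by
  simp only [M, Mbot, lyapunovMatrix, Matrix.of_apply]
  refine Tendsto.div_const (Tendsto.add_const _ ?_) _
  have := ((Complex.continuous_conj.tendsto 0).comp (d.p_tendsto_atBot i)).mul (d.p_tendsto_atBot j)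
  simpa using! this

theorem Mscaled_tendsto (i j : Fin n) :
    Tendsto (fun x => d.Mscaled x i j) atTop (𝓝 (d.Mtop i j)) := by
  simp only [Mscaled, Mtop, lyapunovMatrix, Matrix.of_apply]
  refine Tendsto.div_const (Tendsto.const_add _ ?_) _
  refine tendsto_finsetSum _ fun a _ => ?_
  have := ((Complex.continuous_conj.tendsto 0).comp (d.div_p_tendsto_atTop (d.q a i) i)).mul
    (d.div_p_tendsto_atTop (d.q a j) j)
  simpa using! this

theorem M_inv_isBigO (i j : Fin n) :
    (fun x => (d.M x)⁻¹ i j) =O[atBot] fun _ => (1 : ℝ) :=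
  (tendsto_inv_apply d.M_tendsto d.Mbot_det_ne i j).isBigO_one ℝ

theorem Mscaled_inv_isBigO (i j : Fin n) :
    (fun x => (d.Mscaled x)⁻¹ i j) =O[atTop] fun _ => (1 : ℝ) :=
  (tendsto_inv_apply d.Mscaled_tendsto d.Mtop_det_ne i j).isBigO_one ℝ

/-- M grows at +∞. Conjugating by diag p removes the growth and leaves a matrix with an invertible
limit. -/
theorem M_eq_scaled (x : ℝ) :
    d.M x = Matrix.diagonal (fun i => conj (d.p x i)) * d.Mscaled x * Matrix.diagonal (d.p x) := by
  ext i j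
  have hi := d.p_ne x i
  have hj := d.p_ne x j
  have hi' : conj (d.p x i) ≠ 0 := (map_ne_zero _).mpr hi
  simp only [M, Mscaled, lyapunovMatrix, Matrix.mul_diagonal, Matrix.diagonal_mul, Matrix.of_apply,
    Pi.one_apply, map_one, map_div₀, mul_one]
  have : ∑ a, conj (d.q a i) / conj (d.p x i) * (d.q a j / d.p x j)
      = (∑ a, conj (d.q a i) * d.q a j) / (conj (d.p x i) * d.p x j) := by
    rw [Finset.sum_div]
    exact Finset.sum_congr rfl fun a _ => by field_simp
  rw [this]
  field_simp

theorem det_M_eq (x : ℝ) :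
    (d.M x).det = (d.Mscaled x).det * ((∏ i, ‖d.p x i‖ ^ 2 : ℝ) : ℂ) := by
  rw [M_eq_scaled, Matrix.det_mul, Matrix.det_mul, Matrix.det_diagonal, Matrix.det_diagonal]
  push_cast
  simp only [← Complex.conj_mul', Finset.prod_mul_distrib]
  ring

theorem invForm_scaled (x : ℝ) (g h : Fin n → ℂ) :
    invForm (d.M x) g h
      = invForm (d.Mscaled x) (fun j => g j / d.p x j) (fun j => h j / d.p x j) := by
  have hinv : (d.M x)⁻¹ = Matrix.diagonal (fun i => (d.p x i)⁻¹) * (d.Mscaled x)⁻¹ *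
      Matrix.diagonal (fun i => (conj (d.p x i))⁻¹) := by
    have h1 : ∀ f : Fin n → ℂ, (∀ i, f i ≠ 0) →
        (Matrix.diagonal f)⁻¹ = Matrix.diagonal fun i => (f i)⁻¹ := by
      intro f hf
      refine Matrix.inv_eq_right_inv ?_
      rw [Matrix.diagonal_mul_diagonal]
      simp [hf]
    rw [M_eq_scaled, Matrix.mul_inv_rev, Matrix.mul_inv_rev, h1 _ (d.p_ne x),
      h1 _ fun i => (map_ne_zero _).mpr (d.p_ne x i), Matrix.mul_assoc]
  simp only [invForm, hinv, Matrix.mul_diagonal, Matrix.diagonal_mul, map_div₀]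
  refine Finset.sum_congr rfl fun i _ => Finset.sum_congr rfl fun j _ => ?_
  ring

/-- At -∞ the row p is small and M⁻¹ is bounded. At +∞, in the scaled form, q/p is small while pKᵇ/p
= kᵇ is bounded. -/
theorem T_isBigO {ε : ℝ} (hε : ∀ j, ε ≤ (d.k j).re) (c : α) (b : ℕ) :
    d.T c b =O[cocompact ℝ] fun x : ℝ => Real.exp (-(ε * |x|)) := by
  rw [cocompact_eq_atBot_atTop, Asymptotics.isBigO_sup]
  constructor
  · have := invForm_isBigO (φ := fun _ => 1) d.M_inv_isBigO
      (fun i => Asymptotics.isBigO_const_const (d.q c i) one_ne_zero atBot)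
      (d.pk_isBigO_atBot hε b)
    simpa using! this
  · have := invForm_isBigO (ψ := fun _ => 1) d.Mscaled_inv_isBigO
      (fun i => d.div_p_isBigO_atTop hε (d.q c i) i)
      (fun i => Asymptotics.isBigO_const_const (d.k i ^ b) one_ne_zero atTop)
    refine (this.congr_left fun x => ?_).congr_right fun x => mul_one _
    rw [T, invForm_scaled]
    congr 1
    ext j
    have := d.p_ne x j
    simp only [pk]
    field_simp

theorem S_isBigO_one (a b : ℕ) : d.S a b =O[cocompact ℝ] fun _ : ℝ => (1 : ℝ) := by
  rw [cocompact_eq_atBot_atTop, Asymptotics.isBigO_sup]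
  have hp : ∀ a j, (fun x => d.pk a x j) =O[atBot] fun _ => (1 : ℝ) := by
    intro a j
    have : Tendsto (fun x => d.pk a x j) atBot (𝓝 (d.k j ^ a * 0)) :=
      (d.p_tendsto_atBot j).const_mul _
    exact this.isBigO_one ℝ
  constructor
  · have := invForm_isBigO d.M_inv_isBigO (hp a) (hp b)
    simpa using! this
  · have := invForm_isBigO (φ := fun _ => 1) (ψ := fun _ => 1) d.Mscaled_inv_isBigO
      (fun i => Asymptotics.isBigO_const_const (d.k i ^ a) one_ne_zero atTop)
      (fun i => Asymptotics.isBigO_const_const (d.k i ^ b) one_ne_zero atTop)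
    refine (this.congr_left fun x => ?_).congr_right fun x => mul_one _
    rw [S, invForm_scaled]
    congr 1 <;>
    · ext j
      have := d.p_ne x j
      simp only [pk]
      field_simp

theorem S_isBigO_atBot {ε : ℝ} (hε : ∀ j, ε ≤ (d.k j).re) (a b : ℕ) :
    d.S a b =O[atBot] fun x : ℝ => Real.exp (-(ε * |x|)) * Real.exp (-(ε * |x|)) :=
  invForm_isBigO d.M_inv_isBigO (d.pk_isBigO_atBot hε a) (d.pk_isBigO_atBot hε b)

/-- The moments `q Kᵃ M⁻¹ (q Kᵇ)⋆` summed over the rows of `q`. -/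
def Q (a b : ℕ) (x : ℝ) : ℂ :=
  ∑ c, invForm (d.M x) (fun j => d.k j ^ a * d.q c j) (fun j => d.k j ^ b * d.q c j)

theorem Q_isBigO_atTop {ε : ℝ} (hε : ∀ j, ε ≤ (d.k j).re) (a b : ℕ) :
    d.Q a b =O[atTop] fun x : ℝ => Real.exp (-(ε * |x|)) * Real.exp (-(ε * |x|)) := by
  refine Asymptotics.IsBigO.fun_sum fun c _ => ?_
  simp only [invForm_scaled]
  exact invForm_isBigO d.Mscaled_inv_isBigO (fun i => d.div_p_isBigO_atTop hε _ i)
    (fun i => d.div_p_isBigO_atTop hε _ i)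

/-- In this form the last factor is the transposed right side of the Lyapunov equation, as
`invForm_trace` requires. -/
theorem S_add_Q (a b : ℕ) (x : ℝ) :
    d.S a b x + d.Q a b x = ∑ i, ∑ j, (d.k i ^ a * conj (d.k j) ^ b) * (d.M x)⁻¹ i j *
      (d.p x i * conj (d.p x j) + ∑ c, d.q c i * conj (d.q c j)) := by
  simp only [S, Q, invForm, pk]
  rw [Finset.sum_comm (s := (Finset.univ : Finset α)), ← Finset.sum_add_distrib]
  refine Finset.sum_congr rfl fun i _ => ?_
  rw [Finset.sum_comm (s := (Finset.univ : Finset α)), ← Finset.sum_add_distrib]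
  refine Finset.sum_congr rfl fun j _ => ?_
  rw [mul_add, Finset.mul_sum]
  simp only [map_mul, map_pow]
  congr 1
  · ring
  · exact Finset.sum_congr rfl fun c _ => by ring

/-- Symbol 1. The sum is constant while S vanishes at -∞ and Q at +∞, so the constant is the total
increase of S 0 0. -/
theorem trace_zero (x : ℝ) :
    d.S 0 0 x + d.Q 0 0 x = ((2 * ∑ i, (d.k i).re : ℝ) : ℂ) := by
  rw [S_add_Q]
  simp only [pow_zero, mul_one]
  have h := invForm_trace d.re_pos (d.det_ne x) (fun _ _ => 1) d.k (fun j => conj (d.k j))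
    (fun i j => by ring)
  refine h.trans ?_
  rw [← Finset.sum_add_distrib]
  push_cast
  rw [Finset.mul_sum]
  exact Finset.sum_congr rfl fun i _ => by rw [Complex.add_conj]; push_cast; ring

/-- Symbol k̄ - k, with (k̄ - k)(k + k̄) = k̄² - k². -/
theorem trace_one (x : ℝ) :
    (d.S 0 1 x + d.Q 0 1 x) - (d.S 1 0 x + d.Q 1 0 x)
      = -((2 * ∑ i, (d.k i ^ 2).im : ℝ) : ℂ) * Complex.I := by
  simp only [S_add_Q, ← Finset.sum_sub_distrib]
  have h := invForm_trace (p := d.p x) (q := d.q) d.re_pos (d.det_ne x)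
    (fun i j => conj (d.k j) - d.k i)
    (fun i => -d.k i ^ 2) (fun j => conj (d.k j ^ 2)) (fun i j => by rw [map_pow]; ring)
  refine (Eq.trans ?_ h).trans ?_
  · exact Finset.sum_congr rfl fun i _ => Finset.sum_congr rfl fun j _ => by rw [M]; ring
  rw [← Finset.sum_add_distrib]
  push_cast
  rw [Finset.mul_sum, ← Finset.sum_neg_distrib, Finset.sum_mul]
  refine Finset.sum_congr rfl fun i _ => ?_
  have := Complex.sub_conj (d.k i ^ 2)
  push_cast at this
  linear_combination -this

/-- Symbol k̄² - kk̄ + k², with (k̄² - kk̄ + k²)(k + k̄) = k³ + k̄³. This fixes the combination of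
second-order moments in `A`. -/
theorem trace_two (x : ℝ) :
    (d.S 0 2 x + d.Q 0 2 x) - (d.S 1 1 x + d.Q 1 1 x) + (d.S 2 0 x + d.Q 2 0 x)
      = ((2 * ∑ i, (d.k i ^ 3).re : ℝ) : ℂ) := by
  simp only [S_add_Q, ← Finset.sum_sub_distrib, ← Finset.sum_add_distrib]
  have h := invForm_trace (p := d.p x) (q := d.q) d.re_pos (d.det_ne x)
    (fun i j => conj (d.k j) ^ 2 - d.k i * conj (d.k j) + d.k i ^ 2)
    (fun i => d.k i ^ 3) (fun j => conj (d.k j ^ 3)) (fun i j => by rw [map_pow]; ring)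
  refine (Eq.trans ?_ h).trans ?_
  · exact Finset.sum_congr rfl fun i _ => Finset.sum_congr rfl fun j _ => by rw [M]; ring
  rw [← Finset.sum_add_distrib]
  push_cast
  rw [Finset.mul_sum]
  refine Finset.sum_congr rfl fun i _ => ?_
  have := Complex.add_conj (d.k i ^ 3)
  push_cast at this
  linear_combination this

end SolitonData

/-! ### Integrals of the densities of a profile. -/

namespace SolitonData

variable {n : ℕ} {α : Type*} [Fintype α] (d : SolitonData n α)

theorem continuous_S (a b : ℕ) : Continuous (d.S a b) :=
  continuous_iff_continuousAt.mpr fun x => (d.hasDerivAt_S a b x).continuousAt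

theorem continuous_T (c : α) (b : ℕ) : Continuous (d.T c b) :=
  continuous_iff_continuousAt.mpr fun x => (d.hasDerivAt_T c b x).continuousAt

theorem continuous_T' (c : α) : Continuous (d.T' c) :=
  (d.continuous_T c 1).sub ((d.continuous_T c 0).mul (d.continuous_S 0 0))

theorem continuous_V : Continuous d.V :=
  continuous_finsetSum _ fun c _ => (d.continuous_T c 0).norm.pow 2

theorem T'_isBigO {ε : ℝ} (hε : ∀ j, ε ≤ (d.k j).re) (c : α) :
    d.T' c =O[cocompact ℝ] fun x : ℝ => Real.exp (-(ε * |x|)) := by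
  refine (d.T_isBigO hε c 1).sub ?_
  simpa using (d.T_isBigO hε c 0).mul (d.S_isBigO_one 0 0)

theorem norm_sq_isBigO {ε : ℝ} (hε : 0 < ε) {f : ℝ → ℂ} {l : Filter ℝ}
    (hf : f =O[l] fun x : ℝ => Real.exp (-(ε * |x|))) :
    (fun x => ‖f x‖ ^ 2) =O[l] fun x : ℝ => Real.exp (-(ε * |x|)) := by
  simpa [sq] using (isBigO_exp_neg_abs_mul hε hf hf).norm_left

theorem V_isBigO {ε : ℝ} (hε : 0 < ε) (h : ∀ j, ε ≤ (d.k j).re) :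
    d.V =O[cocompact ℝ] fun x : ℝ => Real.exp (-(ε * |x|)) :=
  Asymptotics.IsBigO.fun_sum fun c _ => norm_sq_isBigO hε (d.T_isBigO h c 0)

theorem integrable_V : Integrable d.V := by
  obtain ⟨ε, hε, h⟩ := d.exists_rate
  exact integrable_of_isBigO_exp_neg_abs d.continuous_V hε
    ((d.V_isBigO hε h).trans (isBigO_exp_neg_abs_weaken ε _))

theorem integrable_mul_V : Integrable fun x => x * d.V x := by
  obtain ⟨ε, hε, h⟩ := d.exists_rate
  exact integrable_of_isBigO_exp_neg_abs (continuous_id.mul d.continuous_V) hε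
    (isBigO_id_mul_exp_neg_abs (d.V_isBigO hε h))

theorem integrable_V_sq : Integrable fun x => d.V x ^ 2 := by
  obtain ⟨ε, hε, h⟩ := d.exists_rate
  refine integrable_of_isBigO_exp_neg_abs (d.continuous_V.pow 2) hε
    (Asymptotics.IsBigO.trans ?_ (isBigO_exp_neg_abs_weaken ε _))
  have h1 := (d.V_isBigO hε h).mul (d.V_isBigO hε h)
  refine (h1.trans ?_).congr_left fun x => (sq _).symm
  refine Asymptotics.isBigO_of_le _ fun x => ?_
  rw [← Real.exp_add, Real.norm_eq_abs, Real.norm_eq_abs, Real.abs_exp, Real.abs_exp,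
    Real.exp_le_exp]
  nlinarith [abs_nonneg x]

theorem integrable_T' (c : α) : Integrable fun x => ‖d.T' c x‖ ^ 2 := by
  obtain ⟨ε, hε, h⟩ := d.exists_rate
  exact integrable_of_isBigO_exp_neg_abs ((d.continuous_T' c).norm.pow 2) hε
    ((norm_sq_isBigO hε (d.T'_isBigO h c)).trans (isBigO_exp_neg_abs_weaken ε _))

theorem integrable_conj_T_mul_T' (c : α) :
    Integrable fun x => (conj (d.T c 0 x) * d.T' c x).im := by
  obtain ⟨ε, hε, h⟩ := d.exists_rate
  refine integrable_of_isBigO_exp_neg_abs (Complex.continuous_im.comp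
    ((Complex.continuous_conj.comp (d.continuous_T c 0)).mul (d.continuous_T' c))) hε
    (Asymptotics.IsBigO.trans ?_ (isBigO_exp_neg_abs_weaken ε _))
  refine Asymptotics.IsBigO.trans ?_
    (isBigO_exp_neg_abs_mul hε (d.T_isBigO h c 0) (d.T'_isBigO h c))
  refine Asymptotics.isBigO_of_le _ fun x => ?_
  rw [Real.norm_eq_abs]
  refine (Complex.abs_im_le_norm _).trans ?_
  rw [norm_mul, norm_mul, RCLike.norm_conj]

theorem tendsto_exp_neg_abs_mul_self {ε : ℝ} (hε : 0 < ε) :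
    Tendsto (fun x : ℝ => Real.exp (-(ε * |x|)) * Real.exp (-(ε * |x|))) (cocompact ℝ) (𝓝 0) := by
  have := tendsto_zero_of_isBigO_exp_neg_abs hε (isBigO_exp_neg_abs_weaken ε (cocompact ℝ))
  simpa using this.mul this

theorem S_tendsto_atBot (a b : ℕ) : Tendsto (d.S a b) atBot (𝓝 0) := by
  obtain ⟨ε, hε, h⟩ := d.exists_rate
  exact (d.S_isBigO_atBot h a b).trans_tendsto
    ((tendsto_exp_neg_abs_mul_self hε).mono_left atBot_le_cocompact)

theorem Q_tendsto_atTop (a b : ℕ) : Tendsto (d.Q a b) atTop (𝓝 0) := by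
  obtain ⟨ε, hε, h⟩ := d.exists_rate
  exact (d.Q_isBigO_atTop h a b).trans_tendsto
    ((tendsto_exp_neg_abs_mul_self hε).mono_left atTop_le_cocompact)

theorem T_tendsto (c : α) (b : ℕ) : Tendsto (d.T c b) (cocompact ℝ) (𝓝 0) := by
  obtain ⟨ε, hε, h⟩ := d.exists_rate
  exact tendsto_zero_of_isBigO_exp_neg_abs hε
    ((d.T_isBigO h c b).trans (isBigO_exp_neg_abs_weaken ε _))

theorem integral_V : ∫ x, d.V x = 2 * ∑ i, (d.k i).re := by
  have hbot : Tendsto (fun x => (d.S 0 0 x).re) atBot (𝓝 0) := by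
    simpa using! (Complex.continuous_re.tendsto 0).comp (d.S_tendsto_atBot 0 0)
  have htop : Tendsto (fun x => (d.S 0 0 x).re) atTop (𝓝 (2 * ∑ i, (d.k i).re)) := by
    have h : ∀ x, (d.S 0 0 x).re = 2 * ∑ i, (d.k i).re - (d.Q 0 0 x).re := by
      intro x
      have := congrArg Complex.re (d.trace_zero x)
      rw [Complex.ofReal_re, Complex.add_re] at this
      linarith
    simp only [h]
    have := (Complex.continuous_re.tendsto 0).comp (d.Q_tendsto_atTop 0 0)
    simpa using this.const_sub (2 * ∑ i, (d.k i).re)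
  rw [integral_of_hasDerivAt_of_tendsto d.hasDerivAt_S_re d.integrable_V hbot htop, sub_zero]

/-- S 1 0 is the conjugate of S 0 1, so `trace_one` determines Im S 0 1 up to moments Q, which
vanish at +∞. -/
theorem integral_twist :
    ∫ x, ∑ c, (conj (d.T c 0 x) * d.T' c x).im = -∑ i, (d.k i ^ 2).im := by
  have hbot : Tendsto (fun x => (d.S 0 1 x).im) atBot (𝓝 0) := by
    simpa using! (Complex.continuous_im.tendsto 0).comp (d.S_tendsto_atBot 0 1)
  have htop : Tendsto (fun x => (d.S 0 1 x).im) atTop (𝓝 (-∑ i, (d.k i ^ 2).im)) := by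
    have h : ∀ x, (d.S 0 1 x).im
        = -∑ i, (d.k i ^ 2).im - ((d.Q 0 1 x).im - (d.Q 1 0 x).im) / 2 := by
      intro x
      have h1 := congrArg Complex.im (d.trace_one x)
      have h2 : (d.S 1 0 x).im = -(d.S 0 1 x).im := by rw [← d.S_conj 0 1, Complex.conj_im]
      simp only [Complex.sub_im, Complex.add_im, h2, ← Complex.ofReal_neg,
        Complex.im_ofReal_mul, Complex.I_im, mul_one] at h1
      linarith
    simp only [h]
    have h1 := (Complex.continuous_im.tendsto 0).comp (d.Q_tendsto_atTop 0 1)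
    have h2 := (Complex.continuous_im.tendsto 0).comp (d.Q_tendsto_atTop 1 0)
    simpa using ((h1.sub h2).div_const 2).const_sub (-∑ i, (d.k i ^ 2).im)
  rw [integral_of_hasDerivAt_of_tendsto d.hasDerivAt_S_im
    (integrable_finsetSum _ fun c _ => d.integrable_conj_T_mul_T' c) hbot htop, sub_zero]

/-- Every other summand of `A` contains a factor T, which decays at both ends. Only the second-order
moments contribute boundary values. -/
theorem A_sub_tendsto :
    Tendsto (fun x => d.A x + (d.S 0 2 x - d.S 1 1 x + d.S 2 0 x)) (cocompact ℝ) (𝓝 0) := by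
  obtain ⟨ε, hε, h⟩ := d.exists_rate
  have hc : ∀ c b, Tendsto (fun x => conj (d.T c b x)) (cocompact ℝ) (𝓝 0) := fun c b => by
    simpa using! (Complex.continuous_conj.tendsto 0).comp (d.T_tendsto c b)
  have h1 : Tendsto (fun x => ∑ c, (conj (d.T c 0 x) * d.T c 1 x + conj (d.T c 1 x) * d.T c 0 x))
      (cocompact ℝ) (𝓝 0) := by
    have := tendsto_finsetSum Finset.univ fun c _ =>
      ((hc c 0).mul (d.T_tendsto c 1)).add ((hc c 1).mul (d.T_tendsto c 0))
    simpa using this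
  have h2 : Tendsto (fun x => 2 * (∑ c, conj (d.T c 0 x) * d.T c 0 x) * d.S 0 0 x)
      (cocompact ℝ) (𝓝 0) := by
    have hs : (fun x => 2 * (∑ c, conj (d.T c 0 x) * d.T c 0 x)) =O[cocompact ℝ]
        fun x : ℝ => Real.exp (-(ε * |x|)) := by
      refine Asymptotics.IsBigO.const_mul_left ?_ 2
      refine (d.V_isBigO hε h).norm_left.congr_left (fun x => ?_) |>.of_norm_left
      rw [← ofReal_V, Complex.norm_real]
    refine tendsto_zero_of_isBigO_exp_neg_abs hε
      (Asymptotics.IsBigO.trans ?_ (isBigO_exp_neg_abs_weaken ε _))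
    simpa using hs.mul (d.S_isBigO_one 0 0)
  have h3 := h1.sub h2
  rw [sub_zero] at h3
  refine h3.congr fun x => ?_
  rw [A]; ring

theorem integral_energy :
    ∫ x, (3 * ∑ c, ‖d.T' c x‖ ^ 2 - 3 * d.V x ^ 2) = -(2 * ∑ i, (d.k i ^ 3).re) := by
  have hre : Tendsto (fun x => (d.A x + (d.S 0 2 x - d.S 1 1 x + d.S 2 0 x)).re)
      (cocompact ℝ) (𝓝 0) := by
    simpa using! (Complex.continuous_re.tendsto 0).comp d.A_sub_tendsto
  have hbot : Tendsto (fun x => (d.A x).re) atBot (𝓝 0) := by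
    have h1 := (((d.S_tendsto_atBot 0 2).sub (d.S_tendsto_atBot 1 1)).add (d.S_tendsto_atBot 2 0))
    have h2 := (Complex.continuous_re.tendsto _).comp h1
    have h3 := (hre.mono_left atBot_le_cocompact).sub h2
    simpa using h3
  have htop : Tendsto (fun x => (d.A x).re) atTop (𝓝 (-(2 * ∑ i, (d.k i ^ 3).re))) := by
    have h1 := (((d.Q_tendsto_atTop 0 2).sub (d.Q_tendsto_atTop 1 1)).add (d.Q_tendsto_atTop 2 0))
    have h2 := (Complex.continuous_re.tendsto _).comp h1
    have h3 := ((hre.mono_left atTop_le_cocompact).add h2).sub_const (2 * ∑ i, (d.k i ^ 3).re)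
    simp only [sub_zero, add_zero, Complex.zero_re, zero_sub] at h3
    refine h3.congr fun x => ?_
    have := congrArg Complex.re (d.trace_two x)
    rw [Complex.ofReal_re] at this
    simp only [Function.comp_apply, Complex.add_re, Complex.sub_re] at this ⊢
    linarith
  have hder : ∀ x, HasDerivAt (fun y => (d.A y).re)
      (3 * ∑ c, ‖d.T' c x‖ ^ 2 - 3 * d.V x ^ 2) x := fun x =>
    Complex.reCLM.hasFDerivAt.comp_hasDerivAt x (d.hasDerivAt_A x)
  rw [integral_of_hasDerivAt_of_tendsto hder
    (((integrable_finsetSum _ fun c _ => d.integrable_T' c).const_mul 3).sub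
      (d.integrable_V_sq.const_mul 3)) hbot htop, sub_zero]

theorem det_re_ne (x : ℝ) : (d.M x).det.re ≠ 0 := by
  intro h
  have := d.det_ne x
  rw [det_re, h] at this
  simp at this

theorem tendsto_log_det {l : Filter ℝ} {N : ℝ → Matrix (Fin n) (Fin n) ℂ}
    {p : Fin n → ℂ} {q : α → Fin n → ℂ}
    (h : ∀ i j, Tendsto (fun x => N x i j) l (𝓝 (lyapunovMatrix d.k p q i j)))
    (h0 : (lyapunovMatrix d.k p q).det ≠ 0) :
    Tendsto (fun x => Real.log (N x).det.re) l
      (𝓝 (Real.log (lyapunovMatrix d.k p q).det.re)) := by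
  have hN : Tendsto N l (𝓝 (lyapunovMatrix d.k p q)) :=
    tendsto_pi_nhds.mpr fun i => tendsto_pi_nhds.mpr (h i)
  have hdet := ((continuous_id.matrix_det (n := Fin n) (R := ℂ)).tendsto _).comp hN
  have hre := (Complex.continuous_re.tendsto _).comp hdet
  refine hre.log fun hz => h0 ?_
  rw [← (Complex.conj_eq_iff_re.mp (lyapunovMatrix_det_conj (k := d.k) (p := p) (q := q)))]
  simpa using hz

/-- Integration by parts with V = (S 0 0)' and S 0 0 = (log det M)'. Only boundary terms remain: the
determinants at both ends and the moduli of the amplitudes, which encode the positions of the waves.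
-/
theorem integral_mul_V :
    ∫ x, x * d.V x
      = Real.log d.Mbot.det.re - Real.log d.Mtop.det.re - 2 * ∑ i, Real.log ‖d.P i‖ := by
  obtain ⟨ε, hε, h⟩ := d.exists_rate
  -- S at -∞ and Q at +∞ decay like the square of the exponential, which absorbs the factor x.
  have hmul : ∀ {l : Filter ℝ} {f : ℝ → ℂ}, l ≤ cocompact ℝ →
      f =O[l] (fun x : ℝ => Real.exp (-(ε * |x|)) * Real.exp (-(ε * |x|))) →
      Tendsto (fun x => x * (f x).re) l (𝓝 0) := by
    intro l f hl hf
    have hw : (fun x => x * (Real.exp (-(ε * |x|)) * Real.exp (-(ε * |x|)))) =O[cocompact ℝ]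
        fun x : ℝ => (1 + |x|) * Real.exp (-(ε * |x|)) := by
      refine isBigO_id_mul_exp_neg_abs (Asymptotics.isBigO_of_le _ fun x => ?_)
      rw [← Real.exp_add, Real.norm_eq_abs, Real.norm_eq_abs, Real.abs_exp, Real.abs_exp,
        Real.exp_le_exp]
      nlinarith [abs_nonneg x]
    have hre : (fun x => (f x).re) =O[l] f := Asymptotics.isBigO_of_le _ fun x => by
      simpa using Complex.abs_re_le_norm (f x)
    exact ((Asymptotics.isBigO_refl (fun x : ℝ => x) l).mul (hre.trans hf)).trans_tendsto
      ((tendsto_zero_of_isBigO_exp_neg_abs hε hw).mono_left hl)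
  have hder : ∀ x, HasDerivAt (fun y => y * (d.S 0 0 y).re - Real.log (d.M y).det.re)
      (x * d.V x) x := by
    intro x
    refine (((hasDerivAt_id x).mul (d.hasDerivAt_S_re x)).sub
      (d.hasDerivAt_log_det x)).congr_deriv ?_
    simp
  have hbot : Tendsto (fun y => y * (d.S 0 0 y).re - Real.log (d.M y).det.re) atBot
      (𝓝 (0 - Real.log d.Mbot.det.re)) :=
    (hmul atBot_le_cocompact (d.S_isBigO_atBot h 0 0)).sub
      (d.tendsto_log_det d.M_tendsto d.Mbot_det_ne)
  have htop : Tendsto (fun y => y * (d.S 0 0 y).re - Real.log (d.M y).det.re) atTop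
      (𝓝 (-0 - Real.log d.Mtop.det.re - 2 * ∑ i, Real.log ‖d.P i‖)) := by
    have h1 := ((hmul atTop_le_cocompact (d.Q_isBigO_atTop h 0 0)).neg.sub
      (d.tendsto_log_det d.Mscaled_tendsto d.Mtop_det_ne)).sub_const
        (2 * ∑ i, Real.log ‖d.P i‖)
    -- At +∞ the linear growth 2x ΣRe k_j of x S 0 0 cancels that of log det M; the latter comes
    -- from the factor Π|p_j|² removed by the scaling.
    refine h1.congr fun x => ?_
    have hS : (d.S 0 0 x).re = 2 * ∑ i, (d.k i).re - (d.Q 0 0 x).re := by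
      have := congrArg Complex.re (d.trace_zero x)
      rw [Complex.ofReal_re, Complex.add_re] at this
      linarith
    have hdet := congrArg Complex.re (d.det_M_eq x)
    rw [mul_comm, Complex.re_ofReal_mul] at hdet
    have hne := d.det_re_ne x
    rw [hdet] at hne
    have hp : ∀ i, ‖d.p x i‖ ^ 2 ≠ 0 := fun i => pow_ne_zero _ (norm_ne_zero_iff.mpr (d.p_ne x i))
    have hlog : ∀ i, Real.log (‖d.p x i‖ ^ 2) = 2 * Real.log ‖d.P i‖ + 2 * ((d.k i).re * x) := by
      intro i
      rw [Real.log_pow, norm_p, Real.log_mul (norm_ne_zero_iff.mpr (d.P_ne i)) (Real.exp_ne_zero _),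
        Real.log_exp]
      push_cast; ring
    rw [hS, hdet, Real.log_mul (left_ne_zero_of_mul hne) (right_ne_zero_of_mul hne),
      Real.log_prod fun i _ => hp i]
    simp only [hlog, Finset.sum_add_distrib, ← Finset.mul_sum, ← Finset.sum_mul]
    ring
  rw [integral_of_hasDerivAt_of_tendsto hder d.integrable_mul_V hbot htop]
  ring

end SolitonData

/-! ### Fields with a multi-soliton profile -/

/-- At each time, `u` has the modulus of a multi-soliton profile, up to the factor `1 / 2`. -/
structure HasProfile {n : ℕ} {α : Type*} [Fintype α] (u : ℝ → ℝ → ℂ)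
    (d : ℝ → SolitonData n α) : Prop where
  smooth : ContDiff ℝ ∞ (fun q : ℝ × ℝ => u q.1 q.2)
  norm_sq : ∀ t x, ‖u t x‖ ^ 2 = (d t).V x / 4
  norm_deriv_sq : ∀ t x, ‖deriv (u t) x‖ ^ 2 = (∑ c, ‖(d t).T' c x‖ ^ 2) / 4

namespace HasProfile

variable {n : ℕ} {α : Type*} [Fintype α] {u : ℝ → ℝ → ℂ} {d : ℝ → SolitonData n α}

theorem momentum_eq (h : HasProfile u d) (t : ℝ) :
    momentum u t = 1 / 2 * ∑ i, ((d t).k i).re := by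
  simp only [momentum, momentumDensity, h.norm_sq, integral_div, SolitonData.integral_V]
  ring

theorem energyDensity_eq (h : HasProfile u d) (t x : ℝ) :
    energyDensity u t x
      = -(1 / 4) * (3 * ∑ c, ‖(d t).T' c x‖ ^ 2 - 3 * (d t).V x ^ 2) := by
  have : ‖u t x‖ ^ 4 = ((d t).V x / 4) ^ 2 := by rw [← h.norm_sq]; ring
  rw [energyDensity, this, h.norm_deriv_sq]
  ring

theorem energy_eq (h : HasProfile u d) (t : ℝ) :
    energy u t = 1 / 2 * ∑ i, ((d t).k i ^ 3).re := by
  simp only [energy, h.energyDensity_eq, integral_const_mul, SolitonData.integral_energy]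
  ring

theorem momentDensity_eq (h : HasProfile u d) (t x : ℝ) :
    momentDensity u t x = x * (d t).V x / 4 := by
  rw [momentDensity, h.norm_sq]; ring

theorem moment_eq (h : HasProfile u d) (t : ℝ) :
    ∫ x, momentDensity u t x = 1 / 4 * (Real.log (d t).Mbot.det.re - Real.log (d t).Mtop.det.re
      - 2 * ∑ i, Real.log ‖(d t).P i‖) := by
  simp only [h.momentDensity_eq, integral_div, SolitonData.integral_mul_V]
  ring

theorem integrable_energy (h : HasProfile u d) (t : ℝ) : Integrable (energyDensity u t) := by
  have : energyDensity u t = _ := funext (h.energyDensity_eq t)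
  rw [this]
  exact (((integrable_finsetSum _ fun c _ => (d t).integrable_T' c).const_mul 3).sub
      ((d t).integrable_V_sq.const_mul 3)).const_mul _

theorem integrable_moment (h : HasProfile u d) (t : ℝ) : Integrable (momentDensity u t) := by
  have : momentDensity u t = _ := funext (h.momentDensity_eq t)
  rw [this]
  exact (d t).integrable_mul_V.div_const 4

theorem contDiff_slice (h : HasProfile u d) (t : ℝ) : ContDiff ℝ ∞ (u t) :=
  h.smooth.comp (contDiff_const.prodMk contDiff_id)

theorem hasFiniteIntegrals (h : HasProfile u d) (hn : 0 < n) : HasFiniteIntegrals u where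
  smooth := h.smooth
  integrable_momentum t := by
    have : momentumDensity u t = _ := funext (h.norm_sq t)
    rw [this]
    exact (d t).integrable_V.div_const 4
  integrable_energy := h.integrable_energy
  integrable_moment := h.integrable_moment
  integrable_galilean t := ((h.integrable_energy t).const_mul t).sub (h.integrable_moment t)
  integrable_twist t := by
    have hu := h.contDiff_slice t
    have hu' : Continuous (deriv (u t)) := hu.continuous_deriv (by simp)
    -- The twist density is dominated through |u u_x| ≤ (|u|² + |u_x|²)/2, whose right side is
    -- already integrable.
    have hb : Integrable fun x =>
        ((d t).V x / 4 + (∑ c, ‖(d t).T' c x‖ ^ 2) / 4) / 2 :=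
      (((d t).integrable_V.div_const 4).add
        ((integrable_finsetSum _ fun c _ => (d t).integrable_T' c).div_const 4)).div_const 2
    refine hb.mono' (Complex.continuous_re.comp ((continuous_const.mul hu.continuous).mul
      (Complex.continuous_conj.comp hu'))).aestronglyMeasurable (ae_of_all _ fun x => ?_)
    rw [← h.norm_sq, ← h.norm_deriv_sq, twistDensity, Real.norm_eq_abs]
    refine (Complex.abs_re_le_norm _).trans ?_
    rw [norm_mul, norm_mul, Complex.norm_I, RCLike.norm_conj]
    nlinarith [sq_nonneg (‖u t x‖ - ‖deriv (u t) x‖)]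
  momentum_pos t := by
    have : Nonempty (Fin n) := ⟨⟨0, hn⟩⟩
    rw [h.momentum_eq]
    have := Finset.sum_pos (fun i _ => (d t).re_pos i) Finset.univ_nonempty
    positivity

theorem galileanEnergy_eq (h : HasProfile u d) (t : ℝ) :
    galileanEnergy u t = t * energy u t - ∫ x, momentDensity u t x := by
  simp only [galileanEnergy, galileanDensity]
  rw [integral_sub ((h.integrable_energy t).const_mul t) (h.integrable_moment t),
    integral_const_mul]
  rfl

end HasProfile

/-! ### Kinematics -/

section Kinematics

variable {c ν : ℝ}

/-- If β₋ ≤ -β₊, cubing gives 2√disc ≤ 0. -/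
theorem invWidth_pos (h : 0 < disc c ν) : 0 < invWidth c ν := by
  have h1 := cbrt_pow_three (√(disc c ν) + ν / 2)
  have h2 := cbrt_pow_three (√(disc c ν) - ν / 2)
  have h3 : 0 < √(disc c ν) := Real.sqrt_pos.mpr h
  have : 0 < betaMinus c ν + betaPlus c ν := by
    by_contra hneg
    push Not at hneg
    have : betaMinus c ν ≤ -betaPlus c ν := by linarith
    have h4 : betaMinus c ν ^ 3 ≤ (-betaPlus c ν) ^ 3 :=
      Odd.strictMono_pow (by decide) |>.monotone this
    rw [Odd.neg_pow (by decide), betaMinus, betaPlus, h1, h2] at h4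
    linarith
  rw [invWidth]
  positivity

/-- If β₋ = β₊, their cubes agree, and these differ by ν. -/
theorem waveNumber_ne_zero (hν : ν ≠ 0) : waveNumber c ν ≠ 0 := by
  intro h
  have h1 := cbrt_pow_three (√(disc c ν) + ν / 2)
  have h2 := cbrt_pow_three (√(disc c ν) - ν / 2)
  have h3 : betaMinus c ν = betaPlus c ν := by rw [waveNumber] at h; linarith
  have h4 : betaMinus c ν ^ 3 = betaPlus c ν ^ 3 := by rw [h3]
  rw [betaMinus, betaPlus, h1, h2] at h4
  exact hν (by linarith)

/-- Cardano: the cube of β₋β₊ is disc - ν²/4 = (c/3)³, so β₋β₊ = c/3. Finally k² - 3κ² = 3β₋β₊. -/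
theorem speed_eq (h : 0 < disc c ν) : c = invWidth c ν ^ 2 - 3 * waveNumber c ν ^ 2 := by
  have h1 := cbrt_pow_three (√(disc c ν) + ν / 2)
  have h2 := cbrt_pow_three (√(disc c ν) - ν / 2)
  have h3 : √(disc c ν) ^ 2 = (c / 3) ^ 3 + (ν / 2) ^ 2 := Real.sq_sqrt h.le
  have h4 : (betaMinus c ν * betaPlus c ν) ^ 3 = (c / 3) ^ 3 := by
    rw [mul_pow, betaMinus, betaPlus, h1, h2]
    linear_combination h3
  have h5 : betaMinus c ν * betaPlus c ν = c / 3 :=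
    Odd.strictMono_pow (R := ℝ) (n := 3) (by decide) |>.injective h4
  have h6 : √3 ^ 2 = (3 : ℝ) := Real.sq_sqrt (by norm_num)
  rw [invWidth, waveNumber]
  linear_combination (-(3 : ℝ)) * h5 - (betaMinus c ν + betaPlus c ν) ^ 2 / 4 * h6

end Kinematics

/-! ### Exponentials of real angles -/

namespace Params

theorem expI_add (a b : ℝ) : expI (a + b) = expI a * expI b := by
  simp only [expI, ← Complex.exp_add]; congr 1; push_cast; ring

theorem expI_neg (a : ℝ) : expI (-a) = (expI a)⁻¹ := by
  simp only [expI, ← Complex.exp_neg]; congr 1; push_cast; ring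

theorem expI_sub (a b : ℝ) : expI (a - b) = expI a / expI b := by
  rw [sub_eq_add_neg, expI_add, expI_neg, div_eq_mul_inv]

theorem expI_ne_zero (a : ℝ) : expI a ≠ 0 := Complex.exp_ne_zero _

theorem norm_expI (a : ℝ) : ‖expI a‖ = 1 := by
  rw [expI, Complex.norm_exp]; simp

theorem conj_expI (a : ℝ) : conj (expI a) = (expI a)⁻¹ := by
  rw [Complex.inv_def, Complex.normSq_eq_norm_sq, norm_expI]; simp

theorem expI_im (a : ℝ) : (expI a).im = Real.sin a := by
  rw [expI, mul_comm, Complex.exp_ofReal_mul_I_im]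

theorem expI_half_sq (a : ℝ) : expI (a / 2) ^ 2 = expI a := by
  rw [sq, ← expI_add]; congr 1; ring

theorem expI_arg {z : ℂ} (hz : z ≠ 0) : expI (Complex.arg z) = z / ‖z‖ := by
  have h : (‖z‖ : ℂ) ≠ 0 := by exact_mod_cast norm_ne_zero_iff.mpr hz
  rw [eq_div_iff h, expI, mul_comm Complex.I, mul_comm]
  exact Complex.norm_mul_exp_arg_mul_I z

theorem coshI_eq (a b : ℝ) :
    coshI a b = (Complex.exp a * expI b + (Complex.exp a)⁻¹ * (expI b)⁻¹) / 2 := by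
  simp only [coshI, Complex.cosh, expI, ← Complex.exp_neg, ← Complex.exp_add]
  congr 3; ring

/-! ### The spectral parameters -/

/-- The first pole `k₁ + i κ₁`. -/
def l₁ (p : Params) : ℂ := ⟨p.k₁, p.κ₁⟩
/-- The second pole `k₂ + i κ₂`. -/
def l₂ (p : Params) : ℂ := ⟨p.k₂, p.κ₂⟩

/-- The two waves have positive widths, nonzero wave numbers and distinct speeds. -/
structure Regular (p : Params) : Prop where
  k₁_pos : 0 < p.k₁
  k₂_pos : 0 < p.k₂
  κ₁_ne : p.κ₁ ≠ 0
  κ₂_ne : p.κ₂ ≠ 0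
  ne : p.l₁ ≠ p.l₂
  ne_conj : p.l₁ ≠ conj p.l₂

variable {p : Params}

/-- The speed depends only on k and κ², so equal or conjugate poles would force equal speeds. -/
theorem regular (hc : p.c₁ ≠ p.c₂) (hν₁ : p.ν₁ ≠ 0) (hν₂ : p.ν₂ ≠ 0)
    (h₁ : 0 < disc p.c₁ p.ν₁) (h₂ : 0 < disc p.c₂ p.ν₂) : p.Regular where
  k₁_pos := invWidth_pos h₁
  k₂_pos := invWidth_pos h₂
  κ₁_ne := waveNumber_ne_zero hν₁
  κ₂_ne := waveNumber_ne_zero hν₂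
  ne := by
    intro h
    have e1 : p.k₁ = p.k₂ := congrArg Complex.re h
    have e2 : p.κ₁ = p.κ₂ := congrArg Complex.im h
    refine hc ?_
    rw [speed_eq h₁, speed_eq h₂]
    change p.k₁ ^ 2 - 3 * p.κ₁ ^ 2 = p.k₂ ^ 2 - 3 * p.κ₂ ^ 2
    rw [e1, e2]
  ne_conj := by
    intro h
    have e1 : p.k₁ = p.k₂ := congrArg Complex.re h
    have e2 : p.κ₁ = -p.κ₂ := congrArg Complex.im h
    refine hc ?_
    rw [speed_eq h₁, speed_eq h₂]
    change p.k₁ ^ 2 - 3 * p.κ₁ ^ 2 = p.k₂ ^ 2 - 3 * p.κ₂ ^ 2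
    rw [e1, e2]
    ring

namespace Regular

theorem l₁_ne (h : p.Regular) : p.l₁ ≠ 0 := fun e => h.k₁_pos.ne' (congrArg Complex.re e)

theorem l₂_ne (h : p.Regular) : p.l₂ ≠ 0 := fun e => h.k₂_pos.ne' (congrArg Complex.re e)

theorem add_ne (h : p.Regular) : p.l₁ + p.l₂ ≠ 0 := fun e => by
  have := congrArg Complex.re e
  simp only [l₁, l₂, Complex.add_re, Complex.zero_re] at this
  linarith [h.k₁_pos, h.k₂_pos]

theorem add_conj_ne (h : p.Regular) : p.l₁ + conj p.l₂ ≠ 0 := fun e => by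
  have := congrArg Complex.re e
  simp only [l₁, l₂, Complex.add_re, Complex.conj_re, Complex.zero_re] at this
  linarith [h.k₁_pos, h.k₂_pos]

end Regular

theorem two_k₁ : 2 * (p.k₁ : ℂ) = p.l₁ + conj p.l₁ := by
  rw [Complex.add_conj]; simp [l₁]
theorem two_k₂ : 2 * (p.k₂ : ℂ) = p.l₂ + conj p.l₂ := by
  rw [Complex.add_conj]; simp [l₂]
theorem two_I_κ₁ : 2 * (p.κ₁ : ℂ) * Complex.I = p.l₁ - conj p.l₁ := by
  rw [Complex.sub_conj]; simp [l₁]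
theorem two_I_κ₂ : 2 * (p.κ₂ : ℂ) * Complex.I = p.l₂ - conj p.l₂ := by
  rw [Complex.sub_conj]; simp [l₂]

theorem norm_sq_add : (p.k₁ + p.k₂) ^ 2 + (p.κ₁ + p.κ₂) ^ 2 = ‖p.l₁ + p.l₂‖ ^ 2 := by
  rw [← Complex.normSq_eq_norm_sq, Complex.normSq_apply]; simp [l₁, l₂]; ring
theorem norm_sq_sub : (p.k₁ - p.k₂) ^ 2 + (p.κ₁ - p.κ₂) ^ 2 = ‖p.l₁ - p.l₂‖ ^ 2 := by
  rw [← Complex.normSq_eq_norm_sq, Complex.normSq_apply]; simp [l₁, l₂]; ring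
theorem norm_sq_add_conj :
    (p.k₁ + p.k₂) ^ 2 + (p.κ₁ - p.κ₂) ^ 2 = ‖p.l₁ + conj p.l₂‖ ^ 2 := by
  rw [← Complex.normSq_eq_norm_sq, Complex.normSq_apply]; simp [l₁, l₂]; ring
theorem norm_sq_sub_conj :
    (p.k₁ - p.k₂) ^ 2 + (p.κ₁ + p.κ₂) ^ 2 = ‖p.l₁ - conj p.l₂‖ ^ 2 := by
  rw [← Complex.normSq_eq_norm_sq, Complex.normSq_apply]; simp [l₁, l₂]; ring

theorem r₁_eq : p.r₁ = ‖p.l₁‖ := by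
  rw [r₁, Complex.norm_eq_sqrt_sq_add_sq]; rfl

theorem Ω_eq : p.Ω = ‖p.l₁ + p.l₂‖ * ‖p.l₁ - conj p.l₂‖ := by
  rw [Ω, norm_sq_add, norm_sq_sub_conj, ← mul_pow, Real.sqrt_sq (by positivity)]

theorem Υ_eq : p.Υ = (‖p.l₁ - p.l₂‖ * ‖p.l₁ + conj p.l₂‖) ^ 2 := by
  rw [Υ, norm_sq_sub, norm_sq_add_conj, ← mul_pow]

theorem sqrt_Υ : √p.Υ = ‖p.l₁ - p.l₂‖ * ‖p.l₁ + conj p.l₂‖ := by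
  rw [Υ_eq, Real.sqrt_sq (by positivity)]

theorem Δ_eq : p.Δ = ‖p.l₁ - conj p.l₂‖ / ‖p.l₁ + p.l₂‖ := by
  rw [Δ, norm_sq_add, norm_sq_sub_conj, ← div_pow, Real.sqrt_sq (by positivity)]

theorem Γ_eq : p.Γ = (‖p.l₁ - p.l₂‖ / ‖p.l₁ + conj p.l₂‖) ^ 2 := by
  rw [Γ, norm_sq_sub, norm_sq_add_conj, ← div_pow]

theorem sqrt_Γ : √p.Γ = ‖p.l₁ - p.l₂‖ / ‖p.l₁ + conj p.l₂‖ := by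
  rw [Γ_eq, Real.sqrt_sq (by positivity)]

theorem norm_sq_eq (z : ℂ) : (‖z‖ : ℂ) ^ 2 = z * conj z := (Complex.mul_conj' z).symm

theorem expI_γ₁ (h : p.Regular) :
    expI p.γ₁ = (p.l₁ - p.l₂) * (p.l₁ + conj p.l₂) / (√p.Υ : ℝ) := by
  have e : (⟨p.k₁ ^ 2 - p.k₂ ^ 2 - (p.κ₁ - p.κ₂) ^ 2, 2 * p.k₁ * (p.κ₁ - p.κ₂)⟩ : ℂ)
      = (p.l₁ - p.l₂) * (p.l₁ + conj p.l₂) := by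
    apply Complex.ext <;> simp [l₁, l₂] <;> ring
  rw [γ₁, e, expI_arg (mul_ne_zero (sub_ne_zero.mpr h.ne) h.add_conj_ne), norm_mul, sqrt_Υ]

theorem expI_γ₂ (h : p.Regular) :
    expI p.γ₂ = -((p.l₁ - p.l₂) * (conj p.l₁ + p.l₂)) / (√p.Υ : ℝ) := by
  have e : (⟨p.k₂ ^ 2 - p.k₁ ^ 2 - (p.κ₁ - p.κ₂) ^ 2, -(2 * p.k₂ * (p.κ₁ - p.κ₂))⟩ : ℂ)
      = -((p.l₁ - p.l₂) * conj (p.l₁ + conj p.l₂)) := by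
    apply Complex.ext <;> simp [l₁, l₂] <;> ring
  rw [γ₂, e, expI_arg (neg_ne_zero.mpr (mul_ne_zero (sub_ne_zero.mpr h.ne)
    ((map_ne_zero _).mpr h.add_conj_ne))), norm_neg, norm_mul, RCLike.norm_conj, sqrt_Υ]
  simp

theorem expI_lam {k κ : ℝ} (hκ : κ ≠ 0) :
    expI (Complex.arg (κ * (κ + Complex.I * k)))
      = Complex.I * Real.sign κ * conj (⟨k, κ⟩ : ℂ) / ‖(⟨k, κ⟩ : ℂ)‖ := by
  have e : (κ * (κ + Complex.I * k) : ℂ) = Complex.I * κ * conj (⟨k, κ⟩ : ℂ) := by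
    apply Complex.ext <;> simp
  have hl : conj (⟨k, κ⟩ : ℂ) ≠ 0 := (map_ne_zero _).mpr fun e => hκ (congrArg Complex.im e)
  have hκ' : (κ : ℂ) ≠ 0 := by exact_mod_cast hκ
  rw [e, expI_arg (mul_ne_zero (mul_ne_zero Complex.I_ne_zero hκ') hl), norm_mul, norm_mul,
    RCLike.norm_conj, Complex.norm_I, one_mul, Complex.norm_real, Real.norm_eq_abs]
  have hn : (‖(⟨k, κ⟩ : ℂ)‖ : ℂ) ≠ 0 := by
    exact_mod_cast norm_ne_zero_iff.mpr fun e => hκ (congrArg Complex.im e)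
  rcases lt_or_gt_of_ne hκ with hneg | hpos
  · rw [Real.sign_of_neg hneg, abs_of_neg hneg]
    push_cast
    field_simp
  · rw [Real.sign_of_pos hpos, abs_of_pos hpos]
    push_cast
    field_simp

theorem expI_δ₁ (h : p.Regular) :
    expI p.δ₁ = (p.l₂ - conj p.l₁) * (conj p.l₁ + conj p.l₂) / (p.Ω : ℝ) := by
  have e : (⟨p.k₂ ^ 2 - p.k₁ ^ 2 + (p.κ₁ + p.κ₂) ^ 2, 2 * p.k₁ * (p.κ₁ + p.κ₂)⟩ : ℂ)
      = -(conj (p.l₁ - conj p.l₂) * conj (p.l₁ + p.l₂)) := by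
    apply Complex.ext <;> simp [l₁, l₂] <;> ring
  rw [δ₁, e, expI_arg (neg_ne_zero.mpr (mul_ne_zero
    ((map_ne_zero _).mpr (sub_ne_zero.mpr h.ne_conj)) ((map_ne_zero _).mpr h.add_ne))), norm_neg,
    norm_mul, RCLike.norm_conj, RCLike.norm_conj, Ω_eq]
  simp only [map_sub, map_add, Complex.conj_conj]
  push_cast
  ring

theorem expI_δ₂ (h : p.Regular) :
    expI p.δ₂ = (p.l₁ - conj p.l₂) * (conj p.l₁ + conj p.l₂) / (p.Ω : ℝ) := by
  have e : (⟨p.k₁ ^ 2 - p.k₂ ^ 2 + (p.κ₁ + p.κ₂) ^ 2, 2 * p.k₂ * (p.κ₁ + p.κ₂)⟩ : ℂ)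
      = (p.l₁ - conj p.l₂) * conj (p.l₁ + p.l₂) := by
    apply Complex.ext <;> simp [l₁, l₂] <;> ring
  rw [δ₂, e, expI_arg (mul_ne_zero (sub_ne_zero.mpr h.ne_conj) ((map_ne_zero _).mpr h.add_ne)),
    norm_mul, RCLike.norm_conj, Ω_eq]
  simp only [map_add]
  push_cast
  ring

/-- The branch of the half-angles `δ₁ / 2`, `δ₂ / 2` is the one with the sign `s`. -/
theorem expI_half_δ_mul (h : p.Regular) :
    expI (p.δ₁ / 2) * expI (p.δ₂ / 2)
      = p.s * Complex.I * (conj p.l₁ + conj p.l₂) / ‖p.l₁ + p.l₂‖ := by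
  have hnp : (‖p.l₁ + p.l₂‖ : ℂ) ≠ 0 := by exact_mod_cast norm_ne_zero_iff.mpr h.add_ne
  have hnm : (‖p.l₁ - conj p.l₂‖ : ℂ) ≠ 0 := by
    exact_mod_cast norm_ne_zero_iff.mpr (sub_ne_zero.mpr h.ne_conj)
  have hs : (p.s : ℂ) ^ 2 = 1 := by rw [s]; split_ifs <;> norm_num
  have hsq : (expI (p.δ₁ / 2) * expI (p.δ₂ / 2)) ^ 2
      = (p.s * Complex.I * (conj p.l₁ + conj p.l₂) / ‖p.l₁ + p.l₂‖) ^ 2 := by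
    rw [mul_pow, expI_half_sq, expI_half_sq, expI_δ₁ h, expI_δ₂ h, Ω_eq, div_pow, mul_pow, mul_pow,
      hs, Complex.I_sq]
    have := norm_sq_eq (p.l₁ - conj p.l₂)
    simp only [map_sub, Complex.conj_conj] at this
    push_cast
    field_simp
    rw [this]
    ring
  -- The angles determine the square of the product; the remaining sign is read off from the
  -- imaginary part sin((δ₁ + δ₂)/2).
  rcases sq_eq_sq_iff_eq_or_eq_neg.mp hsq with e | e
  · exact e
  · exfalso
    have him := congrArg Complex.im e
    rw [← expI_add, expI_im] at him
    have hr : (-(p.s * Complex.I * (conj p.l₁ + conj p.l₂) / ‖p.l₁ + p.l₂‖) : ℂ).im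
        = -(p.s * (p.k₁ + p.k₂) / ‖p.l₁ + p.l₂‖) := by
      rw [Complex.neg_im, Complex.div_ofReal_im, mul_assoc, Complex.im_ofReal_mul]
      simp [l₁, l₂]
    rw [hr] at him
    have hpos : 0 < (p.k₁ + p.k₂) / ‖p.l₁ + p.l₂‖ :=
      div_pos (add_pos h.k₁_pos h.k₂_pos) (norm_pos_iff.mpr h.add_ne)
    -- Both δ₁ and δ₂ have the sign of κ₁ + κ₂, so (δ₁ + δ₂)/2 lies in [0, π] or in [-π, 0]. At κ₁ +
    -- κ₂ = 0 each angle is 0 or π, which selects s = 1.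
    by_cases hS : 0 ≤ p.κ₁ + p.κ₂
    · have h1 : 0 ≤ p.δ₁ := Complex.arg_nonneg_iff.mpr
        (mul_nonneg (mul_nonneg zero_le_two h.k₁_pos.le) hS)
      have h2 : 0 ≤ p.δ₂ := Complex.arg_nonneg_iff.mpr
        (mul_nonneg (mul_nonneg zero_le_two h.k₂_pos.le) hS)
      have h3 : p.δ₁ ≤ Real.pi := Complex.arg_le_pi _
      have h4 : p.δ₂ ≤ Real.pi := Complex.arg_le_pi _
      have := Real.sin_nonneg_of_nonneg_of_le_pi (x := p.δ₁ / 2 + p.δ₂ / 2)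
        (by linarith) (by linarith)
      rw [him, s, if_pos hS, one_mul] at this
      linarith
    · push Not at hS
      have h1 : p.δ₁ < 0 := Complex.arg_neg_iff.mpr
        (mul_neg_of_pos_of_neg (mul_pos two_pos h.k₁_pos) hS)
      have h2 : p.δ₂ < 0 := Complex.arg_neg_iff.mpr
        (mul_neg_of_pos_of_neg (mul_pos two_pos h.k₂_pos) hS)
      have h3 : -Real.pi < p.δ₁ := Complex.neg_pi_lt_arg _
      have h4 : -Real.pi < p.δ₂ := Complex.neg_pi_lt_arg _
      have := Real.sin_nonpos_of_nonpos_of_neg_pi_le (x := p.δ₁ / 2 + p.δ₂ / 2)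
        (by linarith) (by linarith)
      rw [him, s, if_neg (not_le.mpr hS), neg_one_mul, neg_div, neg_neg] at this
      linarith

end Params

open Params

/-! ### Fields given by a profile -/

/-- Cramer's rule along rows. It is the bridge from the abstract profile to the quotients V/W. -/
theorem invForm_eq_det {n : ℕ} {M : Matrix (Fin n) (Fin n) ℂ} (g h : Fin n → ℂ) :
    invForm M g h = (∑ j, conj (h j) * (M.updateRow j g).det) / M.det := by
  have hcol : ∀ j, (M.updateRow j g).det = ∑ i, g i * M.adjugate i j := by
    intro j
    rw [← Matrix.cramer_transpose_apply, Matrix.cramer_eq_adjugate_mulVec,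
      ← Matrix.adjugate_transpose]
    simp only [Matrix.mulVec, dotProduct, Matrix.transpose_apply, mul_comm]
  simp only [hcol, invForm, Matrix.inv_def, Matrix.smul_apply, Ring.inverse_eq_inv', smul_eq_mul]
  rw [Finset.sum_comm, Finset.sum_div]
  refine Finset.sum_congr rfl fun j _ => ?_
  rw [Finset.mul_sum, Finset.sum_div]
  exact Finset.sum_congr rfl fun i _ => by ring

namespace SolitonData

variable {n : ℕ} {α : Type*} [Fintype α] (d : SolitonData n α)

/-- The component of the soliton profile along the row `c`. -/
def profile (c : α) (x : ℝ) : ℂ := invForm (d.M x) (d.p x) (d.q c)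

theorem profile_eq (c : α) (x : ℝ) : d.profile c x = conj (d.T c 0 x) := by
  rw [T, pk_zero, M, invForm_conj]; rfl

theorem hasDerivAt_profile (c : α) (x : ℝ) :
    HasDerivAt (d.profile c) (conj (d.T' c x)) x := by
  have : d.profile c = fun y => conj (d.T c 0 y) := funext (d.profile_eq c)
  rw [this]
  exact (d.hasDerivAt_T_zero c x).star

end SolitonData

theorem deriv_eq_of_profile {n : ℕ} {α : Type*} [Fintype α] {u : ℝ → ℂ} {d : SolitonData n α}
    {c : α} {z : ℂ} (hu : ∀ x, u x = z * d.profile c x) (x : ℝ) :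
    deriv u x = z * conj (d.T' c x) := by
  rw [show u = fun y => z * d.profile c y from funext hu]
  exact ((d.hasDerivAt_profile c x).const_mul z).deriv

/-- Only the modulus of z matters; 1/2 accounts for the factor 1/4 in `HasProfile`. -/
theorem hasProfile_scalar {n : ℕ} {u : ℝ → ℝ → ℂ} {d : ℝ → SolitonData n Unit} {z : ℂ}
    (hz : ‖z‖ = 1 / 2) (hsmooth : ContDiff ℝ ∞ (fun q : ℝ × ℝ => u q.1 q.2))
    (hu : ∀ t x, u t x = z * (d t).profile () x) : HasProfile u d where
  smooth := hsmooth
  norm_sq t x := by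
    rw [hu, norm_mul, hz, SolitonData.profile_eq, RCLike.norm_conj, SolitonData.V]
    simp; ring
  norm_deriv_sq t x := by
    rw [deriv_eq_of_profile (hu t), norm_mul, hz, RCLike.norm_conj]
    simp; ring

theorem angularTwist_scalar {n : ℕ} {u : ℝ → ℝ → ℂ} {d : ℝ → SolitonData n Unit} {z : ℂ}
    (hz : ‖z‖ = 1 / 2) (hu : ∀ t x, u t x = z * (d t).profile () x) (t : ℝ) :
    angularTwist u t = 1 / 4 * ∑ i, ((d t).k i ^ 2).im := by
  have h : ∀ x, twistDensity u t x
      = -(1 / 4) * ∑ c, (conj ((d t).T c 0 x) * (d t).T' c x).im := by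
    intro x
    rw [twistDensity, deriv_eq_of_profile (hu t), hu, SolitonData.profile_eq]
    have e : Complex.I * (z * conj ((d t).T () 0 x)) * conj (z * conj ((d t).T' () x))
        = Complex.I * (((‖z‖ ^ 2 : ℝ) : ℂ) * (conj ((d t).T () 0 x) * (d t).T' () x)) := by
      push_cast
      rw [← Complex.mul_conj', map_mul, Complex.conj_conj]
      ring
    rw [e, Complex.I_mul_re, Complex.im_ofReal_mul, hz, Finset.univ_unique, Finset.sum_singleton]
    ring
  simp only [angularTwist, h]
  rw [integral_const_mul, SolitonData.integral_twist]
  ring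

/-- The two components are conjugate, so V = 2|v|²; this is why |z|² is 1/2 here instead of 1/4. -/
theorem hasProfile_pair {n : ℕ} {u : ℝ → ℝ → ℂ} {d : ℝ → SolitonData n Bool} {z : ℂ}
    (hz : ‖z‖ ^ 2 = 1 / 2) (hsmooth : ContDiff ℝ ∞ (fun q : ℝ × ℝ => u q.1 q.2))
    (hconj : ∀ t x, (d t).profile false x = conj ((d t).profile true x))
    (hu : ∀ t x, u t x = z * (d t).profile true x) : HasProfile u d where
  smooth := hsmooth
  norm_sq t x := by
    have h1 : ‖(d t).T true 0 x‖ = ‖(d t).profile true x‖ := by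
      rw [SolitonData.profile_eq, RCLike.norm_conj]
    have h2 : ‖(d t).T false 0 x‖ = ‖(d t).profile true x‖ := by
      rw [← RCLike.norm_conj, ← SolitonData.profile_eq, hconj, RCLike.norm_conj]
    rw [hu, norm_mul, mul_pow, hz, SolitonData.V, Fintype.sum_bool, h1, h2]
    ring
  norm_deriv_sq t x := by
    have h2 : (d t).T' false x = conj ((d t).T' true x) := by
      have e := (d t).hasDerivAt_profile false x
      rw [show (d t).profile false = fun y => conj ((d t).profile true y) from
        funext (hconj t)] at e
      have e' := e.unique ((d t).hasDerivAt_profile true x).star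
      simpa using congrArg conj e'
    rw [deriv_eq_of_profile (hu t), norm_mul, mul_pow, hz, RCLike.norm_conj, Fintype.sum_bool, h2,
      RCLike.norm_conj]
    ring

/-! ### Amplitudes -/

/-- The amplitude `a e^{iϕ} e^{-l y}` of a wave with pole `l`, position `y` and phase `ϕ`. -/
def amplitude (l a : ℂ) (y ϕ : ℝ) : ℂ := a * (expI ϕ * Complex.exp (-(l * y)))

theorem amplitude_ne_zero {l a : ℂ} (ha : a ≠ 0) (y ϕ : ℝ) : amplitude l a y ϕ ≠ 0 :=
  mul_ne_zero ha (mul_ne_zero (expI_ne_zero _) (Complex.exp_ne_zero _))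

/-- The term -Re l · y is how the position of a wave enters the first moment. -/
theorem log_norm_amplitude {l a : ℂ} (ha : a ≠ 0) (y ϕ : ℝ) :
    Real.log ‖amplitude l a y ϕ‖ = Real.log ‖a‖ - l.re * y := by
  rw [amplitude, norm_mul, norm_mul, norm_expI, Complex.norm_exp, one_mul,
    Real.log_mul (norm_ne_zero_iff.mpr ha) (Real.exp_ne_zero _), Real.log_exp]
  simp; ring

theorem amplitude_mul_exp (k κ : ℝ) (a : ℂ) (y ϕ x : ℝ) :
    amplitude ⟨k, κ⟩ a y ϕ * Complex.exp ((⟨k, κ⟩ : ℂ) * x)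
      = a * Complex.exp ((k * (x - y) : ℝ) : ℂ) * (expI ϕ * expI (κ * (x - y))) := by
  have e : Complex.exp (-((⟨k, κ⟩ : ℂ) * y)) * Complex.exp ((⟨k, κ⟩ : ℂ) * x)
      = Complex.exp ((k * (x - y) : ℝ) : ℂ) * expI (κ * (x - y)) := by
    rw [expI, ← Complex.exp_add, ← Complex.exp_add]
    congr 1
    apply Complex.ext <;> simp <;> ring
  rw [amplitude]
  linear_combination a * expI ϕ * e

/-! ### Hirota 1-solitons -/

section HirotaOne

variable {c ν : ℝ}

/-- Spectral data of the Hirota 1-soliton. -/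
def hirotaOneData (c ν : ℝ) (hk : 0 < invWidth c ν) (φ x₀ t : ℝ) : SolitonData 1 Unit where
  k _ := ⟨invWidth c ν, waveNumber c ν⟩
  P _ := amplitude ⟨invWidth c ν, waveNumber c ν⟩ 1 (c * t + x₀) (φ + ν * t)
  q _ _ := 1
  re_pos _ := hk
  inj := Function.injective_of_subsingleton _
  P_ne _ := amplitude_ne_zero one_ne_zero _ _
  q_ne _ := ⟨(), one_ne_zero⟩

/-- With X = e^{kξ} and w the phase factor, M is the number (X² + 1)/(2k), and the profile is
2kXw/(X² + 1) = kw/cosh(kξ). -/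
theorem hirotaOne_eq (hk : 0 < invWidth c ν) (φ x₀ t x : ℝ) :
    hirotaOne c ν φ x₀ t x = 1 / 2 * (hirotaOneData c ν hk φ x₀ t).profile () x := by
  set X : ℂ := Complex.exp ((invWidth c ν * (x - (c * t + x₀)) : ℝ) : ℂ) with hX
  set w : ℂ := expI (φ + ν * t) * expI (waveNumber c ν * (x - (c * t + x₀))) with hw
  have hX0 : X ≠ 0 := Complex.exp_ne_zero _
  have hw0 : w ≠ 0 := mul_ne_zero (expI_ne_zero _) (expI_ne_zero _)
  have hXc : conj X = X := by rw [hX, ← Complex.exp_conj, Complex.conj_ofReal]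
  have hwc : conj w = w⁻¹ := by rw [hw, map_mul, conj_expI, conj_expI, mul_inv]
  have hp : ∀ j, (hirotaOneData c ν hk φ x₀ t).p x j = X * w := by
    intro j
    simp only [SolitonData.p, hirotaOneData]
    rw [amplitude_mul_exp, one_mul]
  have hk0 : (invWidth c ν : ℂ) ≠ 0 := by exact_mod_cast hk.ne'
  have hkk : conj (⟨invWidth c ν, waveNumber c ν⟩ : ℂ) + ⟨invWidth c ν, waveNumber c ν⟩
      = 2 * invWidth c ν := by rw [add_comm, Complex.add_conj]; push_cast; ring
  have hX1 : X ^ 2 + 1 ≠ 0 := by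
    have h1 : X ^ 2 + 1
        = ((Real.exp (invWidth c ν * (x - (c * t + x₀))) ^ 2 + 1 : ℝ) : ℂ) := by
      rw [hX]; push_cast; rfl
    rw [h1]
    have : (0 : ℝ) < Real.exp (invWidth c ν * (x - (c * t + x₀))) ^ 2 + 1 := by positivity
    exact_mod_cast this.ne'
  have hprof : (hirotaOneData c ν hk φ x₀ t).profile () x
      = 2 * invWidth c ν * X * w / (X ^ 2 + 1) := by
    rw [SolitonData.profile, invForm_eq_det]
    simp only [Matrix.det_fin_one, Finset.univ_unique, Fin.default_eq_zero, Finset.sum_singleton,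
      Matrix.updateRow_self, hp, SolitonData.M, lyapunovMatrix, Matrix.of_apply]
    simp only [hirotaOneData, map_mul, hXc, hwc, hkk, map_one]
    field_simp
  have henv : hirotaEnvelope (invWidth c ν) (x - c * t - x₀)
      = invWidth c ν * X / (X ^ 2 + 1) := by
    have e : x - c * t - x₀ = x - (c * t + x₀) := by ring
    rw [hirotaEnvelope, e]
    push_cast [Complex.cosh]
    rw [Complex.exp_neg]
    have : Complex.exp (↑(invWidth c ν) * (↑x - (↑c * ↑t + ↑x₀))) = X := by rw [hX]; push_cast; rfl
    rw [this]
    field_simp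
  have hw' : w = Complex.exp (Complex.I * φ) * Complex.exp (Complex.I * (ν * t : ℝ))
    * Complex.exp (Complex.I * (waveNumber c ν * (x - c * t - x₀) : ℝ)) := by
    rw [hw, expI_add]
    simp only [expI]
    congr 4
    ring
  rw [hprof, hirotaOne, henv, hw']
  ring

theorem contDiff_hirotaOne (φ x₀ : ℝ) :
    ContDiff ℝ ∞ (fun q : ℝ × ℝ => hirotaOne c ν φ x₀ q.1 q.2) := by
  unfold hirotaOne hirotaEnvelope
  have h : ∀ q : ℝ × ℝ, 2 * Real.cosh (invWidth c ν * (q.2 - c * q.1 - x₀)) ≠ 0 := fun q =>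
    (mul_pos two_pos (Real.cosh_pos _)).ne'
  have hof : ContDiff ℝ ∞ (fun y : ℝ => (y : ℂ)) := Complex.ofRealCLM.contDiff
  have hd : ContDiff ℝ ∞ fun q : ℝ × ℝ =>
      invWidth c ν / (2 * Real.cosh (invWidth c ν * (q.2 - c * q.1 - x₀))) :=
    contDiff_const.div (by fun_prop) h
  have h1 : ContDiff ℝ ∞ fun q : ℝ × ℝ => ν * q.1 := by fun_prop
  have h2 : ContDiff ℝ ∞ fun q : ℝ × ℝ => waveNumber c ν * (q.2 - c * q.1 - x₀) := by fun_prop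
  exact (contDiff_const.mul (contDiff_const.mul (hof.comp h1)).cexp).mul
    ((contDiff_const.mul (hof.comp h2)).cexp.mul (hof.comp hd))

theorem hirotaOne_hasProfile (hk : 0 < invWidth c ν) (φ x₀ : ℝ) :
    HasProfile (hirotaOne c ν φ x₀) (hirotaOneData c ν hk φ x₀) :=
  hasProfile_scalar (z := 1 / 2) (by norm_num) (contDiff_hirotaOne φ x₀) (hirotaOne_eq hk φ x₀)

/-- Both limits are the Cauchy matrix 1/(k̄_i + k_j), so for Hirota data the two determinants cancel
in the first moment. -/
theorem Mbot_eq_Mtop_of_ones {n : ℕ} {d : SolitonData n Unit} (hq : ∀ a j, d.q a j = 1) :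
    d.Mbot = d.Mtop := by
  ext i j
  simp [SolitonData.Mbot, SolitonData.Mtop, lyapunovMatrix, hq]

theorem hirotaOne_momentum (hk : 0 < invWidth c ν) (φ x₀ t : ℝ) :
    momentum (hirotaOne c ν φ x₀) t = 1 / 2 * invWidth c ν := by
  rw [(hirotaOne_hasProfile hk φ x₀).momentum_eq]
  simp [hirotaOneData]

theorem cube_re (k κ : ℝ) : ((⟨k, κ⟩ : ℂ) ^ 3).re = k * (k ^ 2 - 3 * κ ^ 2) := by
  simp [pow_succ]; ring

theorem sq_im (k κ : ℝ) : ((⟨k, κ⟩ : ℂ) ^ 2).im = 2 * κ * k := by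
  simp [pow_succ]; ring

theorem hirotaOne_energy (hk : 0 < invWidth c ν) (φ x₀ t : ℝ) :
    energy (hirotaOne c ν φ x₀) t
      = 1 / 2 * invWidth c ν * (invWidth c ν ^ 2 - 3 * waveNumber c ν ^ 2) := by
  rw [(hirotaOne_hasProfile hk φ x₀).energy_eq, mul_assoc, ← cube_re]
  simp [hirotaOneData]

theorem hirotaOne_angularTwist (hk : 0 < invWidth c ν) (φ x₀ t : ℝ) :
    angularTwist (hirotaOne c ν φ x₀) t = 1 / 2 * waveNumber c ν * invWidth c ν := by
  rw [angularTwist_scalar (z := 1 / 2) (by norm_num) (hirotaOne_eq hk φ x₀)]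
  simp only [hirotaOneData, Finset.univ_unique, Finset.sum_singleton, sq_im]
  ring

/-- The first moment is k(ct + x₀)/2, and by `speed_eq` t times the energy cancels the part
proportional to t. -/
theorem hirotaOne_galileanEnergy (h : 0 < disc c ν) (φ x₀ t : ℝ) :
    galileanEnergy (hirotaOne c ν φ x₀) t = -(1 / 2 * invWidth c ν * x₀) := by
  have hk := invWidth_pos h
  rw [(hirotaOne_hasProfile hk φ x₀).galileanEnergy_eq, (hirotaOne_hasProfile hk φ x₀).moment_eq,
    hirotaOne_energy hk, Mbot_eq_Mtop_of_ones fun _ _ => rfl, ← speed_eq h]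
  simp only [hirotaOneData, Finset.univ_unique, Finset.sum_singleton,
    log_norm_amplitude one_ne_zero, norm_one, Real.log_one]
  ring

end HirotaOne

namespace Params

/-! ### Superpositions of two waves -/

/-- The phase factor `e^{iφ₁} e^{iν₁t} e^{iκ₁ξ₁}` of the first wave. -/
def w₁ (p : Params) (t x : ℝ) : ℂ := expI (p.φ₁ + p.ν₁ * t) * expI (p.κ₁ * (x - p.c₁ * t))
/-- The phase factor of the second wave. -/
def w₂ (p : Params) (t x : ℝ) : ℂ := expI (p.φ₂ + p.ν₂ * t) * expI (p.κ₂ * (x - p.c₂ * t))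

/-- The real exponential `e^{k₁ξ₁}`. -/
def X₁ (p : Params) (t x : ℝ) : ℂ := Complex.exp ((p.k₁ * (x - p.c₁ * t) : ℝ) : ℂ)
/-- The real exponential `e^{k₂ξ₂}`. -/
def X₂ (p : Params) (t x : ℝ) : ℂ := Complex.exp ((p.k₂ * (x - p.c₂ * t) : ℝ) : ℂ)

variable (p : Params)

theorem w₁_ne (t x : ℝ) : p.w₁ t x ≠ 0 := mul_ne_zero (expI_ne_zero _) (expI_ne_zero _)
theorem w₂_ne (t x : ℝ) : p.w₂ t x ≠ 0 := mul_ne_zero (expI_ne_zero _) (expI_ne_zero _)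
theorem X₁_ne (t x : ℝ) : p.X₁ t x ≠ 0 := Complex.exp_ne_zero _
theorem X₂_ne (t x : ℝ) : p.X₂ t x ≠ 0 := Complex.exp_ne_zero _
theorem conj_w₁ (t x : ℝ) : conj (p.w₁ t x) = (p.w₁ t x)⁻¹ := by
  rw [w₁, map_mul, conj_expI, conj_expI, mul_inv]
theorem conj_w₂ (t x : ℝ) : conj (p.w₂ t x) = (p.w₂ t x)⁻¹ := by
  rw [w₂, map_mul, conj_expI, conj_expI, mul_inv]
theorem conj_X₁ (t x : ℝ) : conj (p.X₁ t x) = p.X₁ t x := by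
  rw [X₁, ← Complex.exp_conj, Complex.conj_ofReal]
theorem conj_X₂ (t x : ℝ) : conj (p.X₂ t x) = p.X₂ t x := by
  rw [X₂, ← Complex.exp_conj, Complex.conj_ofReal]

theorem superpose_eq (V₁ V₂ : ℝ → ℝ → ℂ) (W : ℝ → ℝ → ℝ) (t x : ℝ) :
    p.superpose V₁ V₂ W t x
      = (p.w₁ t x * V₁ (x - p.c₁ * t) (x - p.c₂ * t) + p.w₂ t x * V₂ (x - p.c₁ * t) (x - p.c₂ * t))
        / W (x - p.c₁ * t) (x - p.c₂ * t) := by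
  rw [superpose, w₁, w₂, expI_add, expI_add]
  ring

/-- Since ξ₂ - ξ₁ = (c₁ - c₂)t, the term with μ equals (ν₁ - ν₂)t, and θ is exactly the difference
of the full phases. -/
theorem expI_θ (hc : p.c₁ ≠ p.c₂) (t x : ℝ) :
    expI (p.θ (x - p.c₁ * t) (x - p.c₂ * t)) = p.w₁ t x / p.w₂ t x := by
  have hμ : p.μ * (p.c₁ - p.c₂) = p.ν₁ - p.ν₂ := div_mul_cancel₀ _ (sub_ne_zero.mpr hc)
  rw [w₁, w₂, ← expI_add, ← expI_add, ← expI_sub, θ]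
  congr 1
  linear_combination t * hμ

theorem contDiff_expI : ContDiff ℝ ∞ expI :=
  (contDiff_const.mul Complex.ofRealCLM.contDiff).cexp

theorem contDiff_coshI (b : ℝ) : ContDiff ℝ ∞ fun a => coshI a b := by
  have e : (fun a => coshI a b)
      = fun a : ℝ => (Complex.exp a * expI b + Complex.exp (-a) * (expI b)⁻¹) / 2 := by
    ext a
    rw [coshI_eq, Complex.exp_neg]
  have hof : ContDiff ℝ ∞ (fun y : ℝ => (y : ℂ)) := Complex.ofRealCLM.contDiff
  rw [e]
  exact ((hof.cexp.mul contDiff_const).add (hof.neg.cexp.mul contDiff_const)).div_const 2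

theorem contDiff_superpose {V₁ V₂ : ℝ → ℝ → ℂ} {W : ℝ → ℝ → ℝ}
    (h₁ : ContDiff ℝ ∞ fun q : ℝ × ℝ => V₁ q.1 q.2) (h₂ : ContDiff ℝ ∞ fun q : ℝ × ℝ => V₂ q.1 q.2)
    (hW : ContDiff ℝ ∞ fun q : ℝ × ℝ => W q.1 q.2)
    (h0 : ∀ t x, W (x - p.c₁ * t) (x - p.c₂ * t) ≠ 0) :
    ContDiff ℝ ∞ fun q : ℝ × ℝ => p.superpose V₁ V₂ W q.1 q.2 := by
  have hξ : ContDiff ℝ ∞ fun q : ℝ × ℝ => (q.2 - p.c₁ * q.1, q.2 - p.c₂ * q.1) := by fun_prop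
  have hw₁ : ContDiff ℝ ∞ fun q : ℝ × ℝ => p.w₁ q.1 q.2 :=
    (contDiff_expI.comp (g := expI) (f := fun q : ℝ × ℝ => p.φ₁ + p.ν₁ * q.1) (by fun_prop)).mul
      (contDiff_expI.comp (g := expI) (f := fun q : ℝ × ℝ => p.κ₁ * (q.2 - p.c₁ * q.1))
        (by fun_prop))
  have hw₂ : ContDiff ℝ ∞ fun q : ℝ × ℝ => p.w₂ q.1 q.2 :=
    (contDiff_expI.comp (g := expI) (f := fun q : ℝ × ℝ => p.φ₂ + p.ν₂ * q.1) (by fun_prop)).mul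
      (contDiff_expI.comp (g := expI) (f := fun q : ℝ × ℝ => p.κ₂ * (q.2 - p.c₂ * q.1))
        (by fun_prop))
  simp only [superpose_eq]
  simp only [div_eq_mul_inv]
  refine ((hw₁.mul (h₁.comp hξ)).add (hw₂.mul (h₂.comp hξ))).mul
    (ContDiff.inv (Complex.ofRealCLM.contDiff.comp (hW.comp hξ)) fun q => ?_)
  exact Complex.ofReal_ne_zero.mpr (h0 q.1 q.2)

theorem ofReal_cosh_eq (a : ℝ) :
    ((Real.cosh a : ℝ) : ℂ) = (Complex.exp a + (Complex.exp a)⁻¹) / 2 := by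
  rw [Complex.ofReal_cosh, Complex.cosh, Complex.exp_neg]

theorem ofReal_cos_eq (a : ℝ) : ((Real.cos a : ℝ) : ℂ) = (expI a + (expI a)⁻¹) / 2 := by
  rw [Complex.ofReal_cos, Complex.cos, ← expI_neg, expI, expI]
  push_cast
  ring_nf

theorem exp_ofReal_add (a b : ℝ) :
    Complex.exp ((a + b : ℝ) : ℂ) = Complex.exp a * Complex.exp b := by
  rw [← Complex.exp_add]; push_cast; rfl

theorem exp_ofReal_sub (a b : ℝ) :
    Complex.exp ((a - b : ℝ) : ℂ) = Complex.exp a / Complex.exp b := by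
  rw [← Complex.exp_sub]; push_cast; rfl

/-! ### Hirota 2-solitons -/

variable {p}

theorem conj_l₁_add_l₁_ne (h : p.Regular) : conj p.l₁ + p.l₁ ≠ 0 := by
  rw [add_comm, ← two_k₁]
  have : (p.k₁ : ℂ) ≠ 0 := by exact_mod_cast h.k₁_pos.ne'
  exact mul_ne_zero two_ne_zero this

theorem conj_l₂_add_l₂_ne (h : p.Regular) : conj p.l₂ + p.l₂ ≠ 0 := by
  rw [add_comm, ← two_k₂]
  have : (p.k₂ : ℂ) ≠ 0 := by exact_mod_cast h.k₂_pos.ne'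
  exact mul_ne_zero two_ne_zero this

theorem conj_l₁_add_l₂_ne (h : p.Regular) : conj p.l₁ + p.l₂ ≠ 0 := by
  have := (map_ne_zero (starRingEnd ℂ)).mpr h.add_conj_ne
  simpa using this

theorem conj_l₂_add_l₁_ne (h : p.Regular) : conj p.l₂ + p.l₁ ≠ 0 := by
  rw [add_comm]; exact h.add_conj_ne

theorem sub_ne (h : p.Regular) : p.l₁ - p.l₂ ≠ 0 := sub_ne_zero.mpr h.ne

theorem conj_sub_ne (h : p.Regular) : conj p.l₁ - conj p.l₂ ≠ 0 := by
  rw [← map_sub]; exact (map_ne_zero _).mpr (sub_ne h)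

theorem sqrt_Γ_ne (h : p.Regular) : (√p.Γ : ℂ) ≠ 0 := by
  rw [sqrt_Γ]
  exact_mod_cast div_ne_zero (norm_ne_zero_iff.mpr (sub_ne h)) (norm_ne_zero_iff.mpr h.add_conj_ne)

theorem Γ_eq_complex :
    (p.Γ : ℂ) = (p.l₁ - p.l₂) * (conj p.l₁ - conj p.l₂)
      / ((conj p.l₂ + p.l₁) * (conj p.l₁ + p.l₂)) := by
  rw [Γ_eq]
  push_cast
  rw [div_pow, norm_sq_eq, norm_sq_eq]
  simp only [map_add, map_sub, Complex.conj_conj]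
  rw [add_comm p.l₁]

theorem sqrt_Γ_mul_self : (√p.Γ : ℂ) * √p.Γ = p.Γ := by
  rw [sqrt_Γ, Γ_eq]; push_cast; ring

/-- In this product the moduli combine into a rational function of the poles. The same holds for the
companions below, which allows the determinant identities to be checked by polynomial arithmetic. -/
theorem sqrt_Γ_mul_expI_γ₁ (h : p.Regular) :
    (√p.Γ : ℂ) * expI p.γ₁ = (p.l₁ - p.l₂) / (conj p.l₁ + p.l₂) := by
  have hm : (‖p.l₁ - p.l₂‖ : ℂ) ≠ 0 := by exact_mod_cast norm_ne_zero_iff.mpr (sub_ne h)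
  have hp : (‖p.l₁ + conj p.l₂‖ : ℂ) ≠ 0 := by exact_mod_cast norm_ne_zero_iff.mpr h.add_conj_ne
  have hn := norm_sq_eq (p.l₁ + conj p.l₂)
  simp only [map_add, Complex.conj_conj] at hn
  have h1 := conj_l₁_add_l₂_ne h
  rw [expI_γ₁ h, sqrt_Υ, sqrt_Γ]
  push_cast
  field_simp
  rw [hn]
  ring

theorem sqrt_Γ_mul_expI_γ₂ (h : p.Regular) :
    (√p.Γ : ℂ) * expI p.γ₂ = -(p.l₁ - p.l₂) / (conj p.l₂ + p.l₁) := by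
  have hm : (‖p.l₁ - p.l₂‖ : ℂ) ≠ 0 := by exact_mod_cast norm_ne_zero_iff.mpr (sub_ne h)
  have hp : (‖p.l₁ + conj p.l₂‖ : ℂ) ≠ 0 := by exact_mod_cast norm_ne_zero_iff.mpr h.add_conj_ne
  have hn := norm_sq_eq (p.l₁ + conj p.l₂)
  simp only [map_add, Complex.conj_conj] at hn
  have h1 := conj_l₂_add_l₁_ne h
  rw [expI_γ₂ h, sqrt_Υ, sqrt_Γ]
  push_cast
  field_simp
  rw [hn]
  ring

theorem sqrt_Γ_div_expI_γ₁ (h : p.Regular) :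
    (√p.Γ : ℂ) * (expI p.γ₁)⁻¹ = (conj p.l₁ - conj p.l₂) / (conj p.l₂ + p.l₁) := by
  have := congrArg conj (sqrt_Γ_mul_expI_γ₁ h)
  simp only [map_mul, map_div₀, map_add, map_sub, conj_expI, Complex.conj_ofReal,
    Complex.conj_conj] at this
  rw [this, add_comm p.l₁]

theorem sqrt_Γ_div_expI_γ₂ (h : p.Regular) :
    (√p.Γ : ℂ) * (expI p.γ₂)⁻¹ = -(conj p.l₁ - conj p.l₂) / (conj p.l₁ + p.l₂) := by
  have := congrArg conj (sqrt_Γ_mul_expI_γ₂ h)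
  simp only [map_mul, map_div₀, map_add, map_sub, map_neg, conj_expI, Complex.conj_ofReal,
    Complex.conj_conj] at this
  rw [this, add_comm p.l₂]

theorem sqrt_Γ_div_sqrt_Υ (h : p.Regular) :
    (√p.Γ : ℂ) / (√p.Υ : ℝ) = 1 / ((conj p.l₂ + p.l₁) * (conj p.l₁ + p.l₂)) := by
  have hm : (‖p.l₁ - p.l₂‖ : ℂ) ≠ 0 := by exact_mod_cast norm_ne_zero_iff.mpr (sub_ne h)
  have hp : (‖p.l₁ + conj p.l₂‖ : ℂ) ≠ 0 := by exact_mod_cast norm_ne_zero_iff.mpr h.add_conj_ne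
  have hn := norm_sq_eq (p.l₁ + conj p.l₂)
  simp only [map_add, Complex.conj_conj] at hn
  rw [add_comm (conj p.l₂), ← hn, sqrt_Υ, sqrt_Γ]
  push_cast
  field_simp

theorem l_injective (h : p.Regular) : Function.Injective ![p.l₁, p.l₂] := by
  intro i j hij
  fin_cases i <;> fin_cases j <;> simp_all [h.ne, h.ne.symm]

/-- Spectral data of the Hirota 2-soliton. -/
def hirotaData (h : p.Regular) (t : ℝ) : SolitonData 2 Unit where
  k := ![p.l₁, p.l₂]
  P := ![amplitude p.l₁ 1 (p.c₁ * t) (p.φ₁ + p.ν₁ * t),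
    amplitude p.l₂ 1 (p.c₂ * t) (p.φ₂ + p.ν₂ * t)]
  q _ _ := 1
  re_pos j := by fin_cases j; exacts [h.k₁_pos, h.k₂_pos]
  inj := l_injective h
  P_ne j := by
    fin_cases j
    exacts [amplitude_ne_zero one_ne_zero _ _, amplitude_ne_zero one_ne_zero _ _]
  q_ne _ := ⟨(), one_ne_zero⟩

theorem hirotaData_p (h : p.Regular) (t x : ℝ) :
    (hirotaData h t).p x = ![p.X₁ t x * p.w₁ t x, p.X₂ t x * p.w₂ t x] := by
  ext j
  fin_cases j
  · refine (amplitude_mul_exp p.k₁ p.κ₁ 1 (p.c₁ * t) (p.φ₁ + p.ν₁ * t) x).trans ?_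
    rw [one_mul]; rfl
  · refine (amplitude_mul_exp p.k₂ p.κ₂ 1 (p.c₂ * t) (p.φ₂ + p.ν₂ * t) x).trans ?_
    rw [one_mul]; rfl

theorem hirotaData_M (h : p.Regular) (t x : ℝ) :
    (hirotaData h t).M x =
      !![(p.X₁ t x ^ 2 + 1) / (conj p.l₁ + p.l₁),
        (p.X₁ t x * p.X₂ t x * (p.w₂ t x / p.w₁ t x) + 1) / (conj p.l₁ + p.l₂);
        (p.X₁ t x * p.X₂ t x * (p.w₁ t x / p.w₂ t x) + 1) / (conj p.l₂ + p.l₁),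
        (p.X₂ t x ^ 2 + 1) / (conj p.l₂ + p.l₂)] := by
  have h1 := p.w₁_ne t x
  have h2 := p.w₂_ne t x
  ext i j
  rw [SolitonData.M, hirotaData_p]
  fin_cases i <;> fin_cases j <;>
    simp [lyapunovMatrix, hirotaData, conj_w₁, conj_w₂, conj_X₁, conj_X₂] <;> field_simp

theorem WH_eq (hc : p.c₁ ≠ p.c₂) (t x : ℝ) :
    (p.WH (x - p.c₁ * t) (x - p.c₂ * t) : ℂ)
      = √p.Γ * (p.X₁ t x * p.X₂ t x + (p.X₁ t x * p.X₂ t x)⁻¹) / 2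
        + (p.X₁ t x / p.X₂ t x + (p.X₁ t x / p.X₂ t x)⁻¹) / (2 * √p.Γ)
        - 2 * p.k₁ * p.k₂ / (√p.Υ : ℝ)
          * (p.w₁ t x / p.w₂ t x + (p.w₁ t x / p.w₂ t x)⁻¹) := by
  rw [WH, ← expI_θ p hc, Complex.ofReal_sub, Complex.ofReal_add, Complex.ofReal_mul,
    Complex.ofReal_mul, Complex.ofReal_mul, ofReal_cosh_eq, ofReal_cosh_eq, ofReal_cos_eq,
    exp_ofReal_add, exp_ofReal_sub, ← X₁, ← X₂]
  push_cast
  ring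

/-- The denominator is the tau function det M, rescaled by the factor that symmetrizes it in X₁ and
X₂. -/
theorem hirota_det (h : p.Regular) (hc : p.c₁ ≠ p.c₂) (t x : ℝ) :
    (p.WH (x - p.c₁ * t) (x - p.c₂ * t) : ℂ)
      = 2 * p.k₁ * p.k₂ / (√p.Γ * (p.X₁ t x * p.X₂ t x)) * ((hirotaData h t).M x).det := by
  have hX1 := p.X₁_ne t x
  have hX2 := p.X₂_ne t x
  have hw1 := p.w₁_ne t x
  have hw2 := p.w₂_ne t x
  have hG := sqrt_Γ_ne h
  have h11 := conj_l₁_add_l₁_ne h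
  have h22 := conj_l₂_add_l₂_ne h
  have h12 := conj_l₁_add_l₂_ne h
  have h21 := conj_l₂_add_l₁_ne h
  have hΥ := sqrt_Γ_div_sqrt_Υ h
  have hk : (2 * p.k₁ * p.k₂ : ℂ) = (conj p.l₁ + p.l₁) * (conj p.l₂ + p.l₂) / 2 := by
    linear_combination (p.k₂ : ℂ) * two_k₁ (p := p) + (p.l₁ + conj p.l₁) / 2 * two_k₂ (p := p)
  -- After multiplication by √Γ X₁X₂ the radicals occur only in √Γ/√Υ, which is rational in the
  -- poles.
  have hW : (√p.Γ : ℂ) * (p.X₁ t x * p.X₂ t x) * p.WH (x - p.c₁ * t) (x - p.c₂ * t)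
      = p.Γ * ((p.X₁ t x * p.X₂ t x) ^ 2 + 1) / 2 + (p.X₁ t x ^ 2 + p.X₂ t x ^ 2) / 2
        - 2 * p.k₁ * p.k₂ * (√p.Γ / (√p.Υ : ℝ)) * (p.X₁ t x * p.X₂ t x)
          * (p.w₁ t x / p.w₂ t x + (p.w₁ t x / p.w₂ t x)⁻¹) := by
    rw [WH_eq hc, ← sqrt_Γ_mul_self]
    field_simp
  have hD : (√p.Γ : ℂ) * (p.X₁ t x * p.X₂ t x) ≠ 0 := mul_ne_zero hG (mul_ne_zero hX1 hX2)
  rw [div_mul_eq_mul_div, eq_div_iff hD, mul_comm, hW, hΥ, hk, Γ_eq_complex, hirotaData_M,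
    Matrix.det_fin_two_of]
  field_simp
  ring

/-- The common factor agrees with that of `hirota_det`, so it cancels in V/W. The sign of -1/2 is
immaterial later, since only its modulus enters. -/
theorem hirota_num (h : p.Regular) (t x : ℝ) :
    p.w₁ t x * p.VH₁ (x - p.c₁ * t) (x - p.c₂ * t) + p.w₂ t x * p.VH₂ (x - p.c₁ * t) (x - p.c₂ * t)
      = -(1 / 2) * (2 * p.k₁ * p.k₂ / (√p.Γ * (p.X₁ t x * p.X₂ t x))
        * ∑ j, conj ((hirotaData h t).q () j)
          * (((hirotaData h t).M x).updateRow j ((hirotaData h t).p x)).det) := by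
  have hX1 := p.X₁_ne t x
  have hX2 := p.X₂_ne t x
  have hw1 := p.w₁_ne t x
  have hw2 := p.w₂_ne t x
  have hG := sqrt_Γ_ne h
  have h11 := conj_l₁_add_l₁_ne h
  have h22 := conj_l₂_add_l₂_ne h
  have h12 := conj_l₁_add_l₂_ne h
  have h21 := conj_l₂_add_l₁_ne h
  have hk1 : (p.k₁ : ℂ) = (conj p.l₁ + p.l₁) / 2 := by linear_combination two_k₁ (p := p) / 2
  have hk2 : (p.k₂ : ℂ) = (conj p.l₂ + p.l₂) / 2 := by linear_combination two_k₂ (p := p) / 2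
  have hV : (√p.Γ : ℂ) * (p.X₁ t x * p.X₂ t x) * (p.w₁ t x * p.VH₁ (x - p.c₁ * t) (x - p.c₂ * t)
      + p.w₂ t x * p.VH₂ (x - p.c₁ * t) (x - p.c₂ * t))
      = p.X₁ t x * p.w₁ t x * p.k₁ * (p.X₂ t x ^ 2 * (√p.Γ * expI p.γ₂)
          + √p.Γ * (expI p.γ₂)⁻¹) / 2
        + p.X₂ t x * p.w₂ t x * p.k₂ * (p.X₁ t x ^ 2 * (√p.Γ * expI p.γ₁)
          + √p.Γ * (expI p.γ₁)⁻¹) / 2 := by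
    rw [VH₁, VH₂, coshI_eq, coshI_eq, ← X₁, ← X₂]
    field_simp
  have hD : (√p.Γ : ℂ) * (p.X₁ t x * p.X₂ t x) ≠ 0 := mul_ne_zero hG (mul_ne_zero hX1 hX2)
  refine mul_left_cancel₀ hD ?_
  rw [hV, sqrt_Γ_mul_expI_γ₁ h, sqrt_Γ_mul_expI_γ₂ h, sqrt_Γ_div_expI_γ₁ h, sqrt_Γ_div_expI_γ₂ h,
    hirotaData_M, hirotaData_p, Fin.sum_univ_two, Matrix.det_fin_two, Matrix.det_fin_two, hk1, hk2]
  simp only [hirotaData, map_one, one_mul, Matrix.updateRow_apply, Matrix.of_apply,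
    Matrix.cons_val', Matrix.cons_val_zero, Matrix.cons_val_one, Matrix.cons_val_fin_one,
    Fin.isValue, zero_ne_one, one_ne_zero, if_true, if_false]
  field_simp
  ring

/-- The explicit formula contains a difference; its nonvanishing comes from the invertibility of the
Lyapunov matrix. -/
theorem WH_ne (h : p.Regular) (hc : p.c₁ ≠ p.c₂) (t x : ℝ) :
    p.WH (x - p.c₁ * t) (x - p.c₂ * t) ≠ 0 := by
  have h1 : (p.k₁ : ℂ) ≠ 0 := by exact_mod_cast h.k₁_pos.ne'
  have h2 : (p.k₂ : ℂ) ≠ 0 := by exact_mod_cast h.k₂_pos.ne'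
  rw [← Complex.ofReal_ne_zero, hirota_det h hc]
  refine mul_ne_zero (div_ne_zero (mul_ne_zero (mul_ne_zero two_ne_zero h1) h2)
    (mul_ne_zero (sqrt_Γ_ne h) (mul_ne_zero (p.X₁_ne t x) (p.X₂_ne t x)))) ?_
  exact (hirotaData h t).det_ne x

theorem hirota_eq (h : p.Regular) (hc : p.c₁ ≠ p.c₂) (t x : ℝ) :
    p.hirota t x = -(1 / 2) * (hirotaData h t).profile () x := by
  have hW := Complex.ofReal_ne_zero.mpr (WH_ne h hc t x)
  have hdet := (hirotaData h t).det_ne x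
  rw [hirota, superpose_eq, hirota_num h, SolitonData.profile, invForm_eq_det,
    div_eq_iff hW, hirota_det h hc]
  field_simp

theorem hirota_hasProfile (h : p.Regular) (hc : p.c₁ ≠ p.c₂) :
    HasProfile p.hirota (hirotaData h) := by
  refine hasProfile_scalar (z := -(1 / 2)) (by norm_num) ?_ (hirota_eq h hc)
  refine p.contDiff_superpose ?_ ?_ ?_ (WH_ne h hc)
  · exact contDiff_const.mul ((contDiff_coshI p.γ₂).comp
      (f := fun q : ℝ × ℝ => p.k₂ * q.2) (by fun_prop))
  · exact contDiff_const.mul ((contDiff_coshI p.γ₁).comp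
      (f := fun q : ℝ × ℝ => p.k₁ * q.1) (by fun_prop))
  · unfold WH θ
    fun_prop

theorem hirota_momentum (h : p.Regular) (hc : p.c₁ ≠ p.c₂) (t : ℝ) :
    momentum p.hirota t = 1 / 2 * p.k₁ + 1 / 2 * p.k₂ := by
  rw [(hirota_hasProfile h hc).momentum_eq, Fin.sum_univ_two]
  simp [hirotaData, l₁, l₂]; ring

theorem hirota_energy (h : p.Regular) (hc : p.c₁ ≠ p.c₂) (t : ℝ) :
    energy p.hirota t = 1 / 2 * p.k₁ * (p.k₁ ^ 2 - 3 * p.κ₁ ^ 2)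
      + 1 / 2 * p.k₂ * (p.k₂ ^ 2 - 3 * p.κ₂ ^ 2) := by
  rw [(hirota_hasProfile h hc).energy_eq, Fin.sum_univ_two]
  simp only [hirotaData, l₁, l₂, Matrix.cons_val_zero, Matrix.cons_val_one, cube_re]
  ring

theorem hirota_angularTwist (h : p.Regular) (hc : p.c₁ ≠ p.c₂) (t : ℝ) :
    angularTwist p.hirota t = 1 / 2 * p.κ₁ * p.k₁ + 1 / 2 * p.κ₂ * p.k₂ := by
  rw [angularTwist_scalar (z := -(1 / 2)) (by norm_num) (hirota_eq h hc), Fin.sum_univ_two]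
  simp only [hirotaData, l₁, l₂, Matrix.cons_val_zero, Matrix.cons_val_one, sq_im]
  ring

theorem hirota_moment (h : p.Regular) (hc : p.c₁ ≠ p.c₂) (t : ℝ) :
    ∫ x, momentDensity p.hirota t x = (1 / 2 * p.k₁ * p.c₁ + 1 / 2 * p.k₂ * p.c₂) * t := by
  rw [(hirota_hasProfile h hc).moment_eq, Mbot_eq_Mtop_of_ones fun _ _ => rfl, Fin.sum_univ_two]
  simp only [hirotaData, l₁, l₂, Matrix.cons_val_zero, Matrix.cons_val_one,
    log_norm_amplitude one_ne_zero, norm_one, Real.log_one]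
  ring

end Params

open Params

/-! ### Conjugation symmetry of two-component profiles -/

/-- A permutation exchanging each pole with its conjugate, together with the two components, turns M
into its transpose. Reindexing the sum for one component then gives the conjugate of the other. -/
theorem SolitonData.profile_false_eq {n : ℕ} (d : SolitonData n Bool) (σ : Equiv.Perm (Fin n))
    (hk : ∀ j, d.k (σ j) = conj (d.k j)) (hP : ∀ j, d.P (σ j) = conj (d.P j))
    (hq : ∀ c j, d.q (!c) (σ j) = conj (d.q c j)) (x : ℝ) :
    d.profile false x = conj (d.profile true x) := by
  have hp : ∀ j, d.p x (σ j) = conj (d.p x j) := by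
    intro j
    simp only [SolitonData.p, hP, hk, map_mul, ← Complex.exp_conj, Complex.conj_ofReal]
  have hq1 : ∀ j, d.q false (σ j) = conj (d.q true j) := hq true
  have hq2 : ∀ j, d.q true (σ j) = conj (d.q false j) := hq false
  have hM : (d.M x).submatrix σ σ = (d.M x).transpose := by
    ext i j
    simp only [SolitonData.M, lyapunovMatrix, Matrix.submatrix_apply, Matrix.transpose_apply,
      Matrix.of_apply, Fintype.sum_bool, hp, hk, hq1, hq2, Complex.conj_conj]
    congr 1 <;> ring
  have hinv : ∀ i j, (d.M x)⁻¹ (σ i) (σ j) = (d.M x)⁻¹ j i := by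
    intro i j
    have := congrArg (fun A : Matrix (Fin n) (Fin n) ℂ => A⁻¹ i j) hM
    simpa only [Matrix.inv_submatrix_equiv, ← Matrix.transpose_nonsing_inv,
      Matrix.submatrix_apply, Matrix.transpose_apply] using this
  rw [SolitonData.profile, SolitonData.profile, SolitonData.M, invForm_conj, ← SolitonData.M]
  simp only [invForm]
  rw [Finset.sum_comm, ← Equiv.sum_comp σ]
  refine Finset.sum_congr rfl fun i _ => ?_
  rw [← Equiv.sum_comp σ]
  refine Finset.sum_congr rfl fun j _ => ?_
  rw [hp, hinv, hq1, Complex.conj_conj]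
  ring

theorem SolitonData.Mtop_det_re_ne {n : ℕ} {α : Type*} [Fintype α] (d : SolitonData n α) :
    d.Mtop.det.re ≠ 0 := by
  intro h
  have him : d.Mtop.det.im = 0 := Complex.conj_eq_iff_im.mp lyapunovMatrix_det_conj
  exact d.Mtop_det_ne (Complex.ext h him)

/-! ### Sasa-Satsuma 1-solitons -/

/-- The complex amplitude of the Sasa-Satsuma 1-soliton, a square root of `-i l / κ`
for `l = k + i κ`. -/
def sasaFactor (k κ : ℝ) : ℂ :=
  (√(‖(⟨k, κ⟩ : ℂ)‖ / |κ|) : ℝ) * expI (-(Complex.arg (κ * (κ + Complex.I * k)) / 2))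

theorem norm_mk_pos {k κ : ℝ} (hκ : κ ≠ 0) : 0 < ‖(⟨k, κ⟩ : ℂ)‖ :=
  norm_pos_iff.mpr fun e => hκ (congrArg Complex.im e)

theorem sub_conj_mk (k κ : ℝ) : (⟨k, κ⟩ : ℂ) - conj (⟨k, κ⟩ : ℂ) = 2 * κ * Complex.I := by
  rw [Complex.sub_conj]; push_cast; rfl

theorem add_conj_mk (k κ : ℝ) : (⟨k, κ⟩ : ℂ) + conj (⟨k, κ⟩ : ℂ) = 2 * k := by
  rw [Complex.add_conj]; push_cast; rfl

theorem ofReal_sqrt_sq {a : ℝ} (ha : 0 ≤ a) : ((√a : ℝ) : ℂ) ^ 2 = a := by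
  exact_mod_cast Real.sq_sqrt ha

/-- The value a² = 2l/(l - l̄) balances the extreme powers of e^{kξ} in numerator and denominator,
so that the soliton is centred at the prescribed position. -/
theorem sasaFactor_sq {k κ : ℝ} (hκ : κ ≠ 0) :
    sasaFactor k κ ^ 2 * ((⟨k, κ⟩ : ℂ) - conj (⟨k, κ⟩ : ℂ)) = 2 * ⟨k, κ⟩ := by
  have hl := norm_mk_pos (k := k) hκ
  have hl0 : (‖(⟨k, κ⟩ : ℂ)‖ : ℂ) ≠ 0 := by exact_mod_cast hl.ne'
  have hc : conj (⟨k, κ⟩ : ℂ) ≠ 0 := (map_ne_zero _).mpr (norm_pos_iff.mp hl)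
  have ha : ((|κ| : ℝ) : ℂ) ≠ 0 := by exact_mod_cast abs_ne_zero.mpr hκ
  have hs : ((Real.sign κ : ℝ) : ℂ) ≠ 0 := by
    exact_mod_cast fun e => hκ (Real.sign_eq_zero_iff.mp e)
  have hsa : ((Real.sign κ : ℝ) : ℂ) * (|κ| : ℝ) = κ := by
    rcases lt_or_gt_of_ne hκ with h | h
    · rw [Real.sign_of_neg h, abs_of_neg h]; push_cast; ring
    · rw [Real.sign_of_pos h, abs_of_pos h]; push_cast; ring
  rw [sasaFactor, mul_pow, ofReal_sqrt_sq (by positivity), expI_neg, inv_pow, expI_half_sq,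
    expI_lam hκ, sub_conj_mk, ← hsa]
  push_cast
  field_simp
  rw [norm_sq_eq]
  ring

theorem sasaFactor_ne {k κ : ℝ} (hκ : κ ≠ 0) : sasaFactor k κ ≠ 0 := by
  refine mul_ne_zero (Complex.ofReal_ne_zero.mpr (Real.sqrt_ne_zero'.mpr ?_)) (expI_ne_zero _)
  have := norm_mk_pos (k := k) hκ
  positivity

theorem sasaFactor_mul_conj {k κ : ℝ} :
    sasaFactor k κ * conj (sasaFactor k κ) = (‖(⟨k, κ⟩ : ℂ)‖ / |κ| : ℝ) := by
  have h := ofReal_sqrt_sq (a := ‖(⟨k, κ⟩ : ℂ)‖ / |κ|) (by positivity)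
  have he := expI_ne_zero (-(Complex.arg (κ * (κ + Complex.I * k)) / 2))
  rw [sasaFactor, map_mul, conj_expI, Complex.conj_ofReal, ← h]
  field_simp

theorem norm_sasaFactor_sq {k κ : ℝ} : ‖sasaFactor k κ‖ ^ 2 = ‖(⟨k, κ⟩ : ℂ)‖ / |κ| := by
  have h := sasaFactor_mul_conj (k := k) (κ := κ)
  rw [← norm_sq_eq] at h
  exact_mod_cast h

section SasaSatsumaOne

variable {c ν : ℝ}

/-- Spectral data of the Sasa-Satsuma 1-soliton. -/
def sasaSatsumaOneData (c ν : ℝ) (hk : 0 < invWidth c ν) (hκ : waveNumber c ν ≠ 0) (φ x₀ t : ℝ) :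
    SolitonData 2 Bool where
  k := ![⟨invWidth c ν, waveNumber c ν⟩, conj ⟨invWidth c ν, waveNumber c ν⟩]
  P := ![amplitude ⟨invWidth c ν, waveNumber c ν⟩ (sasaFactor (invWidth c ν) (waveNumber c ν))
      (c * t + x₀) (φ + ν * t),
    conj (amplitude ⟨invWidth c ν, waveNumber c ν⟩
      (sasaFactor (invWidth c ν) (waveNumber c ν)) (c * t + x₀) (φ + ν * t))]
  q b := if b then ![1, 0] else ![0, 1]
  re_pos j := by fin_cases j <;> exact hk
  inj := by
    have h : (⟨invWidth c ν, waveNumber c ν⟩ : ℂ) ≠ conj ⟨invWidth c ν, waveNumber c ν⟩ := by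
      rw [← sub_ne_zero, sub_conj_mk]
      simpa using hκ
    intro i j hij
    fin_cases i <;> fin_cases j
    exacts [rfl, absurd hij h, absurd hij h.symm, rfl]
  P_ne j := by
    have := amplitude_ne_zero (l := ⟨invWidth c ν, waveNumber c ν⟩)
      (sasaFactor_ne (k := invWidth c ν) hκ) (c * t + x₀) (φ + ν * t)
    fin_cases j
    exacts [this, (map_ne_zero _).mpr this]
  q_ne j := by
    fin_cases j
    exacts [⟨true, by simp⟩, ⟨false, by simp⟩]

theorem sasaSatsumaOneData_conj (hk : 0 < invWidth c ν) (hκ : waveNumber c ν ≠ 0) (φ x₀ t x : ℝ) :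
    (sasaSatsumaOneData c ν hk hκ φ x₀ t).profile false x
      = conj ((sasaSatsumaOneData c ν hk hκ φ x₀ t).profile true x) := by
  refine SolitonData.profile_false_eq _ (Equiv.swap 0 1) ?_ ?_ ?_ x
  · intro j; fin_cases j <;> simp [sasaSatsumaOneData]
  · intro j; fin_cases j <;> simp [sasaSatsumaOneData]
  · intro b j; cases b <;> fin_cases j <;> simp [sasaSatsumaOneData]

/-- The profile of data consisting of a pole, its conjugate and conjugate amplitudes. -/
theorem profile_of_conj_pair {d : SolitonData 2 Bool} {x : ℝ} {l Z : ℂ}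
    (hk : d.k = ![l, conj l]) (hp : d.p x = ![Z, conj Z])
    (hq : d.q = fun b => if b then ![1, 0] else ![0, 1]) :
    d.profile true x
      = (Z * ((Z * conj Z + 1) / (l + conj l)) - conj Z * (Z ^ 2 / (2 * l)))
        / (((Z * conj Z + 1) / (l + conj l)) ^ 2 - (Z * conj Z) ^ 2 / (4 * (l * conj l))) := by
  rw [SolitonData.profile, invForm_eq_det, Fin.sum_univ_two, Matrix.det_fin_two,
    Matrix.det_fin_two, Matrix.det_fin_two]
  simp only [hq, hp, SolitonData.M, lyapunovMatrix, hk, Fintype.sum_bool, Matrix.updateRow_apply,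
    Matrix.of_apply, Matrix.cons_val_zero, Matrix.cons_val_one, if_true, map_one, map_zero,
    Fin.isValue, zero_ne_one, one_ne_zero, if_false, Complex.conj_conj, Bool.false_eq_true]
  congr 1
  · ring
  · rw [add_comm (conj l) l, ← two_mul, ← two_mul]
    ring

theorem sasaSatsumaOne_eq (hk : 0 < invWidth c ν) (hκ : waveNumber c ν ≠ 0) (φ x₀ t x : ℝ) :
    sasaSatsumaOne c ν φ x₀ t x
      = (√2 / 2 : ℝ) * (sasaSatsumaOneData c ν hk hκ φ x₀ t).profile true x := by
  set k := invWidth c ν with hkdef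
  set κ := waveNumber c ν with hκdef
  set l : ℂ := ⟨k, κ⟩ with hl
  set a := sasaFactor k κ with ha
  set X : ℂ := Complex.exp ((k * (x - (c * t + x₀)) : ℝ) : ℂ) with hX
  set w : ℂ := expI (φ + ν * t) * expI (κ * (x - (c * t + x₀))) with hw
  have hX0 : X ≠ 0 := Complex.exp_ne_zero _
  have hw0 : w ≠ 0 := mul_ne_zero (expI_ne_zero _) (expI_ne_zero _)
  have hXc : conj X = X := by rw [hX, ← Complex.exp_conj, Complex.conj_ofReal]
  have hwc : conj w = w⁻¹ := by rw [hw, map_mul, conj_expI, conj_expI, mul_inv]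
  have hp : (sasaSatsumaOneData c ν hk hκ φ x₀ t).p x = ![a * X * w, conj (a * X * w)] := by
    have h0 := amplitude_mul_exp k κ a (c * t + x₀) (φ + ν * t) x
    ext j
    fin_cases j
    · exact h0
    · refine Eq.trans ?_ (congrArg conj h0)
      rw [map_mul, ← Complex.exp_conj, map_mul, Complex.conj_ofReal]
      rfl
  have hlc : l - conj l ≠ 0 := by
    rw [hl, sub_conj_mk]
    simpa using hκ
  have hl0 : l ≠ 0 := norm_pos_iff.mp (norm_mk_pos hκ)
  have hm0 : conj l ≠ 0 := (map_ne_zero _).mpr hl0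
  have hk2 : l + conj l = 2 * k := add_conj_mk k κ
  have hk0 : (k : ℂ) ≠ 0 := by exact_mod_cast hk.ne'
  have hlk : l + conj l ≠ 0 := by rw [hk2]; exact mul_ne_zero two_ne_zero hk0
  have ha2 : a ^ 2 * (l - conj l) = 2 * l := sasaFactor_sq hκ
  have hb2 : conj a ^ 2 * (conj l - l) = 2 * conj l := by
    have := congrArg conj ha2
    rw [map_mul, map_pow, map_sub, map_mul, Complex.conj_conj, map_ofNat] at this
    exact this
  have ha0 : a ≠ 0 := sasaFactor_ne hκ
  have hb0 : conj a ≠ 0 := (map_ne_zero _).mpr ha0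
  have hZc : conj (a * X * w) = conj a * X * w⁻¹ := by rw [map_mul, map_mul, hXc, hwc]
  -- The term cubic in Z carries the factor a²(l - l̄)/(2l), which the normalization makes equal to
  -- 1.
  have hN : a * X * w * ((a * X * w * (conj a * X * w⁻¹) + 1) / (l + conj l))
      - conj a * X * w⁻¹ * ((a * X * w) ^ 2 / (2 * l))
      = w * X * (X ^ 2 * conj a + a) / (l + conj l) := by
    field_simp
    linear_combination (conj a * X ^ 2) * ha2
  -- Likewise the coefficient of X⁴ reduces to 1, using the normalization of a and of ā, and the
  -- denominator becomes palindromic in X.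
  have hD : ((a * X * w * (conj a * X * w⁻¹) + 1) / (l + conj l)) ^ 2
      - (a * X * w * (conj a * X * w⁻¹)) ^ 2 / (4 * (l * conj l))
      = (X ^ 4 + 1 + 2 * (a * conj a) * X ^ 2) / (l + conj l) ^ 2 := by
    field_simp
    linear_combination (X ^ 4 * conj a ^ 2 * (conj l - l)) * ha2 + 2 * l * X ^ 4 * hb2
  have hab := sasaFactor_mul_conj (k := k) (κ := κ)
  rw [← ha, ← hl] at hab
  have hκ0 : ((|κ| : ℝ) : ℂ) ≠ 0 := by exact_mod_cast abs_ne_zero.mpr hκ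
  have hr : √(k ^ 2 + κ ^ 2) = ‖l‖ := (Complex.norm_eq_sqrt_sq_add_sq l).symm
  have hden : ((|κ| * Real.cosh (2 * k * (x - c * t - x₀)) + √(k ^ 2 + κ ^ 2) : ℝ) : ℂ)
      = (|κ| : ℝ) / (2 * X ^ 2) * (X ^ 4 + 1 + 2 * (a * conj a) * X ^ 2) := by
    have e : ((2 * k * (x - c * t - x₀) : ℝ) : ℂ)
        = ((k * (x - (c * t + x₀)) : ℝ) : ℂ) + ((k * (x - (c * t + x₀)) : ℝ) : ℂ) := by
      push_cast; ring
    rw [Complex.ofReal_add, Complex.ofReal_mul, ofReal_cosh_eq, e, Complex.exp_add, ← hX, hab, hr]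
    push_cast
    field_simp
  have hsqrt : √(2 * |κ|) * √‖l‖ = √2 * |κ| * √(‖l‖ / |κ|) := by
    have h1 : 0 ≤ |κ| := abs_nonneg κ
    rw [Real.sqrt_mul zero_le_two, Real.sqrt_div (norm_nonneg _), mul_assoc, mul_assoc]
    congr 1
    have h2 : √|κ| ≠ 0 := Real.sqrt_ne_zero'.mpr (abs_pos.mpr hκ)
    field_simp
    rw [Real.sq_sqrt h1]
  have hnum : ((k * √(2 * |κ|) * √√(k ^ 2 + κ ^ 2) : ℝ) : ℂ)
      * Complex.cosh ((k * (x - c * t - x₀) : ℝ)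
        + Complex.I * ((Complex.arg (κ * (κ + Complex.I * k)) / 2 : ℝ) : ℂ))
      = k * (√2 : ℝ) * (|κ| : ℝ) * (X ^ 2 * conj a + a) / (2 * X) := by
    have e : x - c * t - x₀ = x - (c * t + x₀) := by ring
    have hE := expI_ne_zero (Complex.arg (κ * (κ + Complex.I * k)) / 2)
    rw [hr, mul_assoc k, hsqrt, e]
    change _ * coshI _ _ = _
    rw [coshI_eq, ← hX, ha, sasaFactor, map_mul, conj_expI, Complex.conj_ofReal, expI_neg, inv_inv,
      ← hl]
    push_cast
    field_simp
  have hQ : X ^ 4 + 1 + 2 * (a * conj a) * X ^ 2 ≠ 0 := by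
    intro h0
    have : |κ| * Real.cosh (2 * k * (x - c * t - x₀)) + √(k ^ 2 + κ ^ 2) = 0 := by
      rw [h0, mul_zero] at hden
      exact_mod_cast hden
    have h1 : 0 < |κ| * Real.cosh (2 * k * (x - c * t - x₀)) :=
      mul_pos (abs_pos.mpr hκ) (Real.cosh_pos _)
    linarith [Real.sqrt_nonneg (k ^ 2 + κ ^ 2)]
  have hw' : w = Complex.exp (Complex.I * φ) * Complex.exp (Complex.I * (ν * t : ℝ))
    * Complex.exp (Complex.I * (κ * (x - c * t - x₀) : ℝ)) := by
    rw [hw, expI_add]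
    simp only [expI]
    congr 4
    ring
  rw [profile_of_conj_pair (l := l) (Z := a * X * w) rfl hp rfl, hZc, hN, hD, sasaSatsumaOne,
    sasaSatsumaEnvelope, ← hkdef, ← hκdef, hnum, hden, ← mul_assoc, ← hw', hk2]
  push_cast
  field_simp

theorem contDiff_sasaSatsumaOne (hκ : waveNumber c ν ≠ 0) (φ x₀ : ℝ) :
    ContDiff ℝ ∞ (fun q : ℝ × ℝ => sasaSatsumaOne c ν φ x₀ q.1 q.2) := by
  unfold sasaSatsumaOne sasaSatsumaEnvelope
  have h : ∀ q : ℝ × ℝ, ((|waveNumber c ν|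
      * Real.cosh (2 * invWidth c ν * (q.2 - c * q.1 - x₀))
      + √(invWidth c ν ^ 2 + waveNumber c ν ^ 2) : ℝ) : ℂ) ≠ 0 := fun q => by
    have h1 := mul_pos (abs_pos.mpr hκ) (Real.cosh_pos (2 * invWidth c ν * (q.2 - c * q.1 - x₀)))
    exact Complex.ofReal_ne_zero.mpr (add_pos_of_pos_of_nonneg h1 (Real.sqrt_nonneg _)).ne'
  have hof : ContDiff ℝ ∞ (fun y : ℝ => (y : ℂ)) := Complex.ofRealCLM.contDiff
  have hd : ContDiff ℝ ∞ fun q : ℝ × ℝ => (|waveNumber c ν|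
      * Real.cosh (2 * invWidth c ν * (q.2 - c * q.1 - x₀))
      + √(invWidth c ν ^ 2 + waveNumber c ν ^ 2)) := by fun_prop
  have h1 : ContDiff ℝ ∞ fun q : ℝ × ℝ => ν * q.1 := by fun_prop
  have h2 : ContDiff ℝ ∞ fun q : ℝ × ℝ => waveNumber c ν * (q.2 - c * q.1 - x₀) := by fun_prop
  have h3 : ContDiff ℝ ∞ fun q : ℝ × ℝ => invWidth c ν * (q.2 - c * q.1 - x₀) := by fun_prop
  simp only [div_eq_mul_inv]
  exact (contDiff_const.mul (contDiff_const.mul (hof.comp h1)).cexp).mul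
    ((contDiff_const.mul (hof.comp h2)).cexp.mul
      ((contDiff_const.mul ((contDiff_coshI _).comp h3)).mul ((hof.comp hd).inv h)))

theorem norm_sqrt_two_div_two_sq : ‖((√2 / 2 : ℝ) : ℂ)‖ ^ 2 = 1 / 2 := by
  rw [Complex.norm_real, Real.norm_eq_abs, sq_abs, div_pow, Real.sq_sqrt zero_le_two]
  norm_num

theorem sasaSatsumaOne_hasProfile (hk : 0 < invWidth c ν) (hκ : waveNumber c ν ≠ 0) (φ x₀ : ℝ) :
    HasProfile (sasaSatsumaOne c ν φ x₀) (sasaSatsumaOneData c ν hk hκ φ x₀) :=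
  hasProfile_pair norm_sqrt_two_div_two_sq (contDiff_sasaSatsumaOne hκ φ x₀)
    (sasaSatsumaOneData_conj hk hκ φ x₀) (sasaSatsumaOne_eq hk hκ φ x₀)

theorem conj_cube_re (z : ℂ) : (conj z ^ 3).re = (z ^ 3).re := by
  rw [← map_pow, Complex.conj_re]

theorem sasaSatsumaOne_momentum (hk : 0 < invWidth c ν) (hκ : waveNumber c ν ≠ 0) (φ x₀ t : ℝ) :
    momentum (sasaSatsumaOne c ν φ x₀) t = invWidth c ν := by
  rw [(sasaSatsumaOne_hasProfile hk hκ φ x₀).momentum_eq, Fin.sum_univ_two]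
  simp only [sasaSatsumaOneData, Matrix.cons_val_zero, Matrix.cons_val_one, Complex.conj_re]
  ring

theorem sasaSatsumaOne_energy (hk : 0 < invWidth c ν) (hκ : waveNumber c ν ≠ 0) (φ x₀ t : ℝ) :
    energy (sasaSatsumaOne c ν φ x₀) t
      = invWidth c ν * (invWidth c ν ^ 2 - 3 * waveNumber c ν ^ 2) := by
  rw [(sasaSatsumaOne_hasProfile hk hκ φ x₀).energy_eq, Fin.sum_univ_two]
  simp only [sasaSatsumaOneData, Matrix.cons_val_zero, Matrix.cons_val_one, conj_cube_re, cube_re]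
  ring

/-- Both sides are explicit, with |a|⁴ = (k² + κ²)/κ². In the first moment this ratio cancels the
contribution of |a| to the amplitudes P_j, so no shift from x₀ remains. -/
theorem sasaSatsumaOneData_det (hk : 0 < invWidth c ν) (hκ : waveNumber c ν ≠ 0) (φ x₀ t : ℝ) :
    (sasaSatsumaOneData c ν hk hκ φ x₀ t).Mbot.det.re
      = ‖sasaFactor (invWidth c ν) (waveNumber c ν)‖ ^ 4
        * (sasaSatsumaOneData c ν hk hκ φ x₀ t).Mtop.det.re := by
  have hb : (sasaSatsumaOneData c ν hk hκ φ x₀ t).Mbot.det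
      = ((1 / (4 * invWidth c ν ^ 2) : ℝ) : ℂ) := by
    rw [Matrix.det_fin_two]
    simp only [SolitonData.Mbot, lyapunovMatrix, sasaSatsumaOneData, Fintype.sum_bool,
      Matrix.of_apply, Matrix.cons_val_zero, Matrix.cons_val_one, if_true, map_one, map_zero,
      Fin.isValue, if_false, Complex.conj_conj, Bool.false_eq_true, Pi.zero_apply]
    rw [add_comm (conj _), add_conj_mk]
    push_cast
    ring
  have ht : (sasaSatsumaOneData c ν hk hκ φ x₀ t).Mtop.det
      = ((1 / (4 * invWidth c ν ^ 2)
        - 1 / (4 * (invWidth c ν ^ 2 + waveNumber c ν ^ 2)) : ℝ) : ℂ) := by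
    have hn : (⟨invWidth c ν, waveNumber c ν⟩ : ℂ) * conj ⟨invWidth c ν, waveNumber c ν⟩
        = invWidth c ν ^ 2 + waveNumber c ν ^ 2 := by
      rw [Complex.mul_conj, Complex.normSq_mk]; push_cast; ring
    rw [Matrix.det_fin_two]
    simp only [SolitonData.Mtop, lyapunovMatrix, sasaSatsumaOneData, Fintype.sum_bool,
      Matrix.of_apply, Matrix.cons_val_zero, Matrix.cons_val_one, map_one, map_zero,
      Fin.isValue, Complex.conj_conj, Pi.one_apply]
    rw [add_comm (conj _), add_conj_mk, ← two_mul, ← two_mul]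
    push_cast
    rw [← hn]
    ring
  have h4 : ‖sasaFactor (invWidth c ν) (waveNumber c ν)‖ ^ 4
      = (invWidth c ν ^ 2 + waveNumber c ν ^ 2) / waveNumber c ν ^ 2 := by
    rw [show 4 = 2 * 2 from rfl, pow_mul, norm_sasaFactor_sq, div_pow, sq_abs,
      ← Complex.normSq_eq_norm_sq, Complex.normSq_mk]
    ring
  have h0 : invWidth c ν ^ 2 + waveNumber c ν ^ 2 ≠ 0 := by positivity
  rw [hb, ht, h4, Complex.ofReal_re, Complex.ofReal_re]
  field_simp
  ring

theorem sasaSatsumaOne_galileanEnergy (h : 0 < disc c ν) (hν : ν ≠ 0) (φ x₀ t : ℝ) :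
    galileanEnergy (sasaSatsumaOne c ν φ x₀) t = -(invWidth c ν * x₀) := by
  have hk := invWidth_pos h
  have hκ := waveNumber_ne_zero (c := c) hν
  have ha := sasaFactor_ne (k := invWidth c ν) hκ
  have hlog : Real.log (sasaSatsumaOneData c ν hk hκ φ x₀ t).Mbot.det.re
      = 4 * Real.log ‖sasaFactor (invWidth c ν) (waveNumber c ν)‖
        + Real.log (sasaSatsumaOneData c ν hk hκ φ x₀ t).Mtop.det.re := by
    have h0 : (sasaSatsumaOneData c ν hk hκ φ x₀ t).Mtop.det.re ≠ 0 :=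
      (sasaSatsumaOneData c ν hk hκ φ x₀ t).Mtop_det_re_ne
    rw [sasaSatsumaOneData_det, Real.log_mul (pow_ne_zero _ (norm_ne_zero_iff.mpr ha)) h0,
      Real.log_pow]
    push_cast; ring
  rw [(sasaSatsumaOne_hasProfile hk hκ φ x₀).galileanEnergy_eq,
    (sasaSatsumaOne_hasProfile hk hκ φ x₀).moment_eq, sasaSatsumaOne_energy hk hκ, hlog,
    ← speed_eq h, Fin.sum_univ_two]
  simp only [sasaSatsumaOneData, Matrix.cons_val_zero, Matrix.cons_val_one, RCLike.norm_conj,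
    log_norm_amplitude ha]
  ring

end SasaSatsumaOne

/-! ### The determinants of the Sasa-Satsuma 2-soliton -/

/-- Two poles `l₁`, `l₂` and their formal conjugates `m₁`, `m₂`, in general position. -/
structure PolePair where
  l₁ : ℂ
  l₂ : ℂ
  m₁ : ℂ
  m₂ : ℂ
  l₁_ne : l₁ ≠ 0
  l₂_ne : l₂ ≠ 0
  m₁_ne : m₁ ≠ 0
  m₂_ne : m₂ ≠ 0
  add₁₁ : m₁ + l₁ ≠ 0
  add₁₂ : m₁ + l₂ ≠ 0
  add₂₁ : m₂ + l₁ ≠ 0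
  add₂₂ : m₂ + l₂ ≠ 0
  add_l : l₁ + l₂ ≠ 0
  add_m : m₁ + m₂ ≠ 0
  sub₁₁ : l₁ - m₁ ≠ 0
  sub₁₂ : l₂ - m₁ ≠ 0
  sub₂₁ : l₁ - m₂ ≠ 0
  sub₂₂ : l₂ - m₂ ≠ 0
  sub_l : l₁ - l₂ ≠ 0
  sub_m : m₁ - m₂ ≠ 0

namespace PolePair

/-- Interchange of the two poles. -/
def swap (s : PolePair) : PolePair where
  l₁ := s.l₂
  l₂ := s.l₁
  m₁ := s.m₂
  m₂ := s.m₁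
  l₁_ne := s.l₂_ne
  l₂_ne := s.l₁_ne
  m₁_ne := s.m₂_ne
  m₂_ne := s.m₁_ne
  add₁₁ := s.add₂₂
  add₁₂ := s.add₂₁
  add₂₁ := s.add₁₂
  add₂₂ := s.add₁₁
  add_l := by rw [add_comm]; exact s.add_l
  add_m := by rw [add_comm]; exact s.add_m
  sub₁₁ := s.sub₂₂
  sub₁₂ := s.sub₂₁
  sub₂₁ := s.sub₁₂
  sub₂₂ := s.sub₁₁
  sub_l := by rw [← neg_sub]; exact neg_ne_zero.mpr s.sub_l
  sub_m := by rw [← neg_sub]; exact neg_ne_zero.mpr s.sub_m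

/-- Interchange of the poles with their conjugates. -/
def bar (s : PolePair) : PolePair where
  l₁ := s.m₁
  l₂ := s.m₂
  m₁ := s.l₁
  m₂ := s.l₂
  l₁_ne := s.m₁_ne
  l₂_ne := s.m₂_ne
  m₁_ne := s.l₁_ne
  m₂_ne := s.l₂_ne
  add₁₁ := by rw [add_comm]; exact s.add₁₁
  add₁₂ := by rw [add_comm]; exact s.add₂₁
  add₂₁ := by rw [add_comm]; exact s.add₁₂
  add₂₂ := by rw [add_comm]; exact s.add₂₂
  add_l := s.add_m
  add_m := s.add_l
  sub₁₁ := by rw [← neg_sub]; exact neg_ne_zero.mpr s.sub₁₁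
  sub₁₂ := by rw [← neg_sub]; exact neg_ne_zero.mpr s.sub₂₁
  sub₂₁ := by rw [← neg_sub]; exact neg_ne_zero.mpr s.sub₁₂
  sub₂₂ := by rw [← neg_sub]; exact neg_ne_zero.mpr s.sub₂₂
  sub_l := s.sub_m
  sub_m := s.sub_l

variable (s : PolePair)

/-! ### Coefficients of the 4×4 determinants. -/

set_option linter.unusedSimpArgs false

/-- Cauchy entries of the Lyapunov matrix: c pairs a conjugate pole with a pole, d two conjugate
poles, e two poles. -/
def c₁₁ : ℂ := (s.m₁ + s.l₁)⁻¹
def c₁₂ : ℂ := (s.m₁ + s.l₂)⁻¹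
def c₂₁ : ℂ := (s.m₂ + s.l₁)⁻¹
def c₂₂ : ℂ := (s.m₂ + s.l₂)⁻¹
def d₁₁ : ℂ := (s.m₁ + s.m₁)⁻¹
def d₁₂ : ℂ := (s.m₁ + s.m₂)⁻¹
def d₂₂ : ℂ := (s.m₂ + s.m₂)⁻¹
def e₁₁ : ℂ := (s.l₁ + s.l₁)⁻¹
def e₁₂ : ℂ := (s.l₁ + s.l₂)⁻¹
def e₂₂ : ℂ := (s.l₂ + s.l₂)⁻¹

/-- The squares of the complex amplitudes of the two waves and of their conjugates. -/
def A₁ : ℂ := 2 * s.l₁ * (s.l₁ + s.l₂) / ((s.l₁ - s.m₁) * (s.l₁ - s.m₂))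
def A₂ : ℂ := 2 * s.l₂ * (s.l₁ + s.l₂) / ((s.l₂ - s.m₂) * (s.l₂ - s.m₁))
def B₁ : ℂ := 2 * s.m₁ * (s.m₁ + s.m₂) / ((s.l₁ - s.m₁) * (s.l₂ - s.m₁))
def B₂ : ℂ := 2 * s.m₂ * (s.m₁ + s.m₂) / ((s.l₂ - s.m₂) * (s.l₁ - s.m₂))

def k₁ : ℂ := (s.l₁ + s.m₁) / 2
def k₂ : ℂ := (s.l₂ + s.m₂) / 2

def Γ : ℂ := (s.l₁ - s.l₂) * (s.m₁ - s.m₂) / ((s.m₂ + s.l₁) * (s.m₁ + s.l₂))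

/-- The square of the ratio `Δ`. -/
def Δsq : ℂ := -((s.l₁ - s.m₂) * (s.l₂ - s.m₁)) / ((s.l₁ + s.l₂) * (s.m₁ + s.m₂))

/-- The normalization of the determinant. -/
def c₀ : ℂ := 8 * s.k₁ ^ 2 * s.k₂ ^ 2 / s.Γ

/-- `Kp`, `Km`, `F`, `H`, `S` and `L` are the coefficients in the expansion of the denominator. -/
def Kp : ℂ := 4 * s.k₁ * s.k₂ / ((s.m₂ + s.l₁) * (s.m₁ + s.l₂))
def Km : ℂ := 4 * s.k₁ * s.k₂ / ((s.l₁ - s.l₂) * (s.m₁ - s.m₂))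
def F : ℂ := (s.l₁ + s.l₂) / (s.m₁ + s.m₂)
def H : ℂ := 1 / (2 * s.Δsq * s.Γ)

/-- The product `Υ` in terms of the poles. -/
def Υ : ℂ := (s.l₁ - s.l₂) * (s.m₁ - s.m₂) * ((s.m₂ + s.l₁) * (s.m₁ + s.l₂))

def S : ℂ :=
  -(8 * s.k₁ ^ 2 * s.k₂ ^ 2 * ((s.l₁ + s.l₂) * (s.m₁ + s.m₂)))
    / (s.Υ * ((s.l₁ - s.m₁) * (s.l₂ - s.m₂)))

def L : ℂ := s.Γ + s.Δsq / s.Γ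
  - 16 * s.k₁ ^ 2 * s.k₂ ^ 2 * ((s.l₁ - s.m₁) * (s.l₂ - s.m₂))
    / ((s.l₁ + s.l₂) * (s.m₁ + s.m₂) * s.Υ)

/-- `h`, `g`, `C` and `G` are the coefficients in the expansion of the numerator. The other half
arises from them through `bar` and `swap`. -/
def h : ℂ := (s.m₁ - s.m₂) / (s.m₁ + s.l₂)
def g : ℂ := (s.l₁ + s.l₂) * (s.m₂ + s.l₁) / ((s.l₁ - s.m₂) * (s.l₁ - s.l₂))

def C : ℂ :=
  4 * s.k₂ ^ 2 * (s.l₂ - s.m₂) / (s.m₁ + s.m₂) / ((s.m₁ - s.m₂) * (s.m₁ + s.l₂))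
    - s.h - s.Δsq * ((s.l₁ + s.l₂) / (s.l₁ - s.m₂)) * ((s.l₁ - s.l₂) / (s.m₂ + s.l₁)) / s.Γ

def G : ℂ :=
  4 * s.k₁ ^ 2 * s.k₂ * (s.m₁ + s.m₂) / (s.l₁ - s.m₁) / ((s.m₁ - s.m₂) * (s.m₂ + s.l₁))

-- The suffix of each name is the monomial in Z₁, Z₂, Y₁, Y₂ whose coefficient in the determinant is
-- evaluated. Squares of amplitudes contained in that monomial are already replaced by `A₁`, `A₂`,
-- `B₁`, `B₂`, which makes each identity rational in four independent variables.
set_option maxRecDepth 4000 in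
theorem det_coeff_one :
    s.c₀ * (s.c₁₁ ^ 2 * s.c₂₂ ^ 2 - 2 * s.c₁₁ * s.c₁₂ * s.c₂₁ * s.c₂₂ + s.c₁₂ ^ 2 * s.c₂₁ ^ 2)
      = s.Γ / 2 := by
  obtain ⟨l₁, l₂, m₁, m₂, _, _, _, _, _, _, _, _, _, _, _, _, _, _, _, _⟩ := s
  simp only [c₀, c₁₁, c₁₂, c₂₁, c₂₂, d₁₁, d₁₂, d₂₂, e₁₁, e₁₂, e₂₂, A₁, A₂, B₁, B₂, k₁, k₂, Γ, Δsq,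
    Kp, Km, F, H, S, L, h, g, C, G, Υ, bar, ← two_mul]
  field_simp
  ring

set_option maxRecDepth 4000 in
theorem det_coeff_Z₁Y₁ :
    s.c₀ * (2 * s.c₁₁ ^ 2 * s.c₂₂ ^ 2 - 2 * s.c₁₁ * s.c₁₂ * s.c₂₁ * s.c₂₂)
      = 1 := by
  obtain ⟨l₁, l₂, m₁, m₂, _, _, _, _, _, _, _, _, _, _, _, _, _, _, _, _⟩ := s
  simp only [c₀, c₁₁, c₁₂, c₂₁, c₂₂, d₁₁, d₁₂, d₂₂, e₁₁, e₁₂, e₂₂, A₁, A₂, B₁, B₂, k₁, k₂, Γ, Δsq,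
    Kp, Km, F, H, S, L, h, g, C, G, Υ, bar, ← two_mul]
  field_simp
  ring

set_option maxRecDepth 4000 in
theorem det_coeff_Z₁Y₂ :
    s.c₀ * (-2 * s.c₁₁ * s.c₁₂ * s.c₂₁ * s.c₂₂ + 2 * s.c₁₂ ^ 2 * s.c₂₁ ^ 2)
      = -s.Kp := by
  obtain ⟨l₁, l₂, m₁, m₂, _, _, _, _, _, _, _, _, _, _, _, _, _, _, _, _⟩ := s
  simp only [c₀, c₁₁, c₁₂, c₂₁, c₂₂, d₁₁, d₁₂, d₂₂, e₁₁, e₁₂, e₂₂, A₁, A₂, B₁, B₂, k₁, k₂, Γ, Δsq,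
    Kp, Km, F, H, S, L, h, g, C, G, Υ, bar, ← two_mul]
  field_simp
  ring

set_option maxRecDepth 4000 in
theorem det_coeff_Z₁Z₁Y₁Y₁ :
    s.c₀ * (s.c₁₁ ^ 2 * s.c₂₂ ^ 2 - s.c₂₂ ^ 2 * s.d₁₁ * s.e₁₁) * (s.A₁ * s.B₁)
      = s.H := by
  obtain ⟨l₁, l₂, m₁, m₂, _, _, _, _, _, _, _, _, _, _, _, _, _, _, _, _⟩ := s
  simp only [c₀, c₁₁, c₁₂, c₂₁, c₂₂, d₁₁, d₁₂, d₂₂, e₁₁, e₁₂, e₂₂, A₁, A₂, B₁, B₂, k₁, k₂, Γ, Δsq,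
    Kp, Km, F, H, S, L, h, g, C, G, Υ, bar, ← two_mul]
  field_simp
  ring

set_option maxRecDepth 4000 in
theorem det_coeff_Z₁Z₁Y₁Y₂ :
    s.c₀ * (-2 * s.c₁₁ * s.c₁₂ * s.c₂₁ * s.c₂₂ + 2 * s.c₁₂ * s.c₂₂ * s.d₁₂ * s.e₁₁) * s.A₁
      = s.Km * s.F := by
  obtain ⟨l₁, l₂, m₁, m₂, _, _, _, _, _, _, _, _, _, _, _, _, _, _, _, _⟩ := s
  simp only [c₀, c₁₁, c₁₂, c₂₁, c₂₂, d₁₁, d₁₂, d₂₂, e₁₁, e₁₂, e₂₂, A₁, A₂, B₁, B₂, k₁, k₂, Γ, Δsq,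
    Kp, Km, F, H, S, L, h, g, C, G, Υ, bar, ← two_mul]
  field_simp
  ring

set_option maxRecDepth 4000 in
theorem det_coeff_Z₁Z₁Y₂Y₂ :
    s.c₀ * (s.c₁₂ ^ 2 * s.c₂₁ ^ 2 - s.c₁₂ ^ 2 * s.d₂₂ * s.e₁₁) * (s.A₁ * s.B₂)
      = s.S := by
  obtain ⟨l₁, l₂, m₁, m₂, _, _, _, _, _, _, _, _, _, _, _, _, _, _, _, _⟩ := s
  simp only [c₀, c₁₁, c₁₂, c₂₁, c₂₂, d₁₁, d₁₂, d₂₂, e₁₁, e₁₂, e₂₂, A₁, A₂, B₁, B₂, k₁, k₂, Γ, Δsq,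
    Kp, Km, F, H, S, L, h, g, C, G, Υ, bar, ← two_mul]
  field_simp
  ring

set_option maxRecDepth 4000 in
theorem det_coeff_Z₁Z₂Y₁Y₂ :
    s.c₀ * (4 * s.c₁₁ ^ 2 * s.c₂₂ ^ 2 - 4 * s.c₁₁ * s.c₁₂ * s.c₂₁ * s.c₂₂ - 2 * s.c₁₁ * s.c₂₂ *
    s.d₁₂ * s.e₁₂ + 4 * s.c₁₂ ^ 2 * s.c₂₁ ^ 2 - 2 * s.c₁₂ * s.c₂₁ * s.d₁₂ * s.e₁₂)
      = s.L := by
  obtain ⟨l₁, l₂, m₁, m₂, _, _, _, _, _, _, _, _, _, _, _, _, _, _, _, _⟩ := s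
  simp only [c₀, c₁₁, c₁₂, c₂₁, c₂₂, d₁₁, d₁₂, d₂₂, e₁₁, e₁₂, e₂₂, A₁, A₂, B₁, B₂, k₁, k₂, Γ, Δsq,
    Kp, Km, F, H, S, L, h, g, C, G, Υ, bar, ← two_mul]
  field_simp
  ring

set_option maxRecDepth 4000 in
theorem det_coeff_Z₁Z₁Z₂Y₁Y₁Y₂ :
    s.c₀ * (2 * s.c₁₁ ^ 2 * s.c₂₂ ^ 2 - 2 * s.c₁₁ * s.c₁₂ * s.c₂₁ * s.c₂₂ - 2 * s.c₁₁ * s.c₂₂ *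
    s.d₁₂ * s.e₁₂ + 2 * s.c₁₂ * s.c₂₂ * s.d₁₂ * s.e₁₁ + 2 * s.c₂₁ * s.c₂₂ * s.d₁₁ * s.e₁₂ - 2 *
    s.c₂₂ ^ 2 * s.d₁₁ * s.e₁₁) * (s.A₁ * s.B₁)
      = 1 := by
  obtain ⟨l₁, l₂, m₁, m₂, _, _, _, _, _, _, _, _, _, _, _, _, _, _, _, _⟩ := s
  simp only [c₀, c₁₁, c₁₂, c₂₁, c₂₂, d₁₁, d₁₂, d₂₂, e₁₁, e₁₂, e₂₂, A₁, A₂, B₁, B₂, k₁, k₂, Γ, Δsq,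
    Kp, Km, F, H, S, L, h, g, C, G, Υ, bar, ← two_mul]
  field_simp
  ring

set_option maxRecDepth 4000 in
theorem det_coeff_Z₁Z₁Z₂Y₁Y₂Y₂ :
    s.c₀ * (-2 * s.c₁₁ * s.c₁₂ * s.c₂₁ * s.c₂₂ + 2 * s.c₁₁ * s.c₁₂ * s.d₂₂ * s.e₁₂ + 2 * s.c₁₂
    ^ 2 * s.c₂₁ ^ 2 - 2 * s.c₁₂ ^ 2 * s.d₂₂ * s.e₁₁ - 2 * s.c₁₂ * s.c₂₁ * s.d₁₂ * s.e₁₂ + 2 *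
    s.c₁₂ * s.c₂₂ * s.d₁₂ * s.e₁₁) * (s.A₁ * s.B₂)
      = -s.Kp := by
  obtain ⟨l₁, l₂, m₁, m₂, _, _, _, _, _, _, _, _, _, _, _, _, _, _, _, _⟩ := s
  simp only [c₀, c₁₁, c₁₂, c₂₁, c₂₂, d₁₁, d₁₂, d₂₂, e₁₁, e₁₂, e₂₂, A₁, A₂, B₁, B₂, k₁, k₂, Γ, Δsq,
    Kp, Km, F, H, S, L, h, g, C, G, Υ, bar, ← two_mul]
  field_simp
  ring

set_option maxRecDepth 4000 in
theorem det_coeff_Z₁Z₁Z₂Z₂Y₁Y₁Y₂Y₂ :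
    s.c₀ * (s.c₁₁ ^ 2 * s.c₂₂ ^ 2 - s.c₁₁ ^ 2 * s.d₂₂ * s.e₂₂ - 2 * s.c₁₁ * s.c₁₂ * s.c₂₁ *
    s.c₂₂ + 2 * s.c₁₁ * s.c₁₂ * s.d₂₂ * s.e₁₂ + 2 * s.c₁₁ * s.c₂₁ * s.d₁₂ * s.e₂₂ - 2 * s.c₁₁ *
    s.c₂₂ * s.d₁₂ * s.e₁₂ + s.c₁₂ ^ 2 * s.c₂₁ ^ 2 - s.c₁₂ ^ 2 * s.d₂₂ * s.e₁₁ - 2 * s.c₁₂ *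
    s.c₂₁ * s.d₁₂ * s.e₁₂ + 2 * s.c₁₂ * s.c₂₂ * s.d₁₂ * s.e₁₁ - s.c₂₁ ^ 2 * s.d₁₁ * s.e₂₂ + 2 *
    s.c₂₁ * s.c₂₂ * s.d₁₁ * s.e₁₂ - s.c₂₂ ^ 2 * s.d₁₁ * s.e₁₁ + s.d₁₁ * s.d₂₂ * s.e₁₁ * s.e₂₂ -
    s.d₁₁ * s.d₂₂ * s.e₁₂ ^ 2 - s.d₁₂ ^ 2 * s.e₁₁ * s.e₂₂ + s.d₁₂ ^ 2 * s.e₁₂ ^ 2) * (s.A₁ *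
    s.A₂ * s.B₁ * s.B₂)
      = s.Γ / 2 := by
  obtain ⟨l₁, l₂, m₁, m₂, _, _, _, _, _, _, _, _, _, _, _, _, _, _, _, _⟩ := s
  simp only [c₀, c₁₁, c₁₂, c₂₁, c₂₂, d₁₁, d₁₂, d₂₂, e₁₁, e₁₂, e₂₂, A₁, A₂, B₁, B₂, k₁, k₂, Γ, Δsq,
    Kp, Km, F, H, S, L, h, g, C, G, Υ, bar, ← two_mul]
  field_simp
  ring

-- The same scheme for the numerator, the sum of the two determinants in which row 0 or row 1 is
-- replaced by p.
set_option maxRecDepth 4000 in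
theorem num_coeff_Z₁ :
    s.c₀ * (-s.c₁₁ * s.c₁₂ * s.c₂₂ + s.c₁₁ * s.c₂₂ ^ 2 + s.c₁₂ ^ 2 * s.c₂₁ - s.c₁₂ * s.c₂₁ *
    s.c₂₂)
      = s.k₁ * s.h := by
  obtain ⟨l₁, l₂, m₁, m₂, _, _, _, _, _, _, _, _, _, _, _, _, _, _, _, _⟩ := s
  simp only [c₀, c₁₁, c₁₂, c₂₁, c₂₂, d₁₁, d₁₂, d₂₂, e₁₁, e₁₂, e₂₂, A₁, A₂, B₁, B₂, k₁, k₂, Γ, Δsq,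
    Kp, Km, F, H, S, L, h, g, C, G, Υ, bar, ← two_mul]
  field_simp
  ring

set_option maxRecDepth 4000 in
theorem num_coeff_Z₁Z₁Z₂Z₂Y₁Y₂Y₂ :
    s.c₀ * (-s.c₁₁ * s.c₂₁ * s.c₂₂ + s.c₁₁ * s.c₂₁ * s.e₂₂ + s.c₁₁ * s.c₂₂ ^ 2 - s.c₁₁ * s.c₂₂
    * s.e₁₂ + s.c₁₁ * s.d₂₂ * s.e₁₂ - s.c₁₁ * s.d₂₂ * s.e₂₂ + s.c₁₂ * s.c₂₁ ^ 2 - s.c₁₂ * s.c₂₁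
    * s.c₂₂ - s.c₁₂ * s.c₂₁ * s.e₁₂ + s.c₁₂ * s.c₂₂ * s.e₁₁ - s.c₁₂ * s.d₂₂ * s.e₁₁ + s.c₁₂ *
    s.d₂₂ * s.e₁₂ - s.c₂₁ ^ 2 * s.e₂₂ + 2 * s.c₂₁ * s.c₂₂ * s.e₁₂ - s.c₂₁ * s.d₁₂ * s.e₁₂ +
    s.c₂₁ * s.d₁₂ * s.e₂₂ - s.c₂₂ ^ 2 * s.e₁₁ + s.c₂₂ * s.d₁₂ * s.e₁₁ - s.c₂₂ * s.d₁₂ * s.e₁₂ -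
    s.d₁₂ * s.e₁₁ * s.e₂₂ + s.d₁₂ * s.e₁₂ ^ 2 + s.d₂₂ * s.e₁₁ * s.e₂₂ - s.d₂₂ * s.e₁₂ ^ 2) *
    (s.A₁ * s.A₂ * s.B₂)
      = s.k₁ * s.bar.h := by
  obtain ⟨l₁, l₂, m₁, m₂, _, _, _, _, _, _, _, _, _, _, _, _, _, _, _, _⟩ := s
  have : l₁ + m₂ ≠ 0 := by rwa [add_comm]
  have : l₂ + m₁ ≠ 0 := by rwa [add_comm]
  simp only [c₀, c₁₁, c₁₂, c₂₁, c₂₂, d₁₁, d₁₂, d₂₂, e₁₁, e₁₂, e₂₂, A₁, A₂, B₁, B₂, k₁, k₂, Γ, Δsq,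
    Kp, Km, F, H, S, L, h, g, C, G, Υ, bar, ← two_mul]
  field_simp
  ring

set_option maxRecDepth 4000 in
theorem num_coeff_Z₁Z₁Y₁ :
    s.c₀ * (-s.c₁₁ * s.c₁₂ * s.c₂₂ + s.c₁₁ * s.c₂₂ ^ 2 + s.c₁₂ * s.c₂₂ * s.e₁₁ - s.c₂₂ ^ 2 *
    s.e₁₁) * s.A₁
      = s.k₁ * s.g := by
  obtain ⟨l₁, l₂, m₁, m₂, _, _, _, _, _, _, _, _, _, _, _, _, _, _, _, _⟩ := s
  simp only [c₀, c₁₁, c₁₂, c₂₁, c₂₂, d₁₁, d₁₂, d₂₂, e₁₁, e₁₂, e₂₂, A₁, A₂, B₁, B₂, k₁, k₂, Γ, Δsq,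
    Kp, Km, F, H, S, L, h, g, C, G, Υ, bar, ← two_mul]
  field_simp
  ring

set_option maxRecDepth 4000 in
theorem num_coeff_Z₁Z₂Z₂Y₂Y₂ :
    s.c₀ * (-s.c₁₁ * s.c₂₁ * s.c₂₂ + s.c₁₁ * s.c₂₁ * s.e₂₂ + s.c₁₁ * s.c₂₂ ^ 2 - s.c₁₁ * s.c₂₂
    * s.e₁₂ + s.c₁₁ * s.d₂₂ * s.e₁₂ - s.c₁₁ * s.d₂₂ * s.e₂₂) * (s.A₂ * s.B₂)
      = s.k₁ * s.bar.g := by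
  obtain ⟨l₁, l₂, m₁, m₂, _, _, _, _, _, _, _, _, _, _, _, _, _, _, _, _⟩ := s
  have : m₁ - l₂ ≠ 0 := by rwa [← neg_sub, neg_ne_zero]
  have : l₁ + m₂ ≠ 0 := by rwa [add_comm]
  have : l₂ + m₁ ≠ 0 := by rwa [add_comm]
  simp only [c₀, c₁₁, c₁₂, c₂₁, c₂₂, d₁₁, d₁₂, d₂₂, e₁₁, e₁₂, e₂₂, A₁, A₂, B₁, B₂, k₁, k₂, Γ, Δsq,
    Kp, Km, F, H, S, L, h, g, C, G, Υ, bar, ← two_mul]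
  field_simp
  ring

set_option maxRecDepth 4000 in
theorem num_coeff_Z₁Z₁Z₂Y₁Y₂ :
    s.c₀ * (-s.c₁₁ * s.c₁₂ * s.c₂₁ - s.c₁₁ * s.c₁₂ * s.c₂₂ + 2 * s.c₁₁ * s.c₁₂ * s.e₁₂ - s.c₁₁
    * s.c₂₁ * s.c₂₂ + 2 * s.c₁₁ * s.c₂₂ ^ 2 - s.c₁₁ * s.c₂₂ * s.e₁₂ + 2 * s.c₁₂ ^ 2 * s.c₂₁ - 2
    * s.c₁₂ ^ 2 * s.e₁₁ - s.c₁₂ * s.c₂₁ * s.c₂₂ - s.c₁₂ * s.c₂₁ * s.e₁₂ + 2 * s.c₁₂ * s.c₂₂ *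
    s.e₁₁ + s.c₁₂ * s.d₁₂ * s.e₁₁ - s.c₁₂ * s.d₁₂ * s.e₁₂ + 2 * s.c₂₁ * s.c₂₂ * s.e₁₂ - 2 *
    s.c₂₂ ^ 2 * s.e₁₁ + s.c₂₂ * s.d₁₂ * s.e₁₁ - s.c₂₂ * s.d₁₂ * s.e₁₂) * s.A₁
      = -(s.k₁ * s.C) := by
  obtain ⟨l₁, l₂, m₁, m₂, _, _, _, _, _, _, _, _, _, _, _, _, _, _, _, _⟩ := s
  simp only [c₀, c₁₁, c₁₂, c₂₁, c₂₂, d₁₁, d₁₂, d₂₂, e₁₁, e₁₂, e₂₂, A₁, A₂, B₁, B₂, k₁, k₂, Γ, Δsq,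
    Kp, Km, F, H, S, L, h, g, C, G, Υ, bar, ← two_mul]
  field_simp
  ring

set_option maxRecDepth 4000 in
theorem num_coeff_Z₁Z₂Y₂ :
    s.c₀ * (-s.c₁₁ * s.c₁₂ * s.c₂₁ - s.c₁₁ * s.c₁₂ * s.c₂₂ + 2 * s.c₁₁ * s.c₁₂ * s.e₁₂ - s.c₁₁
    * s.c₂₁ * s.c₂₂ + 2 * s.c₁₁ * s.c₂₂ ^ 2 - s.c₁₁ * s.c₂₂ * s.e₁₂ + 2 * s.c₁₂ * s.c₂₁ ^ 2 -
    s.c₁₂ * s.c₂₁ * s.c₂₂ - s.c₁₂ * s.c₂₁ * s.e₁₂)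
      = -(s.k₁ * s.bar.C) := by
  obtain ⟨l₁, l₂, m₁, m₂, _, _, _, _, _, _, _, _, _, _, _, _, _, _, _, _⟩ := s
  have : m₁ - l₂ ≠ 0 := by rwa [← neg_sub, neg_ne_zero]
  have : l₁ + m₂ ≠ 0 := by rwa [add_comm]
  have : l₂ + m₁ ≠ 0 := by rwa [add_comm]
  simp only [c₀, c₁₁, c₁₂, c₂₁, c₂₂, d₁₁, d₁₂, d₂₂, e₁₁, e₁₂, e₂₂, A₁, A₂, B₁, B₂, k₁, k₂, Γ, Δsq,
    Kp, Km, F, H, S, L, h, g, C, G, Υ, bar, ← two_mul]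
  field_simp
  ring

set_option maxRecDepth 4000 in
theorem num_coeff_Z₁Z₁Z₂Y₂Y₂ :
    s.c₀ * (s.c₁₂ * s.c₂₁ ^ 2 - s.c₁₂ * s.c₂₁ * s.c₂₂ - s.c₁₂ * s.c₂₁ * s.e₁₂ + s.c₁₂ * s.c₂₂ *
    s.e₁₁ - s.c₁₂ * s.d₂₂ * s.e₁₁ + s.c₁₂ * s.d₂₂ * s.e₁₂) * (s.A₁ * s.B₂)
      = s.G := by
  obtain ⟨l₁, l₂, m₁, m₂, _, _, _, _, _, _, _, _, _, _, _, _, _, _, _, _⟩ := s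
  simp only [c₀, c₁₁, c₁₂, c₂₁, c₂₂, d₁₁, d₁₂, d₂₂, e₁₁, e₁₂, e₂₂, A₁, A₂, B₁, B₂, k₁, k₂, Γ, Δsq,
    Kp, Km, F, H, S, L, h, g, C, G, Υ, bar, ← two_mul]
  field_simp
  ring

set_option maxRecDepth 4000 in
theorem num_coeff_Z₁Z₁Y₂ :
    s.c₀ * (s.c₁₂ ^ 2 * s.c₂₁ - s.c₁₂ ^ 2 * s.e₁₁ - s.c₁₂ * s.c₂₁ * s.c₂₂ + s.c₁₂ * s.c₂₂ *
    s.e₁₁) * s.A₁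
      = s.bar.G := by
  obtain ⟨l₁, l₂, m₁, m₂, _, _, _, _, _, _, _, _, _, _, _, _, _, _, _, _⟩ := s
  have : m₁ - l₁ ≠ 0 := by rwa [← neg_sub, neg_ne_zero]
  have : l₁ + m₂ ≠ 0 := by rwa [add_comm]
  have : l₂ + m₁ ≠ 0 := by rwa [add_comm]
  simp only [c₀, c₁₁, c₁₂, c₂₁, c₂₂, d₁₁, d₁₂, d₂₂, e₁₁, e₁₂, e₂₂, A₁, A₂, B₁, B₂, k₁, k₂, Γ, Δsq,
    Kp, Km, F, H, S, L, h, g, C, G, Υ, bar, ← two_mul]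
  field_simp
  ring

end PolePair

/-! ### Symmetries under `swap` and `bar`, and the assembled determinants. -/

namespace PolePair

variable (s : PolePair)

theorem swap_c₁₁ : s.swap.c₁₁ = s.c₂₂ := rfl
theorem swap_c₁₂ : s.swap.c₁₂ = s.c₂₁ := rfl
theorem swap_c₂₁ : s.swap.c₂₁ = s.c₁₂ := rfl
theorem swap_c₂₂ : s.swap.c₂₂ = s.c₁₁ := rfl
theorem swap_d₁₁ : s.swap.d₁₁ = s.d₂₂ := rfl
theorem swap_d₁₂ : s.swap.d₁₂ = s.d₁₂ := congrArg (·⁻¹) (add_comm _ _)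
theorem swap_d₂₂ : s.swap.d₂₂ = s.d₁₁ := rfl
theorem swap_e₁₁ : s.swap.e₁₁ = s.e₂₂ := rfl
theorem swap_e₁₂ : s.swap.e₁₂ = s.e₁₂ := congrArg (·⁻¹) (add_comm _ _)
theorem swap_e₂₂ : s.swap.e₂₂ = s.e₁₁ := rfl
theorem bar_c₁₁ : s.bar.c₁₁ = s.c₁₁ := congrArg (·⁻¹) (add_comm _ _)
theorem bar_c₁₂ : s.bar.c₁₂ = s.c₂₁ := congrArg (·⁻¹) (add_comm _ _)
theorem bar_c₂₁ : s.bar.c₂₁ = s.c₁₂ := congrArg (·⁻¹) (add_comm _ _)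
theorem bar_c₂₂ : s.bar.c₂₂ = s.c₂₂ := congrArg (·⁻¹) (add_comm _ _)
theorem bar_d₁₂ : s.bar.d₁₂ = s.e₁₂ := rfl
theorem bar_e₁₁ : s.bar.e₁₁ = s.d₁₁ := rfl

theorem swap_A₁ : s.swap.A₁ = s.A₂ := by simp only [A₁, A₂, swap, add_comm s.l₂]
theorem swap_A₂ : s.swap.A₂ = s.A₁ := by simp only [A₁, A₂, swap, add_comm s.l₂]
theorem swap_B₁ : s.swap.B₁ = s.B₂ := by simp only [B₁, B₂, swap, add_comm s.m₂]
theorem swap_B₂ : s.swap.B₂ = s.B₁ := by simp only [B₁, B₂, swap, add_comm s.m₂]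
theorem bar_A₁ : s.bar.A₁ = s.B₁ := by simp only [A₁, B₁, bar]; congr 1; ring
theorem bar_A₂ : s.bar.A₂ = s.B₂ := by simp only [A₂, B₂, bar]; congr 1; ring

theorem swap_k₁ : s.swap.k₁ = s.k₂ := rfl
theorem swap_k₂ : s.swap.k₂ = s.k₁ := rfl
theorem bar_k₁ : s.bar.k₁ = s.k₁ := by simp only [k₁, bar, add_comm]
theorem bar_k₂ : s.bar.k₂ = s.k₂ := by simp only [k₂, bar, add_comm]
theorem swap_Γ : s.swap.Γ = s.Γ := by simp only [Γ, swap]; congr 1 <;> ring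
theorem bar_Γ : s.bar.Γ = s.Γ := by simp only [Γ, bar]; congr 1 <;> ring
theorem swap_Δsq : s.swap.Δsq = s.Δsq := by simp only [Δsq, swap]; congr 1 <;> ring
theorem swap_c₀ : s.swap.c₀ = s.c₀ := by
  simp only [c₀, swap_Γ, swap_k₁, swap_k₂]; congr 1; ring
theorem bar_c₀ : s.bar.c₀ = s.c₀ := by simp only [c₀, bar_Γ, bar_k₁, bar_k₂]
theorem swap_Kp : s.swap.Kp = s.Kp := by
  rw [Kp, Kp, swap_k₁, swap_k₂]; simp only [swap]; congr 1 <;> ring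
theorem swap_Km : s.swap.Km = s.Km := by
  rw [Km, Km, swap_k₁, swap_k₂]; simp only [swap]; congr 1 <;> ring
theorem bar_Km : s.bar.Km = s.Km := by
  rw [Km, Km, bar_k₁, bar_k₂]; simp only [bar]; congr 1; ring
theorem swap_F : s.swap.F = s.F := by simp only [F, swap]; congr 1 <;> ring
theorem swap_H : s.swap.H = s.H := by rw [H, H, swap_Δsq, swap_Γ]
theorem swap_bar_F : s.swap.bar.F = s.bar.F := s.bar.swap_F
theorem swap_Υ : s.swap.Υ = s.Υ := by simp only [Υ, swap]; ring
theorem swap_S : s.swap.S = s.S := by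
  rw [S, S, swap_k₁, swap_k₂, swap_Υ]; simp only [swap]; congr 1 <;> ring

/-- The Lyapunov matrix of the Sasa-Satsuma 2-soliton, as a function of the exponentials
`Z₁`, `Z₂` and their conjugates `Y₁`, `Y₂`. -/
def lyapunov (Z₁ Z₂ Y₁ Y₂ : ℂ) : Matrix (Fin 4) (Fin 4) ℂ :=
  !![(Y₁ * Z₁ + 1) * s.c₁₁, (Y₁ * Z₂ + 1) * s.c₁₂, Y₁ * Y₁ * s.d₁₁, Y₁ * Y₂ * s.d₁₂;
    (Y₂ * Z₁ + 1) * s.c₂₁, (Y₂ * Z₂ + 1) * s.c₂₂, Y₂ * Y₁ * s.d₁₂, Y₂ * Y₂ * s.d₂₂;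
    Z₁ * Z₁ * s.e₁₁, Z₁ * Z₂ * s.e₁₂, (Z₁ * Y₁ + 1) * s.c₁₁, (Z₁ * Y₂ + 1) * s.c₂₁;
    Z₂ * Z₁ * s.e₁₂, Z₂ * Z₂ * s.e₂₂, (Z₂ * Y₁ + 1) * s.c₁₂, (Z₂ * Y₂ + 1) * s.c₂₂]

theorem det_fin_four {R : Type*} [CommRing R] (M : Matrix (Fin 4) (Fin 4) R) :
    M.det =
      M 0 0 * (M 1 1 * (M 2 2 * M 3 3 - M 2 3 * M 3 2) - M 1 2 * (M 2 1 * M 3 3 - M 2 3 * M 3 1)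
        + M 1 3 * (M 2 1 * M 3 2 - M 2 2 * M 3 1))
      - M 0 1 * (M 1 0 * (M 2 2 * M 3 3 - M 2 3 * M 3 2) - M 1 2 * (M 2 0 * M 3 3 - M 2 3 * M 3 0)
        + M 1 3 * (M 2 0 * M 3 2 - M 2 2 * M 3 0))
      + M 0 2 * (M 1 0 * (M 2 1 * M 3 3 - M 2 3 * M 3 1) - M 1 1 * (M 2 0 * M 3 3 - M 2 3 * M 3 0)
        + M 1 3 * (M 2 0 * M 3 1 - M 2 1 * M 3 0))
      - M 0 3 * (M 1 0 * (M 2 1 * M 3 2 - M 2 2 * M 3 1) - M 1 1 * (M 2 0 * M 3 2 - M 2 2 * M 3 0)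
        + M 1 2 * (M 2 0 * M 3 1 - M 2 1 * M 3 0)) := by
  rw [Matrix.det_succ_row_zero, Fin.sum_univ_four]
  simp only [Matrix.det_fin_three, Matrix.submatrix_apply]
  simp [Fin.succAbove, Fin.lt_def, Fin.succ, Fin.castSucc]
  ring

/-- With these amplitudes the expansion is balanced: complementary powers of X₁ and X₂ carry equal
or conjugate coefficients, so dividing by X₁²X₂² yields hyperbolic cosines. -/
theorem c₀_mul_det {a₁ a₂ b₁ b₂ w₁ w₂ v₁ v₂ : ℂ} (ha₁ : a₁ ^ 2 = s.A₁) (ha₂ : a₂ ^ 2 = s.A₂)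
    (hb₁ : b₁ ^ 2 = s.B₁) (hb₂ : b₂ ^ 2 = s.B₂) (hw₁ : w₁ * v₁ = 1) (hw₂ : w₂ * v₂ = 1)
    (X₁ X₂ : ℂ) :
    s.c₀ * (s.lyapunov (a₁ * X₁ * w₁) (a₂ * X₂ * w₂) (b₁ * X₁ * v₁) (b₂ * X₂ * v₂)).det
      = s.Γ / 2 * (1 + X₁ ^ 4 * X₂ ^ 4)
        + s.H * (X₁ ^ 4 + X₂ ^ 4)
        + a₁ * b₁ * X₁ ^ 2 * (1 + X₂ ^ 4) + a₂ * b₂ * X₂ ^ 2 * (1 + X₁ ^ 4)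
        + s.S * X₁ ^ 2 * X₂ ^ 2 * ((w₁ * v₂) ^ 2 + (w₂ * v₁) ^ 2)
        + s.L * (a₁ * b₁ * (a₂ * b₂)) * X₁ ^ 2 * X₂ ^ 2
        - s.Kp * (X₁ * X₂) * (w₁ * v₂ * (b₁ * a₂ * X₁ ^ 2 * X₂ ^ 2 + a₁ * b₂)
          + w₂ * v₁ * (a₁ * b₂ * X₁ ^ 2 * X₂ ^ 2 + b₁ * a₂))
        + s.Km * (X₁ * X₂) * (w₁ * v₂ * (s.F * (b₁ * b₂) * X₁ ^ 2 + s.bar.F * (a₁ * a₂) * X₂ ^ 2)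
          + w₂ * v₁ * (s.bar.F * (a₁ * a₂) * X₁ ^ 2 + s.F * (b₁ * b₂) * X₂ ^ 2)) := by
  -- The digits are the exponents of Z₁, Z₂, Y₁, Y₂. Interchanging the waves and conjugating the
  -- poles supplies the monomials that have no identity of their own.
  have h0000 := s.det_coeff_one
  have h0101 := s.swap.det_coeff_Z₁Y₁
  have h0110 := s.swap.det_coeff_Z₁Y₂
  have h0202 := s.swap.det_coeff_Z₁Z₁Y₁Y₁
  have h0211 := s.swap.det_coeff_Z₁Z₁Y₁Y₂
  have h0220 := s.swap.det_coeff_Z₁Z₁Y₂Y₂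
  have h1001 := s.det_coeff_Z₁Y₂
  have h1010 := s.det_coeff_Z₁Y₁
  have h1102 := s.swap.bar.det_coeff_Z₁Z₁Y₁Y₂
  have h1111 := s.det_coeff_Z₁Z₂Y₁Y₂
  have h1120 := s.bar.det_coeff_Z₁Z₁Y₁Y₂
  have h1212 := s.swap.det_coeff_Z₁Z₁Z₂Y₁Y₁Y₂
  have h1221 := s.swap.det_coeff_Z₁Z₁Z₂Y₁Y₂Y₂
  have h2002 := s.det_coeff_Z₁Z₁Y₂Y₂
  have h2011 := s.det_coeff_Z₁Z₁Y₁Y₂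
  have h2020 := s.det_coeff_Z₁Z₁Y₁Y₁
  have h2112 := s.det_coeff_Z₁Z₁Z₂Y₁Y₂Y₂
  have h2121 := s.det_coeff_Z₁Z₁Z₂Y₁Y₁Y₂
  have h2222 := s.det_coeff_Z₁Z₁Z₂Z₂Y₁Y₁Y₂Y₂
  simp only [swap_c₁₁, swap_c₁₂, swap_c₂₁, swap_c₂₂, swap_d₁₁, swap_d₁₂, swap_d₂₂, swap_e₁₁,
    swap_e₁₂, bar_c₁₁, bar_c₁₂, bar_c₂₁, bar_c₂₂, bar_d₁₂, bar_e₁₁, swap_A₁, swap_B₁, swap_B₂,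
    bar_A₁, swap_c₀, bar_c₀, swap_Kp, swap_Km, bar_Km, swap_F, swap_bar_F, swap_H, swap_S,
    ← ha₁, ← ha₂, ← hb₁, ← hb₂]
    at h0101 h0110 h0202 h0211 h0220 h1102 h1120 h1212 h1221 h2002 h2011 h2020 h2112 h2121 h2222
  -- The products w₁v₁ and w₂v₂ are kept until the end, so that each monomial matches exactly one
  -- coefficient identity.
  have key : s.c₀ * (s.lyapunov (a₁ * X₁ * w₁) (a₂ * X₂ * w₂) (b₁ * X₁ * v₁) (b₂ * X₂ * v₂)).det
      = s.Γ / 2 * (1 + X₁ ^ 4 * X₂ ^ 4 * (w₁ * v₁) ^ 2 * (w₂ * v₂) ^ 2)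
        + s.H * (X₁ ^ 4 * (w₁ * v₁) ^ 2 + X₂ ^ 4 * (w₂ * v₂) ^ 2)
        + a₁ * b₁ * X₁ ^ 2 * (w₁ * v₁) * (1 + X₂ ^ 4 * (w₂ * v₂) ^ 2)
        + a₂ * b₂ * X₂ ^ 2 * (w₂ * v₂) * (1 + X₁ ^ 4 * (w₁ * v₁) ^ 2)
        + s.S * X₁ ^ 2 * X₂ ^ 2 * ((w₁ * v₂) ^ 2 + (w₂ * v₁) ^ 2)
        + s.L * (a₁ * b₁ * (a₂ * b₂)) * X₁ ^ 2 * X₂ ^ 2 * (w₁ * v₁) * (w₂ * v₂)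
        - s.Kp * (X₁ * X₂)
          * (w₁ * v₂ * (b₁ * a₂ * X₁ ^ 2 * X₂ ^ 2 * (w₁ * v₁) * (w₂ * v₂) + a₁ * b₂)
          + w₂ * v₁ * (a₁ * b₂ * X₁ ^ 2 * X₂ ^ 2 * (w₁ * v₁) * (w₂ * v₂) + b₁ * a₂))
        + s.Km * (X₁ * X₂) * (w₁ * v₂ * (s.F * (b₁ * b₂) * X₁ ^ 2 * (w₁ * v₁)
            + s.bar.F * (a₁ * a₂) * X₂ ^ 2 * (w₂ * v₂))
          + w₂ * v₁ * (s.bar.F * (a₁ * a₂) * X₁ ^ 2 * (w₁ * v₁)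
            + s.F * (b₁ * b₂) * X₂ ^ 2 * (w₂ * v₂))) := by
    rw [det_fin_four]
    simp only [lyapunov, Matrix.of_apply, Matrix.cons_val', Matrix.cons_val_zero,
      Matrix.cons_val_one, Matrix.cons_val_fin_one, Matrix.cons_val, Fin.isValue]
    linear_combination h0000 + a₂ * b₂ * X₂ ^ 2 * w₂ * v₂ * h0101
      + a₂ * b₁ * X₁ * X₂ * w₂ * v₁ * h0110 + X₂ ^ 4 * w₂ ^ 2 * v₂ ^ 2 * h0202
      + b₁ * b₂ * X₁ * X₂ ^ 3 * w₂ ^ 2 * v₁ * v₂ * h0211 + X₁ ^ 2 * X₂ ^ 2 * w₂ ^ 2 * v₁ ^ 2 * h0220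
      + a₁ * b₂ * X₁ * X₂ * w₁ * v₂ * h1001 + a₁ * b₁ * X₁ ^ 2 * w₁ * v₁ * h1010
      + a₁ * a₂ * X₁ * X₂ ^ 3 * w₁ * w₂ * v₂ ^ 2 * h1102
      + a₁ * a₂ * b₁ * b₂ * X₁ ^ 2 * X₂ ^ 2 * w₁ * w₂ * v₁ * v₂ * h1111
      + a₁ * a₂ * X₁ ^ 3 * X₂ * w₁ * w₂ * v₁ ^ 2 * h1120
      + a₁ * b₁ * X₁ ^ 2 * X₂ ^ 4 * w₁ * w₂ ^ 2 * v₁ * v₂ ^ 2 * h1212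
      + a₁ * b₂ * X₁ ^ 3 * X₂ ^ 3 * w₁ * w₂ ^ 2 * v₁ ^ 2 * v₂ * h1221
      + X₁ ^ 2 * X₂ ^ 2 * w₁ ^ 2 * v₂ ^ 2 * h2002 + b₁ * b₂ * X₁ ^ 3 * X₂ * w₁ ^ 2 * v₁ * v₂ * h2011
      + X₁ ^ 4 * w₁ ^ 2 * v₁ ^ 2 * h2020
      + a₂ * b₁ * X₁ ^ 3 * X₂ ^ 3 * w₁ ^ 2 * w₂ * v₁ * v₂ ^ 2 * h2112
      + a₂ * b₂ * X₁ ^ 4 * X₂ ^ 2 * w₁ ^ 2 * w₂ * v₁ ^ 2 * v₂ * h2121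
      + X₁ ^ 4 * X₂ ^ 4 * w₁ ^ 2 * w₂ ^ 2 * v₁ ^ 2 * v₂ ^ 2 * h2222
  rw [key, hw₁, hw₂]
  ring

/-- Half of the numerator of the Sasa-Satsuma 2-soliton. -/
def halfNumerator (a₁ a₂ b₁ b₂ X₁ X₂ w₁ v₂ : ℂ) : ℂ :=
  s.k₁ * w₁ * (s.h * a₁ * X₁ + s.bar.h * b₁ * X₁ ^ 3 * X₂ ^ 4 + s.g * b₁ * X₁ ^ 3
      + s.bar.g * a₁ * X₁ * X₂ ^ 4 - s.C * b₁ * (a₂ * b₂) * X₁ ^ 3 * X₂ ^ 2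
      - s.bar.C * a₁ * (a₂ * b₂) * X₁ * X₂ ^ 2)
    + w₁ ^ 2 * v₂ * (s.G * a₂ * X₁ ^ 2 * X₂ ^ 3 + s.bar.G * b₂ * X₁ ^ 2 * X₂)

/-- The polarization row of the first component selects rows 0 and 1. The monomials split into two
halves exchanged by `swap`. -/
theorem c₀_mul_num {a₁ a₂ b₁ b₂ w₁ w₂ v₁ v₂ : ℂ} (ha₁ : a₁ ^ 2 = s.A₁) (ha₂ : a₂ ^ 2 = s.A₂)
    (hb₁ : b₁ ^ 2 = s.B₁) (hb₂ : b₂ ^ 2 = s.B₂) (hw₁ : w₁ * v₁ = 1) (hw₂ : w₂ * v₂ = 1)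
    (X₁ X₂ : ℂ) :
    s.c₀ * (((s.lyapunov (a₁ * X₁ * w₁) (a₂ * X₂ * w₂) (b₁ * X₁ * v₁) (b₂ * X₂ * v₂)).updateRow 0
        ![a₁ * X₁ * w₁, a₂ * X₂ * w₂, b₁ * X₁ * v₁, b₂ * X₂ * v₂]).det
      + ((s.lyapunov (a₁ * X₁ * w₁) (a₂ * X₂ * w₂) (b₁ * X₁ * v₁) (b₂ * X₂ * v₂)).updateRow 1
        ![a₁ * X₁ * w₁, a₂ * X₂ * w₂, b₁ * X₁ * v₁, b₂ * X₂ * v₂]).det)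
      = s.halfNumerator a₁ a₂ b₁ b₂ X₁ X₂ w₁ v₂ + s.swap.halfNumerator a₂ a₁ b₂ b₁ X₂ X₁ w₂ v₁ := by
  have h0100 := s.swap.num_coeff_Z₁
  have h0201 := s.swap.num_coeff_Z₁Z₁Y₁
  have h0210 := s.swap.num_coeff_Z₁Z₁Y₂
  have h1000 := s.num_coeff_Z₁
  have h1101 := s.num_coeff_Z₁Z₂Y₂
  have h1110 := s.swap.num_coeff_Z₁Z₂Y₂
  have h1202 := s.num_coeff_Z₁Z₂Z₂Y₂Y₂
  have h1211 := s.swap.num_coeff_Z₁Z₁Z₂Y₁Y₂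
  have h1220 := s.swap.num_coeff_Z₁Z₁Z₂Y₂Y₂
  have h2001 := s.num_coeff_Z₁Z₁Y₂
  have h2010 := s.num_coeff_Z₁Z₁Y₁
  have h2102 := s.num_coeff_Z₁Z₁Z₂Y₂Y₂
  have h2111 := s.num_coeff_Z₁Z₁Z₂Y₁Y₂
  have h2120 := s.swap.num_coeff_Z₁Z₂Z₂Y₂Y₂
  have h2212 := s.num_coeff_Z₁Z₁Z₂Z₂Y₁Y₂Y₂
  have h2221 := s.swap.num_coeff_Z₁Z₁Z₂Z₂Y₁Y₂Y₂
  simp only [swap_c₁₁, swap_c₁₂, swap_c₂₁, swap_c₂₂, swap_d₁₂, swap_d₂₂, swap_e₁₁, swap_e₁₂,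
    swap_e₂₂, swap_A₁, swap_A₂, swap_B₂, swap_c₀, ← ha₁, ← ha₂, ← hb₁, ← hb₂]
    at h0100 h0201 h0210 h1110 h1202 h1211 h1220 h2001 h2010 h2102 h2111 h2120 h2212 h2221
  have key : s.c₀ * (((s.lyapunov (a₁ * X₁ * w₁) (a₂ * X₂ * w₂) (b₁ * X₁ * v₁)
          (b₂ * X₂ * v₂)).updateRow 0
        ![a₁ * X₁ * w₁, a₂ * X₂ * w₂, b₁ * X₁ * v₁, b₂ * X₂ * v₂]).det
      + ((s.lyapunov (a₁ * X₁ * w₁) (a₂ * X₂ * w₂) (b₁ * X₁ * v₁) (b₂ * X₂ * v₂)).updateRow 1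
        ![a₁ * X₁ * w₁, a₂ * X₂ * w₂, b₁ * X₁ * v₁, b₂ * X₂ * v₂]).det)
      = s.k₁ * w₁ * (s.h * a₁ * X₁ + s.bar.h * b₁ * X₁ ^ 3 * X₂ ^ 4 * (w₁ * v₁) * (w₂ * v₂) ^ 2
          + s.g * b₁ * X₁ ^ 3 * (w₁ * v₁)
          + s.bar.g * a₁ * X₁ * X₂ ^ 4 * (w₂ * v₂) ^ 2
          - s.C * b₁ * (a₂ * b₂) * X₁ ^ 3 * X₂ ^ 2 * (w₁ * v₁) * (w₂ * v₂)
          - s.bar.C * a₁ * (a₂ * b₂) * X₁ * X₂ ^ 2 * (w₂ * v₂))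
        + w₁ ^ 2 * v₂ * (s.G * a₂ * X₁ ^ 2 * X₂ ^ 3 * (w₂ * v₂) + s.bar.G * b₂ * X₁ ^ 2 * X₂)
        + (s.swap.k₁ * w₂ * (s.swap.h * a₂ * X₂ + s.swap.bar.h * b₂ * X₂ ^ 3 * X₁ ^ 4
            * (w₂ * v₂) * (w₁ * v₁) ^ 2
          + s.swap.g * b₂ * X₂ ^ 3 * (w₂ * v₂)
          + s.swap.bar.g * a₂ * X₂ * X₁ ^ 4 * (w₁ * v₁) ^ 2
          - s.swap.C * b₂ * (a₁ * b₁) * X₂ ^ 3 * X₁ ^ 2 * (w₂ * v₂) * (w₁ * v₁)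
          - s.swap.bar.C * a₂ * (a₁ * b₁) * X₂ * X₁ ^ 2 * (w₁ * v₁))
        + w₂ ^ 2 * v₁ * (s.swap.G * a₁ * X₂ ^ 2 * X₁ ^ 3 * (w₁ * v₁)
          + s.swap.bar.G * b₁ * X₂ ^ 2 * X₁)) := by
    rw [det_fin_four, det_fin_four]
    simp only [lyapunov, Matrix.updateRow_apply, Matrix.of_apply, Matrix.cons_val',
      Matrix.cons_val_zero, Matrix.cons_val_one, Matrix.cons_val_fin_one, Matrix.cons_val,
      Fin.isValue, if_true, Fin.reduceEq, if_false]
    linear_combination a₂ * X₂ * w₂ * h0100 + b₂ * X₂ ^ 3 * w₂ ^ 2 * v₂ * h0201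
      + b₁ * X₁ * X₂ ^ 2 * w₂ ^ 2 * v₁ * h0210 + a₁ * X₁ * w₁ * h1000
      + a₁ * a₂ * b₂ * X₁ * X₂ ^ 2 * w₁ * w₂ * v₂ * h1101
      + a₁ * a₂ * b₁ * X₁ ^ 2 * X₂ * w₁ * w₂ * v₁ * h1110
      + a₁ * X₁ * X₂ ^ 4 * w₁ * w₂ ^ 2 * v₂ ^ 2 * h1202
      + a₁ * b₁ * b₂ * X₁ ^ 2 * X₂ ^ 3 * w₁ * w₂ ^ 2 * v₁ * v₂ * h1211
      + a₁ * X₁ ^ 3 * X₂ ^ 2 * w₁ * w₂ ^ 2 * v₁ ^ 2 * h1220 + b₂ * X₁ ^ 2 * X₂ * w₁ ^ 2 * v₂ * h2001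
      + b₁ * X₁ ^ 3 * w₁ ^ 2 * v₁ * h2010 + a₂ * X₁ ^ 2 * X₂ ^ 3 * w₁ ^ 2 * w₂ * v₂ ^ 2 * h2102
      + a₂ * b₁ * b₂ * X₁ ^ 3 * X₂ ^ 2 * w₁ ^ 2 * w₂ * v₁ * v₂ * h2111
      + a₂ * X₁ ^ 4 * X₂ * w₁ ^ 2 * w₂ * v₁ ^ 2 * h2120
      + b₁ * X₁ ^ 3 * X₂ ^ 4 * w₁ ^ 2 * w₂ ^ 2 * v₁ * v₂ ^ 2 * h2212
      + b₂ * X₁ ^ 4 * X₂ ^ 3 * w₁ ^ 2 * w₂ ^ 2 * v₁ ^ 2 * v₂ * h2221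
  rw [key, hw₁, hw₂, halfNumerator, halfNumerator]
  ring

end PolePair

namespace Params

/-! ### Interchange of the two waves -/

/-- The parameters with the two waves interchanged. -/
def swap (p : Params) : Params where
  c₁ := p.c₂
  c₂ := p.c₁
  ν₁ := p.ν₂
  ν₂ := p.ν₁
  φ₁ := p.φ₂
  φ₂ := p.φ₁

variable (p : Params)

theorem swap_Ω : p.swap.Ω = p.Ω := by
  change √(((p.k₂ + p.k₁) ^ 2 + (p.κ₂ + p.κ₁) ^ 2) * ((p.k₂ - p.k₁) ^ 2 + (p.κ₂ + p.κ₁) ^ 2)) = _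
  rw [Ω]; congr 1; ring

theorem swap_Υ : p.swap.Υ = p.Υ := by
  change ((p.k₂ - p.k₁) ^ 2 + (p.κ₂ - p.κ₁) ^ 2) * ((p.k₂ + p.k₁) ^ 2 + (p.κ₂ - p.κ₁) ^ 2) = _
  rw [Υ]; ring

theorem swap_Δ : p.swap.Δ = p.Δ := by
  change √(((p.k₂ - p.k₁) ^ 2 + (p.κ₂ + p.κ₁) ^ 2) / ((p.k₂ + p.k₁) ^ 2 + (p.κ₂ + p.κ₁) ^ 2)) = _
  rw [Δ]; congr 2 <;> ring

theorem swap_Γ : p.swap.Γ = p.Γ := by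
  change ((p.k₂ - p.k₁) ^ 2 + (p.κ₂ - p.κ₁) ^ 2) / ((p.k₂ + p.k₁) ^ 2 + (p.κ₂ - p.κ₁) ^ 2) = _
  rw [Γ]; congr 1 <;> ring

theorem swap_s : p.swap.s = p.s := by
  change (if 0 ≤ p.κ₂ + p.κ₁ then (1 : ℝ) else -1) = _
  rw [s, add_comm]

theorem swap_γ₁ : p.swap.γ₁ = p.γ₂ := by
  change Complex.arg ⟨p.k₂ ^ 2 - p.k₁ ^ 2 - (p.κ₂ - p.κ₁) ^ 2, 2 * p.k₂ * (p.κ₂ - p.κ₁)⟩ = _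
  rw [γ₂]; congr 2 <;> ring

theorem swap_γ₂ : p.swap.γ₂ = p.γ₁ := by
  change Complex.arg ⟨p.k₁ ^ 2 - p.k₂ ^ 2 - (p.κ₂ - p.κ₁) ^ 2, -(2 * p.k₁ * (p.κ₂ - p.κ₁))⟩ = _
  rw [γ₁]; congr 2 <;> ring

theorem swap_δ₁ : p.swap.δ₁ = p.δ₂ := by
  change Complex.arg ⟨p.k₁ ^ 2 - p.k₂ ^ 2 + (p.κ₂ + p.κ₁) ^ 2, 2 * p.k₂ * (p.κ₂ + p.κ₁)⟩ = _
  rw [δ₂, add_comm p.κ₂]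

theorem swap_δ₂ : p.swap.δ₂ = p.δ₁ := by
  change Complex.arg ⟨p.k₂ ^ 2 - p.k₁ ^ 2 + (p.κ₂ + p.κ₁) ^ 2, 2 * p.k₁ * (p.κ₂ + p.κ₁)⟩ = _
  rw [δ₁, add_comm p.κ₂]

theorem swap_ϖ₁ : p.swap.ϖ₁ = p.ϖ₂ := by
  rw [ϖ₁, ϖ₂, swap_δ₁]; rfl
theorem swap_ϖ₂ : p.swap.ϖ₂ = p.ϖ₁ := by
  rw [ϖ₁, ϖ₂, swap_δ₂]; rfl
theorem swap_α₂ : p.swap.α₂ = p.α₁ := by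
  rw [α₁, α₂, swap_δ₂]; rfl
theorem swap_υ₂ : p.swap.υ₂ = p.υ₁ := by
  rw [υ₁, υ₂, swap_δ₂]; rfl

theorem swap_μ : p.swap.μ = p.μ := by
  change (p.ν₂ - p.ν₁) / (p.c₂ - p.c₁) = _
  rw [μ, ← neg_sub p.ν₁, ← neg_sub p.c₁, neg_div_neg_eq]

theorem swap_θ (ξ₁ ξ₂ : ℝ) : p.swap.θ ξ₂ ξ₁ = -p.θ ξ₁ ξ₂ := by
  rw [θ, θ, swap_μ]
  change p.κ₂ * ξ₂ - p.κ₁ * ξ₁ + p.μ * (ξ₁ - ξ₂) + p.φ₂ - p.φ₁ = _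
  ring

theorem swap_VS₁ (ξ₁ ξ₂ : ℝ) : p.swap.VS₁ ξ₂ ξ₁ = p.VS₂ ξ₁ ξ₂ := by
  rw [VS₁, VS₂, swap_Ω, swap_Υ, swap_Δ, swap_Γ, swap_s, swap_γ₁, swap_γ₂, swap_ϖ₁, swap_ϖ₂,
    swap_α₂, swap_υ₂, swap_θ, ← mul_comm p.k₂ p.k₁]
  rfl

variable {p}

theorem Regular.swap (h : p.Regular) : p.swap.Regular where
  k₁_pos := h.k₂_pos
  k₂_pos := h.k₁_pos
  κ₁_ne := h.κ₂_ne
  κ₂_ne := h.κ₁_ne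
  ne := h.ne.symm
  ne_conj := fun e => h.ne_conj (by
    have := congrArg conj e
    rw [Complex.conj_conj] at this
    exact this.symm)

theorem conj_sub_self_ne {l : ℂ} (hl : l.im ≠ 0) : l - conj l ≠ 0 := fun e => hl (by
  have := congrArg Complex.im e
  simp only [Complex.sub_im, Complex.conj_im, Complex.zero_im] at this
  linarith)

/-- The poles of the Sasa-Satsuma 2-soliton and their conjugates. -/
def poles (h : p.Regular) : PolePair where
  l₁ := p.l₁
  l₂ := p.l₂
  m₁ := conj p.l₁
  m₂ := conj p.l₂
  l₁_ne := h.l₁_ne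
  l₂_ne := h.l₂_ne
  m₁_ne := (map_ne_zero _).mpr h.l₁_ne
  m₂_ne := (map_ne_zero _).mpr h.l₂_ne
  add₁₁ := conj_l₁_add_l₁_ne h
  add₁₂ := conj_l₁_add_l₂_ne h
  add₂₁ := conj_l₂_add_l₁_ne h
  add₂₂ := conj_l₂_add_l₂_ne h
  add_l := h.add_ne
  add_m := by rw [← map_add]; exact (map_ne_zero _).mpr h.add_ne
  sub₁₁ := conj_sub_self_ne h.κ₁_ne
  sub₁₂ := sub_ne_zero.mpr h.swap.ne_conj
  sub₂₁ := sub_ne_zero.mpr h.ne_conj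
  sub₂₂ := conj_sub_self_ne h.κ₂_ne
  sub_l := sub_ne h
  sub_m := conj_sub_ne h

/-- Holding by definition, this transfers every statement about the first wave to the second. -/
theorem poles_swap (h : p.Regular) : poles h.swap = (poles h).swap := rfl

/-! ### Square roots and amplitudes -/

theorem Δ_pos (h : p.Regular) : 0 < p.Δ := by
  rw [Δ_eq]
  exact div_pos (norm_pos_iff.mpr (sub_ne_zero.mpr h.ne_conj)) (norm_pos_iff.mpr h.add_ne)

theorem Γ_pos (h : p.Regular) : 0 < p.Γ := by
  rw [Γ_eq]
  exact pow_pos (div_pos (norm_pos_iff.mpr (sub_ne h)) (norm_pos_iff.mpr h.add_conj_ne)) 2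

theorem Υ_pos (h : p.Regular) : 0 < p.Υ := by
  rw [Υ_eq]
  exact pow_pos (mul_pos (norm_pos_iff.mpr (sub_ne h)) (norm_pos_iff.mpr h.add_conj_ne)) 2

theorem Ω_eq_Δ (h : p.Regular) : p.Ω = ‖p.l₁ + p.l₂‖ ^ 2 * p.Δ := by
  have := norm_ne_zero_iff.mpr h.add_ne
  rw [Ω_eq, Δ_eq]; field_simp

theorem sqrt_Ω (h : p.Regular) : √p.Ω = ‖p.l₁ + p.l₂‖ * √p.Δ := by
  rw [Ω_eq_Δ h, Real.sqrt_mul (by positivity), Real.sqrt_sq (norm_nonneg _)]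

theorem sqrt_abs_two_mul (κ : ℝ) : √|2 * κ| = √2 * √|κ| := by
  rw [abs_mul, abs_two, Real.sqrt_mul zero_le_two]

theorem sqrt_eight : √8 = 2 * √2 := by
  rw [show (8 : ℝ) = 2 ^ 2 * 2 by norm_num, Real.sqrt_mul (by norm_num),
    Real.sqrt_sq (by norm_num)]

theorem sqrt_abs_eight_mul (κ : ℝ) : √|8 * κ| = 2 * √2 * √|κ| := by
  rw [abs_mul, abs_of_pos (by norm_num : (0 : ℝ) < 8), Real.sqrt_mul (by norm_num), sqrt_eight]

theorem sqrt_abs_thirtyTwo_mul (κ : ℝ) : √|32 * κ| = 2 * √|8 * κ| := by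
  rw [show 32 * κ = 4 * (8 * κ) by ring, abs_mul, abs_of_pos (by norm_num : (0 : ℝ) < 4),
    Real.sqrt_mul (by norm_num), show (4 : ℝ) = 2 ^ 2 by norm_num, Real.sqrt_sq (by norm_num)]

/-- The complex amplitude of the first wave of the Sasa-Satsuma 2-soliton. -/
def a₁ (p : Params) : ℂ := sasaFactor p.k₁ p.κ₁ * ((√p.Δ)⁻¹ : ℝ) * (expI (p.δ₂ / 2))⁻¹
/-- The complex amplitude of the second wave of the Sasa-Satsuma 2-soliton. -/
def a₂ (p : Params) : ℂ := sasaFactor p.k₂ p.κ₂ * ((√p.Δ)⁻¹ : ℝ) * (expI (p.δ₁ / 2))⁻¹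

theorem swap_a₁ (p : Params) : p.swap.a₁ = p.a₂ := by
  rw [a₁, a₂, swap_Δ, swap_δ₂]; rfl

theorem swap_a₂ (p : Params) : p.swap.a₂ = p.a₁ := by
  rw [a₁, a₂, swap_Δ, swap_δ₁]; rfl

theorem sqrt_Δ_ne (h : p.Regular) : (√p.Δ : ℂ) ≠ 0 :=
  Complex.ofReal_ne_zero.mpr (Real.sqrt_pos.mpr (Δ_pos h)).ne'

theorem sqrt_Δ_sq (h : p.Regular) : (√p.Δ : ℂ) ^ 2 = p.Δ := ofReal_sqrt_sq (Δ_pos h).le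

theorem a₁_ne (h : p.Regular) : p.a₁ ≠ 0 :=
  mul_ne_zero (mul_ne_zero (sasaFactor_ne h.κ₁_ne)
    (by rw [Complex.ofReal_inv]; exact inv_ne_zero (sqrt_Δ_ne h))) (inv_ne_zero (expI_ne_zero _))

/-- The modulus Ω equals |l₁ + l₂|²Δ, so e^{iδ₂} = (l₁ - l̄₂)/((l₁ + l₂)Δ). This trades an inverse
half-angle for the half-angle in `sqrt_r₁_mul`. -/
theorem expI_half_δ₂_inv (h : p.Regular) :
    (expI (p.δ₂ / 2))⁻¹
      = (√p.Δ : ℂ) ^ 2 * ((p.l₁ + p.l₂) / (p.l₁ - conj p.l₂)) * expI (p.δ₂ / 2) := by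
  have h1 := expI_half_sq p.δ₂
  have h0 := expI_ne_zero (p.δ₂ / 2)
  have hs := (poles h).sub₂₁
  change p.l₁ - conj p.l₂ ≠ 0 at hs
  have hn : (‖p.l₁ + p.l₂‖ : ℂ) ≠ 0 := by exact_mod_cast norm_ne_zero_iff.mpr h.add_ne
  have hΔ := Complex.ofReal_ne_zero.mpr (Δ_pos h).ne'
  have hn2 := norm_sq_eq (p.l₁ + p.l₂)
  rw [map_add] at hn2
  rw [expI_δ₂ h, Ω_eq_Δ h] at h1
  push_cast at h1
  rw [eq_div_iff (mul_ne_zero (pow_ne_zero 2 hn) hΔ)] at h1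
  rw [sqrt_Δ_sq h, inv_eq_iff_eq_inv, ← one_div, eq_div_iff (by
    refine mul_ne_zero (mul_ne_zero hΔ (div_ne_zero h.add_ne hs)) h0)]
  field_simp
  have hm := (poles h).add_m
  change conj p.l₁ + conj p.l₂ ≠ 0 at hm
  refine mul_right_cancel₀ hm ?_
  linear_combination h1 - expI (p.δ₂ / 2) ^ 2 * p.Δ * hn2

/-- The 1-soliton factor contributes 2l₁/(l₁ - l̄₁), and the correction by Δ and δ₂ contributes (l₁
+ l₂)/(l₁ - l̄₂), the effect of the other wave. -/
theorem a₁_sq (h : p.Regular) : p.a₁ ^ 2 = (poles h).A₁ := by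
  have h1 : sasaFactor p.k₁ p.κ₁ ^ 2 * (p.l₁ - conj p.l₁) = 2 * p.l₁ := sasaFactor_sq h.κ₁_ne
  have h0 := expI_ne_zero (p.δ₂ / 2)
  have hD := sqrt_Δ_ne h
  have hs : p.l₁ - conj p.l₂ ≠ 0 := (poles h).sub₂₁
  have hs' : p.l₁ - conj p.l₁ ≠ 0 := (poles h).sub₁₁
  have h2 : (expI (p.δ₂ / 2))⁻¹ ^ 2 = (√p.Δ : ℂ) ^ 2 * ((p.l₁ + p.l₂) / (p.l₁ - conj p.l₂)) := by
    rw [sq]; nth_rewrite 1 [expI_half_δ₂_inv h]; field_simp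
  rw [a₁, mul_pow, mul_pow, h2, PolePair.A₁]
  change _ = 2 * p.l₁ * (p.l₁ + p.l₂) / ((p.l₁ - conj p.l₁) * (p.l₁ - conj p.l₂))
  push_cast
  field_simp
  linear_combination (p.l₁ + p.l₂) * h1

theorem a₂_sq (h : p.Regular) : p.a₂ ^ 2 = (poles h).A₂ := by
  rw [← swap_a₁, a₁_sq h.swap, poles_swap, PolePair.swap_A₁]

theorem conj_a₁_sq (h : p.Regular) : conj p.a₁ ^ 2 = (poles h).B₁ := by
  rw [← map_pow, a₁_sq h, ← PolePair.bar_A₁]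
  simp [PolePair.A₁, poles, PolePair.bar, Complex.conj_ofNat]

theorem conj_a₂_sq (h : p.Regular) : conj p.a₂ ^ 2 = (poles h).B₂ := by
  rw [← map_pow, a₂_sq h, ← PolePair.bar_A₂]
  simp [PolePair.A₂, poles, PolePair.bar, Complex.conj_ofNat]

theorem a₁_mul_conj (h : p.Regular) :
    (|p.κ₁| : ℝ) * (√p.Δ : ℂ) ^ 2 * (p.a₁ * conj p.a₁) = p.r₁ := by
  have h1 : _ = ((‖p.l₁‖ / |p.κ₁| : ℝ) : ℂ) := sasaFactor_mul_conj (k := p.k₁) (κ := p.κ₁)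
  have h0 := expI_ne_zero (p.δ₂ / 2)
  have hD := sqrt_Δ_ne h
  have hκ : ((|p.κ₁| : ℝ) : ℂ) ≠ 0 := Complex.ofReal_ne_zero.mpr (abs_ne_zero.mpr h.κ₁_ne)
  rw [a₁, map_mul, map_mul, map_inv₀, conj_expI, Complex.conj_ofReal, r₁_eq]
  push_cast at h1 ⊢
  rw [eq_div_iff hκ] at h1
  field_simp
  linear_combination h1

theorem a₂_mul_conj (h : p.Regular) :
    (|p.κ₂| : ℝ) * (√p.Δ : ℂ) ^ 2 * (p.a₂ * conj p.a₂) = p.r₂ := by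
  have := a₁_mul_conj h.swap
  rw [swap_a₁, swap_Δ] at this
  exact this

/-- The dictionary between half-angles and amplitudes: λ₁ is the phase built into `sasaFactor` and
δ₂ the correction in `a₁`. -/
theorem sqrt_r₁_mul (h : p.Regular) :
    (√p.r₁ : ℂ) * (expI (p.lam₁ / 2) * expI (p.δ₂ / 2)) = conj p.a₁ * (√|p.κ₁| : ℝ) * √p.Δ := by
  have hD := sqrt_Δ_ne h
  have hκ : (√|p.κ₁| : ℂ) ≠ 0 :=
    Complex.ofReal_ne_zero.mpr (Real.sqrt_pos.mpr (abs_pos.mpr h.κ₁_ne)).ne'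
  have h0 := expI_ne_zero (p.δ₂ / 2)
  rw [a₁, sasaFactor, map_mul, map_mul, map_mul, map_inv₀, conj_expI, conj_expI,
    Complex.conj_ofReal, Complex.conj_ofReal, inv_inv, expI_neg, inv_inv,
    Real.sqrt_div (norm_nonneg _), r₁_eq]
  change _ * (expI (Complex.arg _ / 2) * _) = _
  push_cast
  field_simp
  exact mul_comm _ _

theorem sqrt_r₂_mul (h : p.Regular) :
    (√p.r₂ : ℂ) * (expI (p.lam₂ / 2) * expI (p.δ₁ / 2)) = conj p.a₂ * (√|p.κ₂| : ℝ) * √p.Δ := by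
  have := sqrt_r₁_mul h.swap
  rw [swap_a₁, swap_Δ, swap_δ₂] at this
  exact this

theorem sqrt_r₂_mul_inv (h : p.Regular) :
    (√p.r₂ : ℂ) * ((expI (p.lam₂ / 2))⁻¹ * (expI (p.δ₁ / 2))⁻¹) = p.a₂ * (√|p.κ₂| : ℝ) * √p.Δ := by
  have := congrArg conj (sqrt_r₂_mul h)
  simpa only [map_mul, conj_expI, Complex.conj_ofReal, Complex.conj_conj] using this

/-- The normalization of the denominator of the Sasa-Satsuma 2-soliton. -/
def weight (p : Params) : ℝ := |p.κ₁| * |p.κ₂| * √p.Δ ^ 2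

theorem swap_weight (p : Params) : p.swap.weight = p.weight := by
  rw [weight, weight, swap_Δ, mul_comm |p.κ₁|]; rfl

/-- A real prefactor with a phase becomes one complex coefficient and its conjugate. Matching U for
each cosh in the formulas therefore settles two exponentials at once. -/
theorem mul_coshI {c P : ℝ} {b : ℝ} {U : ℂ} (h : (c : ℂ) * expI b = P * U) (a : ℝ) :
    (c : ℂ) * coshI a b = P / 2 * (U * Complex.exp a + conj U * (Complex.exp a)⁻¹) := by
  have h' := congrArg conj h
  rw [map_mul, map_mul, conj_expI, Complex.conj_ofReal, Complex.conj_ofReal] at h'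
  rw [coshI_eq]
  linear_combination Complex.exp a / 2 * h + (Complex.exp a)⁻¹ / 2 * h'

end Params

namespace Params

variable {p : Params}

/-! ### The numerator of the Sasa-Satsuma 2-soliton -/

theorem conj_poles_h (h : p.Regular) : conj (poles h).bar.h = (poles h).h := by
  simp [PolePair.h, poles, PolePair.bar]

theorem conj_poles_g (h : p.Regular) : conj (poles h).g = (poles h).bar.g := by
  simp [PolePair.g, poles, PolePair.bar]

theorem conj_poles_C (h : p.Regular) : conj (poles h).C = (poles h).bar.C := by
  simp [PolePair.C, PolePair.h, PolePair.Γ, PolePair.Δsq, PolePair.k₂, poles, PolePair.bar,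
    Complex.conj_ofNat]

theorem conj_poles_G (h : p.Regular) : conj (poles h).G = (poles h).bar.G := by
  simp [PolePair.G, PolePair.k₁, PolePair.k₂, poles, PolePair.bar, Complex.conj_ofNat]

theorem sqrt_Γ_mul_γ₂ (h : p.Regular) : (√p.Γ : ℂ) * expI p.γ₂ = -(poles h).bar.h := by
  rw [sqrt_Γ_mul_expI_γ₂ h, neg_div, PolePair.h]
  simp only [poles, PolePair.bar, add_comm]

theorem sqrt_Γ_mul_γ₂_inv (h : p.Regular) : (√p.Γ : ℂ) * (expI p.γ₂)⁻¹ = -(poles h).h := by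
  rw [sqrt_Γ_div_expI_γ₂ h, neg_div]; rfl

theorem poles_Γ (h : p.Regular) : (poles h).Γ = p.Γ := Γ_eq_complex.symm

theorem norm_add_sq : (‖p.l₁ + p.l₂‖ : ℂ) ^ 2 = (p.l₁ + p.l₂) * (conj p.l₁ + conj p.l₂) := by
  rw [norm_sq_eq, map_add]

theorem poles_Δsq (h : p.Regular) : (poles h).Δsq = (√p.Δ : ℂ) ^ 4 := by
  have hm : conj p.l₁ + conj p.l₂ ≠ 0 := (poles h).add_m
  have hl := h.add_ne
  have e : (√p.Δ : ℂ) ^ 4 = (p.Δ : ℂ) ^ 2 := by rw [← sqrt_Δ_sq h]; ring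
  rw [e, Δ_eq]
  push_cast
  rw [div_pow, norm_add_sq, norm_sq_eq, map_sub, Complex.conj_conj]
  simp only [PolePair.Δsq, poles]
  congr 1; ring

theorem sign_mul_self (κ : ℝ) : Real.sign κ * κ = |κ| := by
  rcases lt_trichotomy κ 0 with hk | hk | hk
  · rw [Real.sign_of_neg hk, abs_of_neg hk]; ring
  · simp [hk]
  · rw [Real.sign_of_pos hk, abs_of_pos hk]; ring

theorem s_sq : (p.s : ℂ) ^ 2 = 1 := by rw [s]; split_ifs <;> norm_num

/-- Converts δ₁ into δ₂ at the cost of the sign s; this is how the branch of the half-angles enters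
the coefficients. -/
theorem expI_half_δ_mul_inv (h : p.Regular) :
    (expI (p.δ₁ / 2))⁻¹
      = -(Complex.I * p.s * ‖p.l₁ + p.l₂‖ / (conj p.l₁ + conj p.l₂)) * expI (p.δ₂ / 2) := by
  have h1 := expI_half_δ_mul h
  have hm : conj p.l₁ + conj p.l₂ ≠ 0 := (poles h).add_m
  have hn : (‖p.l₁ + p.l₂‖ : ℂ) ≠ 0 := by exact_mod_cast norm_ne_zero_iff.mpr h.add_ne
  have hs : (p.s : ℂ) ^ 2 = 1 := by rw [s]; split_ifs <;> norm_num
  have h0 := expI_ne_zero (p.δ₁ / 2)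
  rw [eq_div_iff hn] at h1
  rw [inv_eq_iff_eq_inv, ← one_div, eq_div_iff (mul_ne_zero (neg_ne_zero.mpr (div_ne_zero
    (mul_ne_zero (mul_ne_zero Complex.I_ne_zero (by intro e; simp [e] at hs)) hn) hm))
    (expI_ne_zero _))]
  field_simp
  linear_combination (-Complex.I * p.s) * h1
    - (conj p.l₁ + conj p.l₂) * (Complex.I ^ 2 * hs + Complex.I_sq)

theorem sq_sqrt_abs (κ : ℝ) : (√|κ| : ℂ) ^ 2 = (|κ| : ℝ) := ofReal_sqrt_sq (abs_nonneg κ)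

theorem Ω_nonneg : 0 ≤ p.Ω := Real.sqrt_nonneg _

theorem expI_sub_eq_mul_inv (a b : ℝ) : expI (a - b) = expI a * (expI b)⁻¹ := by
  rw [expI_sub, div_eq_mul_inv]

theorem poles_k₁ (h : p.Regular) : (poles h).k₁ = p.k₁ := by
  change (p.l₁ + conj p.l₁) / 2 = _
  rw [← two_k₁]; ring

theorem poles_k₂ (h : p.Regular) : (poles h).k₂ = p.k₂ := by
  change (p.l₂ + conj p.l₂) / 2 = _
  rw [← two_k₂]; ring

theorem sqrt_Υ_ne (h : p.Regular) : (√p.Υ : ℂ) ≠ 0 :=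
  Complex.ofReal_ne_zero.mpr (Real.sqrt_pos.mpr (Υ_pos h)).ne'

theorem poles_Υ (h : p.Regular) : (poles h).Υ = p.Υ := by
  rw [Υ_eq]
  push_cast
  rw [mul_pow, norm_sq_eq, norm_sq_eq, map_sub, map_add, Complex.conj_conj]
  simp only [PolePair.Υ, poles]
  ring

theorem sqrt_Υ_sq (h : p.Regular) : (√p.Υ : ℂ) ^ 2 = (poles h).Υ := by
  rw [poles_Υ]; exact ofReal_sqrt_sq (Υ_pos h).le

theorem expI_γ₁_div (h : p.Regular) :
    expI p.γ₁ * (√p.Υ : ℂ)⁻¹ = ((conj p.l₁ - conj p.l₂) * (conj p.l₁ + p.l₂))⁻¹ := by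
  have hΥ := sqrt_Υ_ne h
  have hsq := sqrt_Υ_sq h
  have h1 : p.l₁ - p.l₂ ≠ 0 := (poles h).sub_l
  have h2 : conj p.l₁ - conj p.l₂ ≠ 0 := (poles h).sub_m
  have h3 : conj p.l₁ + p.l₂ ≠ 0 := (poles h).add₁₂
  rw [expI_γ₁ h]
  field_simp
  rw [hsq]
  simp only [PolePair.Υ, poles]
  ring

theorem expI_γ₂_div (h : p.Regular) :
    expI p.γ₂ * (√p.Υ : ℂ)⁻¹ = -((conj p.l₁ - conj p.l₂) * (conj p.l₂ + p.l₁))⁻¹ := by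
  have hΥ := sqrt_Υ_ne h
  have hsq := sqrt_Υ_sq h
  have h1 : p.l₁ - p.l₂ ≠ 0 := (poles h).sub_l
  have h2 : conj p.l₁ - conj p.l₂ ≠ 0 := (poles h).sub_m
  have h3 : conj p.l₂ + p.l₁ ≠ 0 := (poles h).add₂₁
  rw [expI_γ₂ h]
  field_simp
  rw [hsq]
  simp only [PolePair.Υ, poles]
  ring

/-- The first of six identifications, one for each type of cosh in V₁. The angles are split into
λ₁/2, δ₂/2 and γ, grouped with their radicals, and replaced by amplitudes and rational functions of
the poles. -/
theorem coeff_sum_phase (h : p.Regular) :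
    ((√p.r₁ * √|2 * p.κ₁| * |p.κ₂| * √(p.Δ * p.Γ) : ℝ) : ℂ) * expI (p.α₂ + p.γ₂)
      = (√2 * p.weight : ℝ) * (-(poles h).bar.h * conj p.a₁) := by
  have hr := sqrt_r₁_mul h
  have hγ := sqrt_Γ_mul_γ₂ h
  have hκ := sq_sqrt_abs p.κ₁
  rw [expI_add, α₂, add_div, expI_add, sqrt_abs_two_mul, Real.sqrt_mul (Δ_pos h).le, weight]
  push_cast
  linear_combination (√2 * (√|p.κ₁| : ℝ) * (|p.κ₂| : ℝ) * √p.Δ * √p.Γ * expI p.γ₂ : ℂ) * hr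
    + (√2 * (√|p.κ₁| : ℝ) ^ 2 * (|p.κ₂| : ℝ) * √p.Δ ^ 2 * conj p.a₁ : ℂ) * hγ
    - (√2 * (|p.κ₂| : ℝ) * √p.Δ ^ 2 * conj p.a₁ * (poles h).bar.h : ℂ) * hκ

theorem coeff_diff_phase (h : p.Regular) :
    ((√p.r₁ * √|2 * p.κ₁| * |p.κ₂| * (1 / √(p.Δ * p.Γ)) : ℝ) : ℂ) * expI (p.υ₂ - p.γ₂)
      = (√2 * p.weight : ℝ) * (-(poles h).g * conj p.a₁) := by
  have hr := sqrt_r₁_mul h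
  have hγ := sqrt_Γ_mul_γ₂_inv h
  have hκ := sq_sqrt_abs p.κ₁
  have hδ := expI_half_δ₂_inv h
  have hD := sqrt_Δ_ne h
  have hG := sqrt_Γ_ne h
  -- Reversing the half-angle δ₂/2 leaves (l₁ + l₂)/(l₁ - l̄₂), which combines with e^{-iγ₂} into
  -- the coefficient g.
  have hg : (p.l₁ + p.l₂) / (p.l₁ - conj p.l₂) * (expI p.γ₂)⁻¹ = -(√p.Γ * (poles h).g) := by
    refine mul_left_cancel₀ hG ?_
    have hs := (poles h).sub₂₁
    have hl := (poles h).sub_l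
    have hm := (poles h).sub_m
    have h1 := (poles h).add₁₂
    have h2 := (poles h).add₂₁
    have e : (√p.Γ : ℂ) * (-(√p.Γ * (poles h).g)) = -((poles h).Γ * (poles h).g) := by
      rw [poles_Γ, ← sqrt_Γ_mul_self]; ring
    have e2 : (p.l₁ + p.l₂) / (p.l₁ - conj p.l₂) * (poles h).h = (poles h).Γ * (poles h).g := by
      simp only [PolePair.h, PolePair.Γ, PolePair.g]
      change ((poles h).l₁ + (poles h).l₂) / ((poles h).l₁ - (poles h).m₂) * _ = _
      field_simp
    rw [e, ← e2]
    linear_combination ((p.l₁ + p.l₂) / (p.l₁ - conj p.l₂)) * hγ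
  rw [expI_sub_eq_mul_inv, υ₂, sub_div, expI_sub_eq_mul_inv, hδ, sqrt_abs_two_mul,
    Real.sqrt_mul (Δ_pos h).le, weight]
  push_cast
  rw [one_div, mul_inv]
  have hD' : (√p.Δ : ℂ) * (√p.Δ : ℂ)⁻¹ = 1 := mul_inv_cancel₀ hD
  have hG' : (√p.Γ : ℂ) * (√p.Γ : ℂ)⁻¹ = 1 := mul_inv_cancel₀ hG
  set D : ℂ := (√p.Δ : ℂ)
  set iD : ℂ := (√p.Δ : ℂ)⁻¹
  set iG : ℂ := (√p.Γ : ℂ)⁻¹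
  set E : ℂ := (p.l₁ + p.l₂) / (p.l₁ - conj p.l₂)
  linear_combination (√2 * (√|p.κ₁| : ℝ) * (|p.κ₂| : ℝ) * iD * iG * (D ^ 2 * E)
      * (expI p.γ₂)⁻¹ : ℂ) * hr
    + (√2 * (√|p.κ₁| : ℝ) ^ 2 * (|p.κ₂| : ℝ) * conj p.a₁ * iD * iG * D ^ 3 : ℂ) * hg
    - (√2 * (√|p.κ₁| : ℝ) ^ 2 * (|p.κ₂| : ℝ) * conj p.a₁ * D ^ 2 * (poles h).g : ℂ)
      * (iG * √p.Γ * hD' + hG')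
    - (√2 * (|p.κ₂| : ℝ) * D ^ 2 * conj p.a₁ * (poles h).g : ℂ) * hκ

/-- Here ϖ₁ contains δ₁, while the amplitude requires δ₂. The conversion produces a second factor s,
which cancels the one in the prefactor. -/
theorem coeff_resonant (h : p.Regular) :
    ((√p.r₁ * √|2 * p.κ₁| * p.r₂ * (-8 * p.k₂ ^ 2 * p.κ₂ * p.s * (1 / √(p.Ω * p.Υ))) : ℝ) : ℂ)
        * expI (p.ϖ₁ + p.γ₁)
      = (√2 * p.weight : ℝ) * (4 * p.k₂ ^ 2 * (p.l₂ - conj p.l₂) / (conj p.l₁ + conj p.l₂)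
        / ((conj p.l₁ - conj p.l₂) * (conj p.l₁ + p.l₂)) * (p.a₂ * conj p.a₂) * conj p.a₁) := by
  have hr := sqrt_r₁_mul h
  have hγ := expI_γ₁_div h
  have hκ := sq_sqrt_abs p.κ₁
  have hδ := expI_half_δ_mul_inv h
  have hD' : (√p.Δ : ℂ) * (√p.Δ : ℂ)⁻¹ = 1 := mul_inv_cancel₀ (sqrt_Δ_ne h)
  have hn : (‖p.l₁ + p.l₂‖ : ℂ) * (‖p.l₁ + p.l₂‖ : ℂ)⁻¹ = 1 :=
    mul_inv_cancel₀ (by exact_mod_cast norm_ne_zero_iff.mpr h.add_ne)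
  have hr2 := a₂_mul_conj h
  rw [expI_add, ϖ₁, sub_div, expI_sub_eq_mul_inv, hδ, sqrt_abs_two_mul,
    Real.sqrt_mul Ω_nonneg, sqrt_Ω h, weight]
  push_cast
  rw [one_div, mul_inv, mul_inv]
  calc _ = (√2 * 4 * p.k₂ ^ 2 * (2 * p.κ₂ * Complex.I) * (conj p.l₁ + conj p.l₂)⁻¹ : ℂ)
        * (√p.r₁ * (expI (p.lam₁ / 2) * expI (p.δ₂ / 2))) * (expI p.γ₁ * (√p.Υ : ℂ)⁻¹)
        * p.s ^ 2 * (‖p.l₁ + p.l₂‖ * (‖p.l₁ + p.l₂‖ : ℂ)⁻¹) * (√|p.κ₁| : ℝ) * p.r₂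
        * (√p.Δ : ℂ)⁻¹ := by ring
    _ = _ := by
      rw [hr, hγ, s_sq, hn, two_I_κ₂, ← hr2, ← hκ]
      linear_combination (√2 * 4 * p.k₂ ^ 2 * (p.l₂ - conj p.l₂) * (conj p.l₁ + conj p.l₂)⁻¹
        * ((conj p.l₁ - conj p.l₂) * (conj p.l₁ + p.l₂))⁻¹ * conj p.a₁ * (√|p.κ₁| : ℝ) ^ 2
        * (|p.κ₂| : ℝ) * √p.Δ ^ 2 * (p.a₂ * conj p.a₂) : ℂ) * hD'

theorem coeff_plain_sum (h : p.Regular) :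
    ((√p.r₁ * √|2 * p.κ₁| * p.r₂ * √(p.Γ / p.Δ) : ℝ) : ℂ) * expI (p.α₂ - p.γ₂)
      = (√2 * p.weight : ℝ) * (-(poles h).h * (p.a₂ * conj p.a₂) * conj p.a₁) := by
  have hr := sqrt_r₁_mul h
  have hγ := sqrt_Γ_mul_γ₂_inv h
  have hκ := sq_sqrt_abs p.κ₁
  have hD' : (√p.Δ : ℂ) * (√p.Δ : ℂ)⁻¹ = 1 := mul_inv_cancel₀ (sqrt_Δ_ne h)
  have hr2 := a₂_mul_conj h
  rw [expI_sub_eq_mul_inv, α₂, add_div, expI_add, sqrt_abs_two_mul,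
    Real.sqrt_div (Γ_pos h).le, weight]
  push_cast
  calc _ = (√2 : ℂ) * (√p.r₁ * (expI (p.lam₁ / 2) * expI (p.δ₂ / 2)))
        * (√p.Γ * (expI p.γ₂)⁻¹) * (√|p.κ₁| : ℝ) * p.r₂ * (√p.Δ : ℂ)⁻¹ := by ring
    _ = _ := by
      rw [hr, hγ, ← hr2, ← hκ]
      linear_combination (-√2 * (poles h).h * conj p.a₁ * (√|p.κ₁| : ℝ) ^ 2
        * (|p.κ₂| : ℝ) * √p.Δ ^ 2 * (p.a₂ * conj p.a₂) : ℂ) * hD'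

theorem coeff_plain_diff (h : p.Regular) :
    ((√p.r₁ * √|2 * p.κ₁| * p.r₂ * √(p.Δ / p.Γ) : ℝ) : ℂ) * expI (p.υ₂ + p.γ₂)
      = (√2 * p.weight : ℝ) * (-((poles h).Δsq * ((p.l₁ + p.l₂) / (p.l₁ - conj p.l₂))
        * (poles h).bar.h / (poles h).Γ) * (p.a₂ * conj p.a₂) * conj p.a₁) := by
  have hr := sqrt_r₁_mul h
  have hγ := sqrt_Γ_mul_γ₂ h
  have hκ := sq_sqrt_abs p.κ₁
  have hδ := expI_half_δ₂_inv h
  have hG := sqrt_Γ_ne h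
  have hr2 := a₂_mul_conj h
  have hγ' : expI p.γ₂ * (√p.Γ : ℂ)⁻¹ = -(poles h).bar.h / (poles h).Γ := by
    rw [poles_Γ, ← sqrt_Γ_mul_self, ← hγ]; field_simp
  rw [expI_add, υ₂, sub_div, expI_sub_eq_mul_inv, hδ, sqrt_abs_two_mul,
    Real.sqrt_div (Δ_pos h).le, weight, poles_Δsq]
  push_cast
  calc _ = (√2 : ℂ) * (√p.r₁ * (expI (p.lam₁ / 2) * expI (p.δ₂ / 2)))
        * (expI p.γ₂ * (√p.Γ : ℂ)⁻¹) * (√|p.κ₁| : ℝ) * p.r₂ * √p.Δ ^ 3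
        * ((p.l₁ + p.l₂) / (p.l₁ - conj p.l₂)) := by ring
    _ = _ := by
      rw [hr, hγ', ← hr2, ← hκ]
      ring

/-- The sign s₁ becomes |κ₁|/(l₁ - l̄₁) up to a constant, and s cancels through the product of the
half-angles of δ₁ and δ₂. -/
theorem coeff_cross (h : p.Regular) :
    ((p.k₁ * p.k₂ * p.s * √(p.Ω / p.Υ) * (p.k₁ * √p.r₂ * √|8 * p.κ₂| * p.s₁) : ℝ) : ℂ)
        * expI (p.γ₂ - p.ϖ₂)
      = (√2 * p.weight : ℝ) * ((poles h).G * p.a₂) := by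
  have hr := sqrt_r₂_mul_inv h
  have hγ := expI_γ₂_div h
  have hκ := sq_sqrt_abs p.κ₂
  have hn0 : (‖p.l₁ + p.l₂‖ : ℂ) ≠ 0 := by exact_mod_cast norm_ne_zero_iff.mpr h.add_ne
  have hn : (‖p.l₁ + p.l₂‖ : ℂ) * (‖p.l₁ + p.l₂‖ : ℂ)⁻¹ = 1 := mul_inv_cancel₀ hn0
  have he : expI (p.δ₂ / 2) = p.s * Complex.I * (conj p.l₁ + conj p.l₂)
      * (‖p.l₁ + p.l₂‖ : ℂ)⁻¹ * (expI (p.δ₁ / 2))⁻¹ := by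
    have h0 := expI_ne_zero (p.δ₁ / 2)
    rw [← div_eq_mul_inv _ (‖p.l₁ + p.l₂‖ : ℂ), ← expI_half_δ_mul h]
    field_simp
  have hs : (p.s₁ : ℂ) * Complex.I * (-2) = 4 * (|p.κ₁| : ℝ) * (p.l₁ - conj p.l₁)⁻¹ := by
    have h1 : p.l₁ - conj p.l₁ ≠ 0 := (poles h).sub₁₁
    have h2 : (p.s₁ : ℂ) * p.κ₁ = (|p.κ₁| : ℝ) := by
      rw [← sign_mul_self, Complex.ofReal_mul, s₁]
    rw [eq_mul_inv_iff_mul_eq₀ h1, ← two_I_κ₁, ← h2]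
    linear_combination (-4 * p.s₁ * p.κ₁ : ℂ) * Complex.I_sq
  rw [show p.γ₂ - p.ϖ₂ = p.γ₂ + p.δ₂ / 2 - p.lam₂ / 2 by rw [ϖ₂]; ring, expI_sub_eq_mul_inv,
    expI_add, he, sqrt_abs_eight_mul, Real.sqrt_div Ω_nonneg, sqrt_Ω h, weight,
    PolePair.G, poles_k₁, poles_k₂]
  push_cast
  calc _ = (√2 * p.k₁ ^ 2 * p.k₂ * (conj p.l₁ + conj p.l₂) : ℂ) * -(p.s₁ * Complex.I * (-2))
        * p.s ^ 2 * (‖p.l₁ + p.l₂‖ * (‖p.l₁ + p.l₂‖ : ℂ)⁻¹)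
        * (√p.r₂ * ((expI (p.lam₂ / 2))⁻¹ * (expI (p.δ₁ / 2))⁻¹))
        * (expI p.γ₂ * (√p.Υ : ℂ)⁻¹) * √p.Δ * (√|p.κ₂| : ℝ) := by ring
    _ = _ := by
      rw [hr, hγ, hs, s_sq, hn, ← hκ]
      simp only [poles]
      ring

end Params

/-! ### Assembly of the Sasa-Satsuma numerator. -/

namespace Params

variable {p : Params}

/-- The part of the first numerator that does not depend on the relative phase. -/
def mainTerm (h : p.Regular) (Y₁ Y₂ : ℂ) : ℂ :=
  (poles h).bar.h * conj p.a₁ * (Y₁ * Y₂ ^ 2) + (poles h).h * p.a₁ * (Y₁ * Y₂ ^ 2)⁻¹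
    + (poles h).g * conj p.a₁ * (Y₁ / Y₂ ^ 2) + (poles h).bar.g * p.a₁ * (Y₁ / Y₂ ^ 2)⁻¹
    - (poles h).C * (p.a₂ * conj p.a₂) * conj p.a₁ * Y₁
    - (poles h).bar.C * (p.a₂ * conj p.a₂) * p.a₁ * Y₁⁻¹

/-- The part of the first numerator that multiplies the relative phase. -/
def crossTerm (h : p.Regular) (Y₂ : ℂ) : ℂ :=
  (poles h).G * p.a₂ * Y₂ + (poles h).bar.G * conj p.a₂ * Y₂⁻¹

theorem cross_coshI (h : p.Regular) (ξ₂ : ℝ) :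
    ((p.k₁ * p.k₂ * p.s * √(p.Ω / p.Υ) * (p.k₁ * √p.r₂ * √|8 * p.κ₂| * p.s₁) : ℝ) : ℂ)
        * coshI (p.k₂ * ξ₂) (p.γ₂ - p.ϖ₂)
      = (√2 * p.weight : ℝ) / 2 * crossTerm h (Complex.exp (p.k₂ * ξ₂ : ℝ)) := by
  rw [mul_coshI (coeff_cross h), crossTerm, map_mul, conj_poles_G]

theorem cross_coshI_neg (h : p.Regular) (ξ₂ : ℝ) :
    ((p.k₁ * p.k₂ * p.s * √(p.Ω / p.Υ) * (p.k₁ * √p.r₂ * √|8 * p.κ₂| * p.s₁) : ℝ) : ℂ)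
        * coshI (p.k₂ * ξ₂) (p.ϖ₂ - p.γ₂)
      = (√2 * p.weight : ℝ) / 2 * crossTerm h (Complex.exp (p.k₂ * ξ₂ : ℝ))⁻¹ := by
  have := cross_coshI h (-ξ₂)
  rw [mul_neg, Complex.ofReal_neg, Complex.exp_neg] at this
  rw [← this]
  congr 1
  rw [coshI, coshI, ← Complex.cosh_neg]
  congr 1
  push_cast
  ring

theorem conj_coshI (a b : ℝ) : conj (coshI a b) = coshI a (-b) := by
  rw [coshI, coshI, ← Complex.cosh_conj]
  congr 1
  simp

theorem ofReal_re_eq (z : ℂ) : ((z.re : ℝ) : ℂ) = (z + conj z) / 2 := Complex.re_eq_add_conj z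

theorem main_coshI (h : p.Regular) (ξ₁ ξ₂ : ℝ) :
    ((p.k₁ * √p.r₁ * √|2 * p.κ₁| : ℝ) : ℂ)
      * ((|p.κ₂| : ℝ)
          * ((√(p.Δ * p.Γ) : ℝ) * coshI (p.k₁ * ξ₁ + 2 * p.k₂ * ξ₂) (p.α₂ + p.γ₂)
            + (1 / √(p.Δ * p.Γ) : ℝ) * coshI (p.k₁ * ξ₁ - 2 * p.k₂ * ξ₂) (p.υ₂ - p.γ₂))
        + (p.r₂ : ℝ)
          * ((-8 * p.k₂ ^ 2 * p.κ₂ * p.s * (1 / √(p.Ω * p.Υ)) : ℝ)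
              * coshI (p.k₁ * ξ₁) (p.ϖ₁ + p.γ₁)
            + (√(p.Γ / p.Δ) : ℝ) * coshI (p.k₁ * ξ₁) (p.α₂ - p.γ₂)
            + (√(p.Δ / p.Γ) : ℝ) * coshI (p.k₁ * ξ₁) (p.υ₂ + p.γ₂)))
      = -((√2 * p.weight : ℝ) / 2 * (p.k₁
        * mainTerm h (Complex.exp (p.k₁ * ξ₁ : ℝ)) (Complex.exp (p.k₂ * ξ₂ : ℝ)))) := by
  have e₁ := mul_coshI (coeff_sum_phase h) (p.k₁ * ξ₁ + 2 * p.k₂ * ξ₂)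
  have e₂ := mul_coshI (coeff_diff_phase h) (p.k₁ * ξ₁ - 2 * p.k₂ * ξ₂)
  have e₃ := mul_coshI (coeff_resonant h) (p.k₁ * ξ₁)
  have e₄ := mul_coshI (coeff_plain_sum h) (p.k₁ * ξ₁)
  have e₅ := mul_coshI (coeff_plain_diff h) (p.k₁ * ξ₁)
  have hX : Complex.exp ((2 * p.k₂ * ξ₂ : ℝ) : ℂ) = Complex.exp (p.k₂ * ξ₂ : ℝ) ^ 2 := by
    rw [← Complex.exp_nat_mul]; push_cast; ring_nf
  -- The three summands of C come from the three cosh terms in ξ₁ alone: resonant, sum and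
  -- difference.
  have hC : (poles h).C = 4 * p.k₂ ^ 2 * (p.l₂ - conj p.l₂) / (conj p.l₁ + conj p.l₂)
      / ((conj p.l₁ - conj p.l₂) * (conj p.l₁ + p.l₂)) - (poles h).h
      - (poles h).Δsq * ((p.l₁ + p.l₂) / (p.l₁ - conj p.l₂)) * (poles h).bar.h / (poles h).Γ := by
    rw [PolePair.C, poles_k₂]
    simp only [PolePair.h, poles, PolePair.bar, add_comm (conj p.l₂)]
  have hC' := congrArg conj hC
  rw [conj_poles_C, map_sub, map_sub] at hC'
  rw [exp_ofReal_add, hX] at e₁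
  rw [exp_ofReal_sub, hX] at e₂
  simp only [map_mul, map_neg, Complex.conj_conj, conj_poles_h, conj_poles_g] at e₁ e₂
  rw [map_mul, map_mul, map_mul, Complex.conj_conj, Complex.conj_conj] at e₃
  rw [map_mul, map_mul, map_mul, map_neg, Complex.conj_conj, Complex.conj_conj] at e₄
  rw [map_mul, map_mul, map_mul, map_neg, Complex.conj_conj, Complex.conj_conj] at e₅
  rw [mainTerm, hC, hC']
  rw [Complex.ofReal_mul] at e₁ e₂ e₃ e₄ e₅
  simp only [Complex.ofReal_mul _ p.r₂, Complex.ofReal_mul _ |p.κ₂|] at e₁ e₂ e₃ e₄ e₅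
  rw [show p.k₁ * √p.r₁ * √|2 * p.κ₁| = p.k₁ * (√p.r₁ * √|2 * p.κ₁|) by ring, Complex.ofReal_mul]
  linear_combination (p.k₁ : ℂ) * (e₁ + e₂ + e₃ + e₄ + e₅)

/-- √|32κ₂| is twice √|8κ₂|, which compensates the half in the real part. Hence all cross terms
share the same normalization. -/
theorem VS₁_eq (h : p.Regular) (ξ₁ ξ₂ : ℝ) :
    p.VS₁ ξ₁ ξ₂ = (√2 * p.weight : ℝ) / 2
      * (-(p.k₁ * mainTerm h (Complex.exp (p.k₁ * ξ₁ : ℝ)) (Complex.exp (p.k₂ * ξ₂ : ℝ)))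
        + crossTerm h.swap (Complex.exp (p.k₁ * ξ₁ : ℝ))⁻¹
        - (crossTerm h (Complex.exp (p.k₂ * ξ₂ : ℝ)) * expI (p.θ ξ₁ ξ₂)
          + crossTerm h (Complex.exp (p.k₂ * ξ₂ : ℝ))⁻¹ * (expI (p.θ ξ₁ ξ₂))⁻¹)) := by
  have h₁ := cross_coshI_neg h.swap ξ₁
  rw [swap_weight, swap_ϖ₂, swap_γ₂, swap_Ω, swap_Υ, swap_s] at h₁
  change ((p.k₂ * p.k₁ * p.s * √(p.Ω / p.Υ) * (p.k₂ * √p.r₁ * √|8 * p.κ₁| * p.s₂) : ℝ) : ℂ)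
        * coshI (p.k₁ * ξ₁) (p.ϖ₁ - p.γ₁)
      = (√2 * p.weight : ℝ) / 2 * crossTerm h.swap (Complex.exp (p.k₁ * ξ₁ : ℝ))⁻¹ at h₁
  have h₂ := cross_coshI h ξ₂
  have h₃ := cross_coshI_neg h ξ₂
  have hre : (((coshI (p.k₂ * ξ₂) (p.γ₂ - p.ϖ₂) * expI (p.θ ξ₁ ξ₂)).re : ℝ) : ℂ)
      = (coshI (p.k₂ * ξ₂) (p.γ₂ - p.ϖ₂) * expI (p.θ ξ₁ ξ₂)
        + coshI (p.k₂ * ξ₂) (p.ϖ₂ - p.γ₂) * (expI (p.θ ξ₁ ξ₂))⁻¹) / 2 := by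
    rw [ofReal_re_eq, map_mul, conj_expI, conj_coshI, neg_sub]
  rw [VS₁, main_coshI h, sqrt_abs_thirtyTwo_mul]
  simp only [Complex.ofReal_mul _ (Complex.re _), hre]
  simp only [Complex.ofReal_mul, Complex.ofReal_ofNat] at h₁ h₂ h₃ ⊢
  linear_combination h₁ - expI (p.θ ξ₁ ξ₂) * h₂ - (expI (p.θ ξ₁ ξ₂))⁻¹ * h₃

/-- Because e^{iθ} = w₁/w₂, the e^{-iθ} part of w₁V₁ cancels the phase-free cross term of w₂V₂, and
likewise with the waves interchanged. The terms with w₁²/w₂ and w₂²/w₁ survive and are those of the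
half numerators. -/
theorem sasaSatsuma_num (h : p.Regular) (hc : p.c₁ ≠ p.c₂) (t x : ℝ) :
    (p.w₁ t x * p.VS₁ (x - p.c₁ * t) (x - p.c₂ * t)
        + p.w₂ t x * p.VS₂ (x - p.c₁ * t) (x - p.c₂ * t)) * (p.X₁ t x ^ 2 * p.X₂ t x ^ 2)
      = -((√2 / 2 : ℝ) * p.weight * ((poles h).halfNumerator p.a₁ p.a₂ (conj p.a₁) (conj p.a₂)
          (p.X₁ t x) (p.X₂ t x) (p.w₁ t x) (p.w₂ t x)⁻¹
        + (poles h).swap.halfNumerator p.a₂ p.a₁ (conj p.a₂) (conj p.a₁)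
          (p.X₂ t x) (p.X₁ t x) (p.w₂ t x) (p.w₁ t x)⁻¹)) := by
  have hX1 := p.X₁_ne t x
  have hX2 := p.X₂_ne t x
  have hw1 := p.w₁_ne t x
  have hw2 := p.w₂_ne t x
  have e₁ := VS₁_eq h (x - p.c₁ * t) (x - p.c₂ * t)
  have e₂ := VS₁_eq h.swap (x - p.c₂ * t) (x - p.c₁ * t)
  rw [expI_θ p hc, ← X₁, ← X₂] at e₁
  rw [swap_VS₁, swap_θ, expI_neg, expI_θ p hc, swap_weight] at e₂
  change _ = _ * (-(p.k₂ * mainTerm h.swap (p.X₂ t x) (p.X₁ t x)) + crossTerm h (p.X₂ t x)⁻¹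
    - (crossTerm h.swap (p.X₁ t x) * _ + crossTerm h.swap (p.X₁ t x)⁻¹ * _)) at e₂
  have hN₁ : (poles h).halfNumerator p.a₁ p.a₂ (conj p.a₁) (conj p.a₂)
          (p.X₁ t x) (p.X₂ t x) (p.w₁ t x) (p.w₂ t x)⁻¹
      = p.X₁ t x ^ 2 * p.X₂ t x ^ 2 * (p.w₁ t x * (p.k₁ * mainTerm h (p.X₁ t x) (p.X₂ t x))
        + p.w₁ t x ^ 2 * (p.w₂ t x)⁻¹ * crossTerm h (p.X₂ t x)) := by
    rw [PolePair.halfNumerator, poles_k₁, mainTerm, crossTerm]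
    field_simp
    ring
  have hN₂ : (poles h).swap.halfNumerator p.a₂ p.a₁ (conj p.a₂) (conj p.a₁)
          (p.X₂ t x) (p.X₁ t x) (p.w₂ t x) (p.w₁ t x)⁻¹
      = p.X₁ t x ^ 2 * p.X₂ t x ^ 2 * (p.w₂ t x * (p.k₂ * mainTerm h.swap (p.X₂ t x) (p.X₁ t x))
        + p.w₂ t x ^ 2 * (p.w₁ t x)⁻¹ * crossTerm h.swap (p.X₁ t x)) := by
    rw [PolePair.halfNumerator, PolePair.swap_k₁, poles_k₂ h, mainTerm, crossTerm, poles_swap h,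
      swap_a₁, swap_a₂]
    field_simp
    ring
  rw [hN₁, hN₂, e₁, e₂]
  -- The cancellation is formal in the main and cross terms.
  generalize mainTerm h _ _ = m₁
  generalize mainTerm h.swap _ _ = m₂
  generalize crossTerm h (p.X₂ t x) = t₁
  generalize crossTerm h (p.X₂ t x)⁻¹ = t₂
  generalize crossTerm h.swap (p.X₁ t x) = t₃
  generalize crossTerm h.swap (p.X₁ t x)⁻¹ = t₄
  push_cast
  field_simp
  ring

end Params

namespace Params

variable {p : Params}

/-! ### The denominator of the Sasa-Satsuma 2-soliton -/

theorem conj_poles_F (h : p.Regular) : conj (poles h).F = (poles h).bar.F := by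
  simp [PolePair.F, poles, PolePair.bar]

theorem conj_Kp_denom :
    conj ((conj p.l₂ + p.l₁) * (conj p.l₁ + p.l₂)) = (conj p.l₂ + p.l₁) * (conj p.l₁ + p.l₂) := by
  simp only [map_mul, map_add, Complex.conj_conj]; ring

theorem conj_Km_denom :
    conj ((p.l₁ - p.l₂) * (conj p.l₁ - conj p.l₂)) = (p.l₁ - p.l₂) * (conj p.l₁ - conj p.l₂) := by
  simp only [map_mul, map_sub, Complex.conj_conj]; ring

theorem sqrt_Γ_mul_sqrt_Υ (h : p.Regular) :
    (√p.Γ : ℂ) * (√p.Υ : ℝ) = (p.l₁ - p.l₂) * (conj p.l₁ - conj p.l₂) := by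
  have hp : (‖p.l₁ + conj p.l₂‖ : ℂ) ≠ 0 := by exact_mod_cast norm_ne_zero_iff.mpr h.add_conj_ne
  have hn := norm_sq_eq (p.l₁ - p.l₂)
  rw [map_sub] at hn
  rw [← hn, sqrt_Υ, sqrt_Γ]
  push_cast
  field_simp

theorem coeff_sum_W (h : p.Regular) :
    ((√|p.κ₁ * p.κ₂| * √p.r₁ * √p.r₂ * √(p.Γ / p.Υ) : ℝ) : ℂ) * expI (p.ϖ₁ - p.ϖ₂)
      = p.weight * (conj p.a₁ * p.a₂ / ((conj p.l₂ + p.l₁) * (conj p.l₁ + p.l₂))) := by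
  have hr := sqrt_r₁_mul h
  have hr' := sqrt_r₂_mul_inv h
  have hκ := sq_sqrt_abs p.κ₁
  have hκ' := sq_sqrt_abs p.κ₂
  have hG := sqrt_Γ_div_sqrt_Υ h
  rw [show p.ϖ₁ - p.ϖ₂ = p.lam₁ / 2 + p.δ₂ / 2 - p.lam₂ / 2 - p.δ₁ / 2 by rw [ϖ₁, ϖ₂]; ring,
    expI_sub_eq_mul_inv, expI_sub_eq_mul_inv, expI_add, abs_mul, Real.sqrt_mul (abs_nonneg _),
    Real.sqrt_div (Γ_pos h).le, weight]
  push_cast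
  calc _ = (√p.r₁ * (expI (p.lam₁ / 2) * expI (p.δ₂ / 2)) : ℂ)
        * (√p.r₂ * ((expI (p.lam₂ / 2))⁻¹ * (expI (p.δ₁ / 2))⁻¹))
        * (√p.Γ / (√p.Υ : ℝ)) * (√|p.κ₁| : ℝ) * (√|p.κ₂| : ℝ) := by ring
    _ = _ := by
      rw [hr, hr', hG, ← hκ, ← hκ']
      ring

/-- The amplitude lemmas supply e^{i(δ₁+δ₂)/2}, whereas ϖ₁ + ϖ₂ requires the inverse. The
discrepancy e^{-i(δ₁+δ₂)} is -F, in which s no longer appears. -/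
theorem coeff_diff_W (h : p.Regular) :
    ((√|p.κ₁ * p.κ₂| * √p.r₁ * √p.r₂ * (1 / √(p.Γ * p.Υ)) : ℝ) : ℂ) * expI (p.ϖ₁ + p.ϖ₂)
      = p.weight * (-((poles h).F * (conj p.a₁ * conj p.a₂))
        / ((p.l₁ - p.l₂) * (conj p.l₁ - conj p.l₂))) := by
  have hr := sqrt_r₁_mul h
  have hr' := sqrt_r₂_mul h
  have hκ := sq_sqrt_abs p.κ₁
  have hκ' := sq_sqrt_abs p.κ₂
  have hG := sqrt_Γ_mul_sqrt_Υ h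
  have hm : conj p.l₁ + conj p.l₂ ≠ 0 := (poles h).add_m
  have hn : (‖p.l₁ + p.l₂‖ : ℂ) ≠ 0 := by exact_mod_cast norm_ne_zero_iff.mpr h.add_ne
  have hF : ((expI (p.δ₁ / 2))⁻¹ * (expI (p.δ₂ / 2))⁻¹) ^ 2 = -(poles h).F := by
    have hn2 := norm_add_sq (p := p)
    rw [← mul_inv, inv_pow, expI_half_δ_mul h, div_pow, mul_pow, mul_pow, s_sq, Complex.I_sq, hn2]
    simp only [PolePair.F, poles]
    field_simp
  have h1 := expI_ne_zero (p.δ₁ / 2)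
  have h2 := expI_ne_zero (p.δ₂ / 2)
  rw [show p.ϖ₁ + p.ϖ₂ = p.lam₁ / 2 + p.lam₂ / 2 - p.δ₁ / 2 - p.δ₂ / 2 by rw [ϖ₁, ϖ₂]; ring,
    expI_sub_eq_mul_inv, expI_sub_eq_mul_inv, expI_add, abs_mul, Real.sqrt_mul (abs_nonneg _),
    Real.sqrt_mul (Γ_pos h).le, weight]
  push_cast
  rw [hG]
  calc _ = (√p.r₁ * (expI (p.lam₁ / 2) * expI (p.δ₂ / 2)) : ℂ)
        * (√p.r₂ * (expI (p.lam₂ / 2) * expI (p.δ₁ / 2)))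
        * ((expI (p.δ₁ / 2))⁻¹ * (expI (p.δ₂ / 2))⁻¹) ^ 2
        * (1 / ((p.l₁ - p.l₂) * (conj p.l₁ - conj p.l₂))) * (√|p.κ₁| : ℝ) * (√|p.κ₂| : ℝ) := by
        field_simp
    _ = _ := by
      rw [hr, hr', hF, ← hκ, ← hκ']
      ring

/-- The signs s₁, s₂ turn κ₁κ₂ into its modulus, and (l₁ - l̄₁)(l₂ - l̄₂) = -4κ₁κ₂. -/
theorem coeff_double_W (h : p.Regular) :
    ((2 * p.k₁ ^ 2 * p.k₂ ^ 2 * p.s₁ * p.s₂ * (p.Ω / p.Υ) : ℝ) : ℂ) = p.weight * (poles h).S := by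
  have hn := norm_add_sq (p := p)
  have h1 := two_I_κ₁ (p := p)
  have h2 := two_I_κ₂ (p := p)
  have hκ1 : (p.κ₁ : ℂ) ≠ 0 := Complex.ofReal_ne_zero.mpr h.κ₁_ne
  have hκ2 : (p.κ₂ : ℂ) ≠ 0 := Complex.ofReal_ne_zero.mpr h.κ₂_ne
  have hΥ : (p.Υ : ℂ) ≠ 0 := Complex.ofReal_ne_zero.mpr (Υ_pos h).ne'
  rw [PolePair.S, poles_k₁, poles_k₂, poles_Υ, weight, ← sign_mul_self, ← sign_mul_self,
    Real.sq_sqrt (Δ_pos h).le, Ω_eq_Δ h]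
  change _ = _ * (-(8 * _ * _ * ((p.l₁ + p.l₂) * (conj p.l₁ + conj p.l₂)))
    / (_ * ((p.l₁ - conj p.l₁) * (p.l₂ - conj p.l₂))))
  rw [← hn, ← h1, ← h2, s₁, s₂]
  push_cast
  field_simp
  linear_combination (8 * (p.k₁ : ℂ) ^ 2 * p.k₂ ^ 2 * Real.sign p.κ₁ * Real.sign p.κ₂
    * ‖p.l₁ + p.l₂‖ ^ 2 * p.Δ) * Complex.I_sq

theorem coeff_const_W (h : p.Regular) :
    ((p.r₁ * p.r₂ * (p.Γ / p.Δ + p.Δ / p.Γ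
        + 64 * p.k₁ ^ 2 * p.k₂ ^ 2 * p.κ₁ * p.κ₂ * (1 / (p.Ω * p.Υ))) : ℝ) : ℂ)
      = p.weight * ((poles h).L * (p.a₁ * conj p.a₁ * (p.a₂ * conj p.a₂))) := by
  have hn := norm_add_sq (p := p)
  have h1 := two_I_κ₁ (p := p)
  have h2 := two_I_κ₂ (p := p)
  have hr1 := a₁_mul_conj h
  have hr2 := a₂_mul_conj h
  have hΔ : (p.Δ : ℂ) ≠ 0 := Complex.ofReal_ne_zero.mpr (Δ_pos h).ne'
  have hΓ : (p.Γ : ℂ) ≠ 0 := Complex.ofReal_ne_zero.mpr (Γ_pos h).ne'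
  have hΥ : (p.Υ : ℂ) ≠ 0 := Complex.ofReal_ne_zero.mpr (Υ_pos h).ne'
  have hnp : (‖p.l₁ + p.l₂‖ : ℂ) ≠ 0 := by exact_mod_cast norm_ne_zero_iff.mpr h.add_ne
  have hD : (poles h).Δsq = (p.Δ : ℂ) ^ 2 := by rw [poles_Δsq, ← sqrt_Δ_sq h]; ring
  rw [sqrt_Δ_sq h] at hr1 hr2
  rw [PolePair.L, poles_k₁, poles_k₂, poles_Υ, poles_Γ, hD, weight, Real.sq_sqrt (Δ_pos h).le,
    Ω_eq_Δ h]
  change _ = _ * ((_ - 16 * _ * _ * ((p.l₁ - conj p.l₁) * (p.l₂ - conj p.l₂))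
    / ((p.l₁ + p.l₂) * (conj p.l₁ + conj p.l₂) * _)) * _)
  rw [← hn, ← h1, ← h2]
  push_cast
  rw [← hr1, ← hr2]
  field_simp
  linear_combination (64 * (|p.κ₁| : ℝ) * p.a₁ * conj p.a₁ * (|p.κ₂| : ℝ) * p.a₂ * conj p.a₂
    * (p.Γ : ℂ) * p.k₁ ^ 2 * p.k₂ ^ 2 * p.κ₁ * p.κ₂) * Complex.I_sq

/-- Real part of a phase times a hyperbolic cosine. -/
theorem re_expI_mul_coshI {c P b : ℝ} {U : ℂ} (h : (c : ℂ) * expI b = P * U) (a θ : ℝ) :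
    (((expI θ * (c * coshI a b)).re : ℝ) : ℂ)
      = P / 4 * (expI θ * (U * Complex.exp a + conj U * (Complex.exp a)⁻¹)
        + (expI θ)⁻¹ * (conj U * Complex.exp a + U * (Complex.exp a)⁻¹)) := by
  rw [ofReal_re_eq, mul_coshI h]
  simp only [map_mul, map_add, map_div₀, map_inv₀, conj_expI, Complex.conj_ofReal,
    Complex.conj_conj, Complex.conj_ofNat, ← Complex.exp_conj]
  ring

theorem ofReal_cosh_two_mul (a : ℝ) :
    ((Real.cosh (2 * a) : ℝ) : ℂ) = (Complex.exp a ^ 2 + (Complex.exp a ^ 2)⁻¹) / 2 := by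
  rw [ofReal_cosh_eq, two_mul, exp_ofReal_add, sq]

theorem ofReal_cos_two_mul (a : ℝ) :
    ((Real.cos (2 * a) : ℝ) : ℂ) = (expI a ^ 2 + (expI a ^ 2)⁻¹) / 2 := by
  rw [ofReal_cos_eq, two_mul, expI_add, sq]

theorem WS_eq (h : p.Regular) (ξ₁ ξ₂ : ℝ) :
    (p.WS ξ₁ ξ₂ : ℂ)
      = |p.κ₁ * p.κ₂| * (p.Δ * p.Γ * Real.cosh (2 * (p.k₁ * ξ₁ + p.k₂ * ξ₂))
        + 1 / (p.Δ * p.Γ) * Real.cosh (2 * (p.k₁ * ξ₁ - p.k₂ * ξ₂)))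
      + 2 * p.r₁ * |p.κ₂| * Real.cosh (2 * (p.k₂ * ξ₂))
      + 2 * p.r₂ * |p.κ₁| * Real.cosh (2 * (p.k₁ * ξ₁))
      + 2 * (p.weight * (poles h).S) * Real.cos (2 * p.θ ξ₁ ξ₂)
      + p.weight * ((poles h).L * (p.a₁ * conj p.a₁ * (p.a₂ * conj p.a₂)))
      - 16 * p.k₁ * p.k₂
        * ((expI (p.θ ξ₁ ξ₂) * ((√|p.κ₁ * p.κ₂| * √p.r₁ * √p.r₂ * √(p.Γ / p.Υ) : ℝ)
            * coshI (p.k₁ * ξ₁ + p.k₂ * ξ₂) (p.ϖ₁ - p.ϖ₂))).re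
          + (expI (p.θ ξ₁ ξ₂) * ((√|p.κ₁ * p.κ₂| * √p.r₁ * √p.r₂ * (1 / √(p.Γ * p.Υ)) : ℝ)
            * coshI (p.k₁ * ξ₁ - p.k₂ * ξ₂) (p.ϖ₁ + p.ϖ₂))).re) := by
  rw [← coeff_double_W h, ← coeff_const_W h]
  have e (c d : ℝ) (z w : ℂ) :
      (expI (p.θ ξ₁ ξ₂) * ((√|p.κ₁ * p.κ₂| * √p.r₁ * √p.r₂ * c : ℝ) * z)).re
      + (expI (p.θ ξ₁ ξ₂) * ((√|p.κ₁ * p.κ₂| * √p.r₁ * √p.r₂ * d : ℝ) * w)).re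
      = √|p.κ₁ * p.κ₂| * √p.r₁ * √p.r₂ * (expI (p.θ ξ₁ ξ₂) * (c * z + d * w)).re := by
    rw [← Complex.add_re, ← Complex.re_ofReal_mul]
    congr 1
    push_cast
    ring
  rw [← Complex.ofReal_add, e, WS, ← mul_assoc 2 p.k₂, ← mul_assoc 2 p.k₁]
  push_cast
  ring

/-- `WS_eq` isolates the terms whose coefficients have been identified; comparison with `c₀_mul_det`
is then termwise in the exponentials. -/
theorem sasaSatsuma_det (h : p.Regular) (hc : p.c₁ ≠ p.c₂) (t x : ℝ) :
    (p.WS (x - p.c₁ * t) (x - p.c₂ * t) : ℂ) * (p.X₁ t x ^ 2 * p.X₂ t x ^ 2)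
      = p.weight * ((poles h).c₀ * ((poles h).lyapunov (p.a₁ * p.X₁ t x * p.w₁ t x)
        (p.a₂ * p.X₂ t x * p.w₂ t x) (conj p.a₁ * p.X₁ t x * (p.w₁ t x)⁻¹)
        (conj p.a₂ * p.X₂ t x * (p.w₂ t x)⁻¹)).det) := by
  have hX1 := p.X₁_ne t x
  have hX2 := p.X₂_ne t x
  have hw1 := p.w₁_ne t x
  have hw2 := p.w₂_ne t x
  have hΔ : (p.Δ : ℂ) ≠ 0 := Complex.ofReal_ne_zero.mpr (Δ_pos h).ne'
  have hΓ : (p.Γ : ℂ) ≠ 0 := Complex.ofReal_ne_zero.mpr (Γ_pos h).ne'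
  have hD : (poles h).Δsq = (p.Δ : ℂ) ^ 2 := by rw [poles_Δsq, ← sqrt_Δ_sq h]; ring
  have hr1 := a₁_mul_conj h
  have hr2 := a₂_mul_conj h
  rw [sqrt_Δ_sq h] at hr1 hr2
  have hwt : (p.weight : ℂ) = (|p.κ₁| : ℝ) * (|p.κ₂| : ℝ) * p.Δ := by
    rw [weight, Real.sq_sqrt (Δ_pos h).le]; push_cast; ring
  have h1 : conj p.l₂ + p.l₁ ≠ 0 := (poles h).add₂₁
  have h2 : conj p.l₁ + p.l₂ ≠ 0 := (poles h).add₁₂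
  have h3 : p.l₁ - p.l₂ ≠ 0 := (poles h).sub_l
  have h4 : conj p.l₁ - conj p.l₂ ≠ 0 := (poles h).sub_m
  have hKp : (poles h).Kp = 4 * p.k₁ * p.k₂ / ((conj p.l₂ + p.l₁) * (conj p.l₁ + p.l₂)) := by
    rw [PolePair.Kp, poles_k₁, poles_k₂]; rfl
  have hKm : (poles h).Km = 4 * p.k₁ * p.k₂ / ((p.l₁ - p.l₂) * (conj p.l₁ - conj p.l₂)) := by
    rw [PolePair.Km, poles_k₁, poles_k₂]; rfl
  rw [(poles h).c₀_mul_det (a₁_sq h) (a₂_sq h) (conj_a₁_sq h) (conj_a₂_sq h)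
    (mul_inv_cancel₀ hw1) (mul_inv_cancel₀ hw2), WS_eq h, re_expI_mul_coshI (coeff_sum_W h),
    re_expI_mul_coshI (coeff_diff_W h), ofReal_cosh_two_mul, ofReal_cosh_two_mul,
    ofReal_cosh_two_mul, ofReal_cosh_two_mul, ofReal_cos_two_mul, exp_ofReal_add, exp_ofReal_sub,
    expI_θ p hc, ← X₁, ← X₂, PolePair.H, hD, poles_Γ, hKp, hKm, map_div₀, map_div₀, conj_Kp_denom,
    conj_Km_denom, map_neg, map_mul, map_mul, map_mul, conj_poles_F, Complex.conj_conj,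
    Complex.conj_conj, abs_mul, ← hr1, ← hr2, hwt]
  -- The amplitudes and the sums and differences of poles can now be treated as independent symbols;
  -- no relation among them is used any more.
  generalize conj p.a₁ = b₁
  generalize conj p.a₂ = b₂
  generalize conj p.l₂ + p.l₁ = n₁ at *
  generalize conj p.l₁ + p.l₂ = n₂ at *
  generalize p.l₁ - p.l₂ = n₃ at *
  generalize conj p.l₁ - conj p.l₂ = n₄ at *
  push_cast
  field_simp
  ring

end Params

namespace Params

variable {p : Params}

/-! ### Sasa-Satsuma 2-solitons -/

theorem a₂_ne (h : p.Regular) : p.a₂ ≠ 0 := by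
  rw [← swap_a₁]; exact a₁_ne h.swap

/-- Spectral data of the Sasa-Satsuma 2-soliton. -/
def sasaSatsumaData (h : p.Regular) (t : ℝ) : SolitonData 4 Bool where
  k := ![p.l₁, p.l₂, conj p.l₁, conj p.l₂]
  P := ![amplitude p.l₁ p.a₁ (p.c₁ * t) (p.φ₁ + p.ν₁ * t),
    amplitude p.l₂ p.a₂ (p.c₂ * t) (p.φ₂ + p.ν₂ * t),
    conj (amplitude p.l₁ p.a₁ (p.c₁ * t) (p.φ₁ + p.ν₁ * t)),
    conj (amplitude p.l₂ p.a₂ (p.c₂ * t) (p.φ₂ + p.ν₂ * t))]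
  q b := if b then ![1, 1, 0, 0] else ![0, 0, 1, 1]
  re_pos j := by fin_cases j; exacts [h.k₁_pos, h.k₂_pos, h.k₁_pos, h.k₂_pos]
  inj := by
    have h1 : p.l₁ ≠ p.l₂ := h.ne
    have h2 : p.l₁ ≠ conj p.l₁ := sub_ne_zero.mp (poles h).sub₁₁
    have h3 : p.l₁ ≠ conj p.l₂ := h.ne_conj
    have h4 : p.l₂ ≠ conj p.l₁ := h.swap.ne_conj
    have h5 : p.l₂ ≠ conj p.l₂ := sub_ne_zero.mp (poles h).sub₂₂
    have h6 : conj p.l₁ ≠ conj p.l₂ := sub_ne_zero.mp (poles h).sub_m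
    intro i j hij
    fin_cases i <;> fin_cases j
    exacts [rfl, absurd hij h1, absurd hij h2, absurd hij h3, absurd hij h1.symm, rfl,
      absurd hij h4, absurd hij h5, absurd hij h2.symm, absurd hij h4.symm, rfl, absurd hij h6,
      absurd hij h3.symm, absurd hij h5.symm, absurd hij h6.symm, rfl]
  P_ne j := by
    have h1 := amplitude_ne_zero (l := p.l₁) (a₁_ne h) (p.c₁ * t) (p.φ₁ + p.ν₁ * t)
    have h2 := amplitude_ne_zero (l := p.l₂) (a₂_ne h) (p.c₂ * t) (p.φ₂ + p.ν₂ * t)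
    fin_cases j
    exacts [h1, h2, (map_ne_zero _).mpr h1, (map_ne_zero _).mpr h2]
  q_ne j := by
    fin_cases j
    exacts [⟨true, by simp⟩, ⟨true, by simp⟩, ⟨false, by simp⟩, ⟨false, by simp⟩]

theorem sasaSatsumaData_conj (h : p.Regular) (t x : ℝ) :
    (sasaSatsumaData h t).profile false x = conj ((sasaSatsumaData h t).profile true x) := by
  refine SolitonData.profile_false_eq _ (Equiv.swap 0 2 * Equiv.swap 1 3) ?_ ?_ ?_ x
  · intro j
    fin_cases j <;>
      simp [sasaSatsumaData, Equiv.swap_apply_def]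
  · intro j
    fin_cases j <;>
      simp [sasaSatsumaData, Equiv.swap_apply_def]
  · intro b j
    cases b <;> fin_cases j <;>
      simp [sasaSatsumaData, Equiv.swap_apply_def]

theorem sasaSatsumaData_p (h : p.Regular) (t x : ℝ) :
    (sasaSatsumaData h t).p x = ![p.a₁ * p.X₁ t x * p.w₁ t x, p.a₂ * p.X₂ t x * p.w₂ t x,
      conj p.a₁ * p.X₁ t x * (p.w₁ t x)⁻¹, conj p.a₂ * p.X₂ t x * (p.w₂ t x)⁻¹] := by
  have h1 : amplitude p.l₁ p.a₁ (p.c₁ * t) (p.φ₁ + p.ν₁ * t) * Complex.exp (p.l₁ * x)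
      = p.a₁ * p.X₁ t x * p.w₁ t x :=
    amplitude_mul_exp p.k₁ p.κ₁ p.a₁ (p.c₁ * t) (p.φ₁ + p.ν₁ * t) x
  have h2 : amplitude p.l₂ p.a₂ (p.c₂ * t) (p.φ₂ + p.ν₂ * t) * Complex.exp (p.l₂ * x)
      = p.a₂ * p.X₂ t x * p.w₂ t x :=
    amplitude_mul_exp p.k₂ p.κ₂ p.a₂ (p.c₂ * t) (p.φ₂ + p.ν₂ * t) x
  have h3 := congrArg conj h1
  have h4 := congrArg conj h2
  simp only [map_mul, ← Complex.exp_conj, Complex.conj_ofReal, conj_w₁, conj_w₂, conj_X₁, conj_X₂]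
    at h3 h4
  ext j
  fin_cases j
  exacts [h1, h2, h3, h4]

theorem sasaSatsumaData_M (h : p.Regular) (t x : ℝ) :
    (sasaSatsumaData h t).M x = (poles h).lyapunov (p.a₁ * p.X₁ t x * p.w₁ t x)
      (p.a₂ * p.X₂ t x * p.w₂ t x) (conj p.a₁ * p.X₁ t x * (p.w₁ t x)⁻¹)
      (conj p.a₂ * p.X₂ t x * (p.w₂ t x)⁻¹) := by
  rw [SolitonData.M, sasaSatsumaData_p]
  have h1 : conj (p.a₁ * p.X₁ t x * p.w₁ t x) = conj p.a₁ * p.X₁ t x * (p.w₁ t x)⁻¹ := by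
    rw [map_mul, map_mul, conj_X₁, conj_w₁]
  have h2 : conj (p.a₂ * p.X₂ t x * p.w₂ t x) = conj p.a₂ * p.X₂ t x * (p.w₂ t x)⁻¹ := by
    rw [map_mul, map_mul, conj_X₂, conj_w₂]
  rw [← h1, ← h2]
  generalize p.a₁ * p.X₁ t x * p.w₁ t x = Z₁
  generalize p.a₂ * p.X₂ t x * p.w₂ t x = Z₂
  ext i j
  fin_cases i <;> fin_cases j <;>
    simp [lyapunovMatrix, sasaSatsumaData, PolePair.lyapunov, poles, PolePair.c₁₁, PolePair.c₁₂,
      PolePair.c₂₁, PolePair.c₂₂, PolePair.d₁₁, PolePair.d₁₂, PolePair.d₂₂, PolePair.e₁₁,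
      PolePair.e₁₂, PolePair.e₂₂, div_eq_mul_inv, add_comm]

theorem weight_ne (h : p.Regular) : (p.weight : ℂ) ≠ 0 :=
  Complex.ofReal_ne_zero.mpr (mul_ne_zero (mul_ne_zero (abs_ne_zero.mpr h.κ₁_ne)
    (abs_ne_zero.mpr h.κ₂_ne)) (pow_ne_zero 2 (Real.sqrt_pos.mpr (Δ_pos h)).ne'))

theorem poles_c₀_ne (h : p.Regular) : (poles h).c₀ ≠ 0 := by
  rw [PolePair.c₀, poles_k₁, poles_k₂, poles_Γ]
  have h1 : (p.k₁ : ℂ) ≠ 0 := by exact_mod_cast h.k₁_pos.ne'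
  have h2 : (p.k₂ : ℂ) ≠ 0 := by exact_mod_cast h.k₂_pos.ne'
  have h3 : (p.Γ : ℂ) ≠ 0 := by exact_mod_cast (Γ_pos h).ne'
  exact div_ne_zero (mul_ne_zero (mul_ne_zero (by norm_num) (pow_ne_zero 2 h1))
    (pow_ne_zero 2 h2)) h3

/-- As for Hirota, a zero of W would make the Lyapunov matrix singular. -/
theorem WS_ne (h : p.Regular) (hc : p.c₁ ≠ p.c₂) (t x : ℝ) :
    p.WS (x - p.c₁ * t) (x - p.c₂ * t) ≠ 0 := by
  intro e
  have h1 := sasaSatsuma_det h hc t x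
  rw [e, Complex.ofReal_zero, zero_mul, ← sasaSatsumaData_M h] at h1
  exact mul_ne_zero (weight_ne h) (mul_ne_zero (poles_c₀_ne h) ((sasaSatsumaData h t).det_ne x))
    h1.symm

theorem sasaSatsuma_eq (h : p.Regular) (hc : p.c₁ ≠ p.c₂) (t x : ℝ) :
    p.sasaSatsuma t x = -((√2 / 2 : ℝ) : ℂ) * (sasaSatsumaData h t).profile true x := by
  have hW := Complex.ofReal_ne_zero.mpr (WS_ne h hc t x)
  have hdet := (sasaSatsumaData h t).det_ne x
  have hX : p.X₁ t x ^ 2 * p.X₂ t x ^ 2 ≠ 0 :=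
    mul_ne_zero (pow_ne_zero 2 (p.X₁_ne t x)) (pow_ne_zero 2 (p.X₂_ne t x))
  have hnum := sasaSatsuma_num h hc t x
  have hden := sasaSatsuma_det h hc t x
  rw [← (poles h).c₀_mul_num (a₁_sq h) (a₂_sq h) (conj_a₁_sq h) (conj_a₂_sq h)
    (mul_inv_cancel₀ (p.w₁_ne t x)) (mul_inv_cancel₀ (p.w₂_ne t x)),
    ← sasaSatsumaData_M h, ← sasaSatsumaData_p h] at hnum
  rw [← sasaSatsumaData_M h] at hden
  have hq : ∑ j, conj ((sasaSatsumaData h t).q true j)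
      * (((sasaSatsumaData h t).M x).updateRow j ((sasaSatsumaData h t).p x)).det
      = (((sasaSatsumaData h t).M x).updateRow 0 ((sasaSatsumaData h t).p x)).det
        + (((sasaSatsumaData h t).M x).updateRow 1 ((sasaSatsumaData h t).p x)).det := by
    rw [Fin.sum_univ_four]
    simp [sasaSatsumaData]
  rw [sasaSatsuma, superpose_eq, SolitonData.profile, invForm_eq_det, hq, ← mul_div_assoc,
    div_eq_div_iff hW hdet]
  refine mul_right_cancel₀ (mul_ne_zero (mul_ne_zero (weight_ne h) (poles_c₀_ne h)) hX) ?_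
  linear_combination ((sasaSatsumaData h t).M x).det * p.weight * (poles h).c₀ * hnum
    + (((√2 / 2 : ℝ) : ℂ) * p.weight * (poles h).c₀
      * ((((sasaSatsumaData h t).M x).updateRow 0 ((sasaSatsumaData h t).p x)).det
        + (((sasaSatsumaData h t).M x).updateRow 1 ((sasaSatsumaData h t).p x)).det)) * hden

theorem contDiff_coshI_comp {f : ℝ × ℝ → ℝ} (hf : ContDiff ℝ ∞ f) (b : ℝ) :
    ContDiff ℝ ∞ fun q => coshI (f q) b := (contDiff_coshI b).comp hf

theorem contDiff_expI_θ : ContDiff ℝ ∞ fun q : ℝ × ℝ => expI (p.θ q.1 q.2) :=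
  contDiff_expI.comp (g := expI) (f := fun q : ℝ × ℝ => p.θ q.1 q.2) (by unfold θ; fun_prop)

theorem contDiff_re {f : ℝ × ℝ → ℂ} (hf : ContDiff ℝ ∞ f) : ContDiff ℝ ∞ fun q => (f q).re :=
  Complex.reCLM.contDiff.comp hf

theorem contDiff_VS₁ : ContDiff ℝ ∞ fun q : ℝ × ℝ => p.VS₁ q.1 q.2 := by
  have hof : ContDiff ℝ ∞ (fun y : ℝ => (y : ℂ)) := Complex.ofRealCLM.contDiff
  have h₁ (b : ℝ) : ContDiff ℝ ∞ fun q : ℝ × ℝ => coshI (p.k₁ * q.1 + 2 * p.k₂ * q.2) b :=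
    contDiff_coshI_comp (by fun_prop) b
  have h₂ (b : ℝ) : ContDiff ℝ ∞ fun q : ℝ × ℝ => coshI (p.k₁ * q.1 - 2 * p.k₂ * q.2) b :=
    contDiff_coshI_comp (by fun_prop) b
  have h₃ (b : ℝ) : ContDiff ℝ ∞ fun q : ℝ × ℝ => coshI (p.k₁ * q.1) b :=
    contDiff_coshI_comp (by fun_prop) b
  have h₄ (b : ℝ) : ContDiff ℝ ∞ fun q : ℝ × ℝ => coshI (p.k₂ * q.2) b :=
    contDiff_coshI_comp (by fun_prop) b
  unfold VS₁
  refine (contDiff_const.mul ((contDiff_const.mul ((contDiff_const.mul (h₁ _)).add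
    (contDiff_const.mul (h₂ _)))).add (contDiff_const.mul (((contDiff_const.mul (h₃ _)).add
    (contDiff_const.mul (h₃ _))).add (contDiff_const.mul (h₃ _)))))).add
    (contDiff_const.mul ((contDiff_const.mul (h₃ _)).sub (hof.comp (contDiff_const.mul
    (contDiff_re ((h₄ _).mul contDiff_expI_θ))))))

theorem contDiff_VS₂ : ContDiff ℝ ∞ fun q : ℝ × ℝ => p.VS₂ q.1 q.2 := by
  have e : (fun q : ℝ × ℝ => p.VS₂ q.1 q.2)
      = (fun q : ℝ × ℝ => p.swap.VS₁ q.1 q.2) ∘ fun q => (q.2, q.1) :=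
    funext fun q => (p.swap_VS₁ q.1 q.2).symm
  rw [e]
  exact contDiff_VS₁.comp (contDiff_snd.prodMk contDiff_fst)

theorem contDiff_WS : ContDiff ℝ ∞ fun q : ℝ × ℝ => p.WS q.1 q.2 := by
  have h₁ : ContDiff ℝ ∞ fun q : ℝ × ℝ => coshI (p.k₁ * q.1 + p.k₂ * q.2) (p.ϖ₁ - p.ϖ₂) :=
    contDiff_coshI_comp (by fun_prop) _
  have h₂ : ContDiff ℝ ∞ fun q : ℝ × ℝ => coshI (p.k₁ * q.1 - p.k₂ * q.2) (p.ϖ₁ + p.ϖ₂) :=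
    contDiff_coshI_comp (by fun_prop) _
  have hre := contDiff_re ((contDiff_expI_θ (p := p)).mul
    ((contDiff_const (c := ((√(p.Γ / p.Υ) : ℝ) : ℂ)).mul h₁).add
      (contDiff_const (c := ((1 / √(p.Γ * p.Υ) : ℝ) : ℂ)).mul h₂)))
  have hcos : ContDiff ℝ ∞ fun q : ℝ × ℝ => Real.cos (2 * p.θ q.1 q.2) := by
    unfold θ; fun_prop
  unfold WS
  exact ContDiff.sub (ContDiff.add (ContDiff.add (by fun_prop) (contDiff_const.mul hcos))
    contDiff_const) (contDiff_const.mul hre)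

theorem sasaSatsuma_hasProfile (h : p.Regular) (hc : p.c₁ ≠ p.c₂) :
    HasProfile p.sasaSatsuma (sasaSatsumaData h) :=
  hasProfile_pair (by rw [norm_neg]; exact norm_sqrt_two_div_two_sq)
    (p.contDiff_superpose contDiff_VS₁ contDiff_VS₂ contDiff_WS (WS_ne h hc))
    (sasaSatsumaData_conj h) (sasaSatsuma_eq h hc)

theorem sasaSatsuma_momentum (h : p.Regular) (hc : p.c₁ ≠ p.c₂) (t : ℝ) :
    momentum p.sasaSatsuma t = p.k₁ + p.k₂ := by
  rw [(sasaSatsuma_hasProfile h hc).momentum_eq, Fin.sum_univ_four]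
  simp [sasaSatsumaData, l₁, l₂]; ring

theorem sasaSatsuma_energy (h : p.Regular) (hc : p.c₁ ≠ p.c₂) (t : ℝ) :
    energy p.sasaSatsuma t
      = p.k₁ * (p.k₁ ^ 2 - 3 * p.κ₁ ^ 2) + p.k₂ * (p.k₂ ^ 2 - 3 * p.κ₂ ^ 2) := by
  rw [(sasaSatsuma_hasProfile h hc).energy_eq, Fin.sum_univ_four]
  simp only [sasaSatsumaData, l₁, l₂, Matrix.cons_val_zero, Matrix.cons_val_one, Matrix.cons_val,
    conj_cube_re, cube_re]
  ring

/-- The limits at the two ends are the lowest and the highest coefficient of the determinant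
expansion. Both equal Γ/2 once the amplitudes are included, which gives the ratio. -/
theorem sasaSatsumaData_det (h : p.Regular) (t : ℝ) :
    (sasaSatsumaData h t).Mbot.det.re
      = ‖p.a₁‖ ^ 4 * ‖p.a₂‖ ^ 4 * (sasaSatsumaData h t).Mtop.det.re := by
  have hb : (poles h).c₀ * (sasaSatsumaData h t).Mbot.det = (poles h).Γ / 2 := by
    have e : (sasaSatsumaData h t).Mbot = (poles h).lyapunov 0 0 0 0 := by
      ext i j
      fin_cases i <;> fin_cases j <;>
        simp [SolitonData.Mbot, lyapunovMatrix, sasaSatsumaData, PolePair.lyapunov, poles,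
          PolePair.c₁₁, PolePair.c₁₂, PolePair.c₂₁, PolePair.c₂₂, add_comm]
    rw [e, PolePair.det_fin_four, ← (poles h).det_coeff_one]
    simp only [PolePair.lyapunov, Matrix.of_apply, Matrix.cons_val', Matrix.cons_val_zero,
      Matrix.cons_val_one, Matrix.cons_val_fin_one, Matrix.cons_val, Fin.isValue]
    ring
  have ht : (poles h).c₀ * (sasaSatsumaData h t).Mtop.det
      * ((poles h).A₁ * (poles h).A₂ * (poles h).B₁ * (poles h).B₂) = (poles h).Γ / 2 := by
    have e : (sasaSatsumaData h t).Mtop = !![(poles h).c₁₁, (poles h).c₁₂, (poles h).d₁₁,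
        (poles h).d₁₂; (poles h).c₂₁, (poles h).c₂₂, (poles h).d₁₂, (poles h).d₂₂;
        (poles h).e₁₁, (poles h).e₁₂, (poles h).c₁₁, (poles h).c₂₁;
        (poles h).e₁₂, (poles h).e₂₂, (poles h).c₁₂, (poles h).c₂₂] := by
      ext i j
      fin_cases i <;> fin_cases j <;>
        simp [SolitonData.Mtop, lyapunovMatrix, sasaSatsumaData, poles, PolePair.c₁₁, PolePair.c₁₂,
          PolePair.c₂₁, PolePair.c₂₂, PolePair.d₁₁, PolePair.d₁₂, PolePair.d₂₂, PolePair.e₁₁,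
          PolePair.e₁₂, PolePair.e₂₂, add_comm]
    rw [e, PolePair.det_fin_four, ← (poles h).det_coeff_Z₁Z₁Z₂Z₂Y₁Y₁Y₂Y₂]
    simp only [Matrix.of_apply, Matrix.cons_val', Matrix.cons_val_zero,
      Matrix.cons_val_one, Matrix.cons_val_fin_one, Matrix.cons_val, Fin.isValue]
    ring
  have hn : (poles h).A₁ * (poles h).A₂ * (poles h).B₁ * (poles h).B₂
      = ((‖p.a₁‖ ^ 4 * ‖p.a₂‖ ^ 4 : ℝ) : ℂ) := by
    have e (z : ℂ) : (‖z‖ : ℂ) ^ 4 = z ^ 2 * conj z ^ 2 := by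
      rw [show 4 = 2 * 2 from rfl, pow_mul, norm_sq_eq, mul_pow]
    push_cast
    rw [e, e, a₁_sq h, a₂_sq h, conj_a₁_sq h, conj_a₂_sq h]
    ring
  rw [← ht, hn, mul_assoc] at hb
  rw [mul_left_cancel₀ (poles_c₀_ne h) hb, mul_comm, Complex.re_ofReal_mul]

/-- The logarithms of |a₁| and |a₂| from `sasaSatsumaData_det` cancel those in the P_j, leaving only
the positions c_j t. -/
theorem sasaSatsuma_moment (h : p.Regular) (hc : p.c₁ ≠ p.c₂) (t : ℝ) :
    ∫ x, momentDensity p.sasaSatsuma t x = (p.k₁ * p.c₁ + p.k₂ * p.c₂) * t := by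
  have h1 := norm_ne_zero_iff.mpr (a₁_ne h)
  have h2 := norm_ne_zero_iff.mpr (a₂_ne h)
  rw [(sasaSatsuma_hasProfile h hc).moment_eq, sasaSatsumaData_det,
    Real.log_mul (mul_ne_zero (pow_ne_zero _ h1) (pow_ne_zero _ h2))
      (sasaSatsumaData h t).Mtop_det_re_ne,
    Real.log_mul (pow_ne_zero _ h1) (pow_ne_zero _ h2), Real.log_pow, Real.log_pow,
    Fin.sum_univ_four]
  simp only [sasaSatsumaData, Matrix.cons_val_zero, Matrix.cons_val_one, Matrix.cons_val,
    RCLike.norm_conj, log_norm_amplitude (a₁_ne h), log_norm_amplitude (a₂_ne h), l₁, l₂]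
  push_cast
  ring

end Params

namespace Params

variable {p : Params}

/-! ### Conserved integrals in terms of the kinematic parameters -/

theorem k₁_beta : p.k₁ = √3 * (p.β₁m + p.β₁p) / 2 := rfl
theorem k₂_beta : p.k₂ = √3 * (p.β₂m + p.β₂p) / 2 := rfl
theorem κ₁_beta : p.κ₁ = (p.β₁m - p.β₁p) / 2 := rfl
theorem κ₂_beta : p.κ₂ = (p.β₂m - p.β₂p) / 2 := rfl

/-- The asymptotic shifts, weighted by momentum, balance. This makes the Galilean energies of the
two asymptotic solitons cancel. -/
theorem k₁_mul_xH₁_add (h : p.Regular) : p.k₁ * p.xH₁ + p.k₂ * p.xH₂ = 0 := by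
  have h1 := h.k₁_pos.ne'
  have h2 := h.k₂_pos.ne'
  rw [xH₁, xH₂]
  field_simp
  ring

theorem k₁_mul_xS₁_add (h : p.Regular) : p.k₁ * p.xS₁ + p.k₂ * p.xS₂ = 0 := by
  have h1 := h.k₁_pos.ne'
  have h2 := h.k₂_pos.ne'
  rw [xS₁, xS₂]
  field_simp
  ring

theorem speed_ratio_beta :
    (p.k₁ * p.c₁ + p.k₂ * p.c₂) / (p.k₁ + p.k₂)
      = ((p.β₁m + p.β₁p) * p.c₁ + (p.β₂m + p.β₂p) * p.c₂)
        / (p.β₁m + p.β₁p + p.β₂m + p.β₂p) := by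
  have h3 : √3 / 2 ≠ 0 := by positivity
  rw [← mul_div_mul_left _ (p.β₁m + p.β₁p + p.β₂m + p.β₂p) h3, k₁_beta, k₂_beta]
  congr 1 <;> ring

/-- The motion of the center of momentum, given the momentum, the energy and the first moment up
to a common factor `ε`. -/
theorem centerOfMomentum_and_speed {ε : ℝ} (hε : ε ≠ 0) {u u₁ u₂ : ℝ → ℝ → ℂ}
    {t : ℝ} (hP : momentum u t = ε * (p.k₁ + p.k₂)) (hP₁ : momentum u₁ t = ε * p.k₁)
    (hP₂ : momentum u₂ t = ε * p.k₂) (hE : energy u t = ε * (p.k₁ * p.c₁ + p.k₂ * p.c₂))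
    (hX : ∫ x, momentDensity u t x = ε * (p.k₁ * p.c₁ + p.k₂ * p.c₂) * t) :
    centerOfMomentum u t = energy u t / momentum u t * t ∧
      energy u t / momentum u t =
        (momentum u₁ t * p.c₁ + momentum u₂ t * p.c₂) / (momentum u₁ t + momentum u₂ t) ∧
      energy u t / momentum u t =
        ((p.β₁m + p.β₁p) * p.c₁ + (p.β₂m + p.β₂p) * p.c₂)
          / (p.β₁m + p.β₁p + p.β₂m + p.β₂p) := by
  rw [centerOfMomentum, hX, hE, hP, hP₁, hP₂]
  refine ⟨by ring, by congr 1 <;> ring, ?_⟩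
  rw [mul_div_mul_left _ _ hε, speed_ratio_beta]

end Params

end OscSoliton

end

/-! ### The conservation laws for both equations. -/

theorem theorem2 (p : Params) (hc : p.c₁ ≠ p.c₂) (hν₁ : p.ν₁ ≠ 0) (hν₂ : p.ν₂ ≠ 0)
    (hkin₁ : 0 < (p.c₁ / 3) ^ 3 + (p.ν₁ / 2) ^ 2)
    (hkin₂ : 0 < (p.c₂ / 3) ^ 3 + (p.ν₂ / 2) ^ 2)
    (σ : ℝ) (hσ : σ = 1 ∨ σ = -1) :
    -- Hirota
    (∀ u u₁ u₂ : ℝ → ℝ → ℂ,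
      u = p.hirota → u₁ = p.hirotaAsymptotic₁ σ → u₂ = p.hirotaAsymptotic₂ σ →
      HasFiniteIntegrals u ∧ HasFiniteIntegrals u₁ ∧ HasFiniteIntegrals u₂ ∧ ∀ t : ℝ,
        -- angular twist
        (angularTwist u t = angularTwist u₁ t + angularTwist u₂ t ∧
          angularTwist u₁ t = 1 / 2 * p.κ₁ * p.k₁ ∧
          angularTwist u₂ t = 1 / 2 * p.κ₂ * p.k₂ ∧
          angularTwist u t = √3 * (p.β₁m ^ 2 - p.β₁p ^ 2 + p.β₂m ^ 2 - p.β₂p ^ 2) / 8) ∧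
        -- momentum
        (momentum u t = momentum u₁ t + momentum u₂ t ∧
          momentum u₁ t = 1 / 2 * p.k₁ ∧
          momentum u₂ t = 1 / 2 * p.k₂ ∧
          momentum u t = √3 * (p.β₁m + p.β₁p + p.β₂m + p.β₂p) / 4) ∧
        -- energy
        (energy u t = energy u₁ t + energy u₂ t ∧
          energy u₁ t = 1 / 2 * p.k₁ * (p.k₁ ^ 2 - 3 * p.κ₁ ^ 2) ∧
          energy u₂ t = 1 / 2 * p.k₂ * (p.k₂ ^ 2 - 3 * p.κ₂ ^ 2) ∧
          energy u t = √3 * ((p.β₁m + p.β₁p) * p.c₁ + (p.β₂m + p.β₂p) * p.c₂) / 4) ∧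
        -- Galilean energy
        (galileanEnergy u t = galileanEnergy u₁ t + galileanEnergy u₂ t ∧
          galileanEnergy u₁ t = -σ * (1 / 2 * p.k₁ * p.xH₁) ∧
          galileanEnergy u₂ t = -σ * (1 / 2 * p.k₂ * p.xH₂) ∧
          galileanEnergy u t = 0) ∧
        -- center of momentum and its speed
        (centerOfMomentum u t = energy u t / momentum u t * t ∧
          energy u t / momentum u t =
            (momentum u₁ t * p.c₁ + momentum u₂ t * p.c₂) / (momentum u₁ t + momentum u₂ t) ∧
          energy u t / momentum u t =
            ((p.β₁m + p.β₁p) * p.c₁ + (p.β₂m + p.β₂p) * p.c₂)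
              / (p.β₁m + p.β₁p + p.β₂m + p.β₂p))) ∧
    -- Sasa-Satsuma
    (∀ u u₁ u₂ : ℝ → ℝ → ℂ,
      u = p.sasaSatsuma → u₁ = p.sasaSatsumaAsymptotic₁ σ → u₂ = p.sasaSatsumaAsymptotic₂ σ →
      HasFiniteIntegrals u ∧ HasFiniteIntegrals u₁ ∧ HasFiniteIntegrals u₂ ∧ ∀ t : ℝ,
        -- momentum
        (momentum u t = momentum u₁ t + momentum u₂ t ∧
          momentum u₁ t = p.k₁ ∧
          momentum u₂ t = p.k₂ ∧
          momentum u t = √3 * (p.β₁m + p.β₁p + p.β₂m + p.β₂p) / 2) ∧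
        -- energy
        (energy u t = energy u₁ t + energy u₂ t ∧
          energy u₁ t = p.k₁ * (p.k₁ ^ 2 - 3 * p.κ₁ ^ 2) ∧
          energy u₂ t = p.k₂ * (p.k₂ ^ 2 - 3 * p.κ₂ ^ 2) ∧
          energy u t = √3 * ((p.β₁m + p.β₁p) * p.c₁ + (p.β₂m + p.β₂p) * p.c₂) / 2) ∧
        -- Galilean energy
        (galileanEnergy u t = galileanEnergy u₁ t + galileanEnergy u₂ t ∧
          galileanEnergy u₁ t = -σ * (p.k₁ * p.xS₁) ∧
          galileanEnergy u₂ t = -σ * (p.k₂ * p.xS₂) ∧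
          galileanEnergy u t = 0) ∧
        -- center of momentum and its speed
        (centerOfMomentum u t = energy u t / momentum u t * t ∧
          energy u t / momentum u t =
            (momentum u₁ t * p.c₁ + momentum u₂ t * p.c₂) / (momentum u₁ t + momentum u₂ t) ∧
          energy u t / momentum u t =
            ((p.β₁m + p.β₁p) * p.c₁ + (p.β₂m + p.β₂p) * p.c₂)
              / (p.β₁m + p.β₁p + p.β₂m + p.β₂p))) := by
  have h : p.Regular := Params.regular hc hν₁ hν₂ hkin₁ hkin₂
  have hκ₁ : p.κ₁ ≠ 0 := waveNumber_ne_zero hν₁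
  have hκ₂ : p.κ₂ ≠ 0 := waveNumber_ne_zero hν₂
  -- These relations turn the energies k(k² - 3κ²) into kc, the momentum-weighted speeds.
  have hs₁ : p.c₁ = p.k₁ ^ 2 - 3 * p.κ₁ ^ 2 := speed_eq hkin₁
  have hs₂ : p.c₂ = p.k₂ ^ 2 - 3 * p.κ₂ ^ 2 := speed_eq hkin₂
  constructor
  · rintro u u₁ u₂ rfl rfl rfl
    have hu := Params.hirota_hasProfile h hc
    refine ⟨hu.hasFiniteIntegrals (by norm_num),
      (hirotaOne_hasProfile h.k₁_pos _ _).hasFiniteIntegrals (by norm_num),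
      (hirotaOne_hasProfile h.k₂_pos _ _).hasFiniteIntegrals (by norm_num), fun t => ?_⟩
    have hP := Params.hirota_momentum h hc t
    have hP₁ : momentum (p.hirotaAsymptotic₁ σ) t = 1 / 2 * p.k₁ :=
      hirotaOne_momentum h.k₁_pos _ _ t
    have hP₂ : momentum (p.hirotaAsymptotic₂ σ) t = 1 / 2 * p.k₂ :=
      hirotaOne_momentum h.k₂_pos _ _ t
    have hE := Params.hirota_energy h hc t
    have hE₁ : energy (p.hirotaAsymptotic₁ σ) t = 1 / 2 * p.k₁ * (p.k₁ ^ 2 - 3 * p.κ₁ ^ 2) :=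
      hirotaOne_energy h.k₁_pos _ _ t
    have hE₂ : energy (p.hirotaAsymptotic₂ σ) t = 1 / 2 * p.k₂ * (p.k₂ ^ 2 - 3 * p.κ₂ ^ 2) :=
      hirotaOne_energy h.k₂_pos _ _ t
    have hW := Params.hirota_angularTwist h hc t
    have hW₁ : angularTwist (p.hirotaAsymptotic₁ σ) t = 1 / 2 * p.κ₁ * p.k₁ :=
      hirotaOne_angularTwist h.k₁_pos _ _ t
    have hW₂ : angularTwist (p.hirotaAsymptotic₂ σ) t = 1 / 2 * p.κ₂ * p.k₂ :=
      hirotaOne_angularTwist h.k₂_pos _ _ t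
    have hX := Params.hirota_moment h hc t
    have hC₁ : galileanEnergy (p.hirotaAsymptotic₁ σ) t = -σ * (1 / 2 * p.k₁ * p.xH₁) :=
      (hirotaOne_galileanEnergy hkin₁ _ _ t).trans (by change -(1 / 2 * p.k₁ * _) = _; ring)
    have hC₂ : galileanEnergy (p.hirotaAsymptotic₂ σ) t = -σ * (1 / 2 * p.k₂ * p.xH₂) :=
      (hirotaOne_galileanEnergy hkin₂ _ _ t).trans (by change -(1 / 2 * p.k₂ * _) = _; ring)
    -- The first moment equals t times the energy.
    have hC : galileanEnergy p.hirota t = 0 := by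
      rw [hu.galileanEnergy_eq, hX, hE, ← hs₁, ← hs₂]; ring
    refine ⟨⟨by rw [hW, hW₁, hW₂], hW₁, hW₂, ?_⟩, ⟨by rw [hP, hP₁, hP₂], hP₁, hP₂, ?_⟩,
      ⟨by rw [hE, hE₁, hE₂], hE₁, hE₂, ?_⟩, ⟨?_, hC₁, hC₂, hC⟩, ?_⟩
    · rw [hW, Params.k₁_beta, Params.k₂_beta, Params.κ₁_beta, Params.κ₂_beta]; ring
    · rw [hP, Params.k₁_beta, Params.k₂_beta]; ring
    · rw [hE, ← hs₁, ← hs₂, Params.k₁_beta, Params.k₂_beta]; ring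
    · rw [hC, hC₁, hC₂]
      linear_combination σ / 2 * Params.k₁_mul_xH₁_add h
    · refine Params.centerOfMomentum_and_speed (ε := 1 / 2) (by norm_num) ?_ hP₁ hP₂ ?_ ?_
      · rw [hP]; ring
      · rw [hE, ← hs₁, ← hs₂]; ring
      · rw [hX]; ring
  · rintro u u₁ u₂ rfl rfl rfl
    have hu := Params.sasaSatsuma_hasProfile h hc
    refine ⟨hu.hasFiniteIntegrals (by norm_num),
      (sasaSatsumaOne_hasProfile h.k₁_pos hκ₁ _ _).hasFiniteIntegrals (by norm_num),
      (sasaSatsumaOne_hasProfile h.k₂_pos hκ₂ _ _).hasFiniteIntegrals (by norm_num), fun t => ?_⟩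
    have hP := Params.sasaSatsuma_momentum h hc t
    have hP₁ : momentum (p.sasaSatsumaAsymptotic₁ σ) t = p.k₁ :=
      sasaSatsumaOne_momentum h.k₁_pos hκ₁ _ _ t
    have hP₂ : momentum (p.sasaSatsumaAsymptotic₂ σ) t = p.k₂ :=
      sasaSatsumaOne_momentum h.k₂_pos hκ₂ _ _ t
    have hE := Params.sasaSatsuma_energy h hc t
    have hE₁ : energy (p.sasaSatsumaAsymptotic₁ σ) t = p.k₁ * (p.k₁ ^ 2 - 3 * p.κ₁ ^ 2) :=
      sasaSatsumaOne_energy h.k₁_pos hκ₁ _ _ t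
    have hE₂ : energy (p.sasaSatsumaAsymptotic₂ σ) t = p.k₂ * (p.k₂ ^ 2 - 3 * p.κ₂ ^ 2) :=
      sasaSatsumaOne_energy h.k₂_pos hκ₂ _ _ t
    have hX := Params.sasaSatsuma_moment h hc t
    have hC₁ : galileanEnergy (p.sasaSatsumaAsymptotic₁ σ) t = -σ * (p.k₁ * p.xS₁) :=
      (sasaSatsumaOne_galileanEnergy hkin₁ hν₁ _ _ t).trans (by change -(p.k₁ * _) = _; ring)
    have hC₂ : galileanEnergy (p.sasaSatsumaAsymptotic₂ σ) t = -σ * (p.k₂ * p.xS₂) :=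
      (sasaSatsumaOne_galileanEnergy hkin₂ hν₂ _ _ t).trans (by change -(p.k₂ * _) = _; ring)
    have hC : galileanEnergy p.sasaSatsuma t = 0 := by
      rw [hu.galileanEnergy_eq, hX, hE, ← hs₁, ← hs₂]; ring
    refine ⟨⟨by rw [hP, hP₁, hP₂], hP₁, hP₂, ?_⟩, ⟨by rw [hE, hE₁, hE₂], hE₁, hE₂, ?_⟩,
      ⟨?_, hC₁, hC₂, hC⟩, ?_⟩
    · rw [hP, Params.k₁_beta, Params.k₂_beta]; ring
    · rw [hE, ← hs₁, ← hs₂, Params.k₁_beta, Params.k₂_beta]; ring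
    · rw [hC, hC₁, hC₂]
      linear_combination σ * Params.k₁_mul_xS₁_add h
    · refine Params.centerOfMomentum_and_speed one_ne_zero ?_ (by rw [hP₁, one_mul])
        (by rw [hP₂, one_mul]) ?_ ?_
      · rw [hP, one_mul]
      · rw [hE, ← hs₁, ← hs₂, one_mul]
      · rw [hX, one_mul]
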